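/- **Theorem (variants of the parabolic maximum principle).** Let $d\ge 1$; $S^{d-1}\subset\mathbb R^d$ is the unit sphere. (1) For a function $g$ on a convex set $A\subset\mathbb R^d$ put $A_t=\{y\in A: g(y)\le t\}$ and let $\mathcal C_{g,l}$ be the set of all $x\in\operatorname{Int}A$ such that $x\in A_t\cap\partial\operatorname{conv}(A_t)$ for some $t\in\mathbb R$. There is a constant $C=C(d)$, depending only on $d$, such that for every non-empty bounded convex set $A\subset\mathbb R^d$ and every function $v$ that is continuous on $\overline A$ and twice continuously differentiable in $\operatorname{Int}A$, $$\sup_{A} v\le \sup_{\partial A} v + C(d)\int_{\mathcal C_{-v,l}}|\nabla v|\,K\,dx\qquad(\text{the integral may be }+\infty).$$ Here $K(x)$ is the Gauss curvature at $x$ of the boundary of $D=\operatorname{conv}\{y\in A: v(x)\le v(y)\}$, defined as follows. Let $H(\theta)=\sup_{z\in D}\langle\theta,z\rangle$ be the support function of $D$. If $D$ has a unique unit outer normal $n$ at $x$, $H|_{S^{d-1}}$ is twice differentiable at $n$ in the sense of Alexandrov (that is, it has a second order Taylor expansion at $n$, with Hessian $D^2_\theta H$), and $\det(H\cdot\mathrm{Id}+D^2_\theta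 H)(n)\neq 0$, then $K(x)=1/\det(H\cdot\mathrm{Id}+D^2_\theta H)(n)$; otherwise $K(x)=0$. (2) Let $S^{d-1}_+=\{\theta\in S^{d-1}:\theta_d\ge 0\}$, $\partial S^{d-1}_+=\{\theta\in S^{d-1}:\theta_d=0\}$, and let $Q\subset S^{d-1}_+$ be non-empty and spherically convex (with any two non-antipodal points it contains the shortest great circle arc joining them), at positive distance from $\partial S^{d-1}_+$. There are constants $C_1,C_2>0$, depending only on $d$ and $Q$, such that the following holds. Let $0\le R_1\le R_2$, $$\Omega=\{r\theta: R_1\le r\le R_2,\ \theta\in Q\},\qquad \partial_p\Omega=\{R_2\theta:\theta\in Q\}\cup\{r\theta: R_1\le r\le R_2,\ \theta\in\partial Q\},$$ where $\partial Q$ is the boundary of $Q$ relative to $S^{d-1}$, and let $f$ be continuous on $\overline\Omega$ and twice continuously differentiable in the interior of $\Omega$, with $\sup_{\partial_p\Omega}f\ge 0$. Then $$\sup_\Omega f\le C_1\sup_{\partial_p\Omega}f+C_2\Bigl[\int_{\Gamma_f}\frac{|f_r\det(f\cdot\mathrm{Id}+D^2_\theta f)|}{r^{d-1}}\,dx\Bigr]^{1/d}\qquad(\text{the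 integral may be }+\infty),$$ where $r=|x|$, $f_r$ is the radial derivative, $D^2_\theta f$ at $x=rn$ is the Hessian at $n$ of $\theta\mapsto f(r\theta)$ on the unit sphere $S^{d-1}$, and $\Gamma_f=\{x\in\Omega: f_r\le 0,\ f\cdot\mathrm{Id}+D^2_\theta f\le 0\}$. -/

import Mathlib

open scoped Topology Gradient NNReal ENNReal

noncomputable section

/-! ### Second derivatives on the unit sphere -/

/-- `h` has at `x` the second order expansion
`h (x + w) = h x + ⟪g, w⟫ + ½ ⟪B w, w⟫ + o(|w|²)` with a symmetric operator `B`, that is, `h` is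
twice differentiable at `x` in the sense of Alexandrov, with gradient `g` and Hessian `B`. -/
def HasAlexandrovHessianAt {F : Type*} [NormedAddCommGroup F] [InnerProductSpace ℝ F]
    (h : F → ℝ) (x g : F) (B : F →L[ℝ] F) : Prop :=
  (B : F →ₗ[ℝ] F).IsSymmetric ∧
    (fun w : F => h (x + w) - h x - inner ℝ g w - inner ℝ (B w) w / 2)
      =o[𝓝 0] fun w : F => ‖w‖ ^ 2

/-- The tangent space `n^⊥` of the unit sphere at `n`. -/
abbrev SphereTangent {d : ℕ} (n : EuclideanSpace ℝ (Fin d)) :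
    Submodule ℝ (EuclideanSpace ℝ (Fin d)) :=
  (Submodule.span ℝ {n})ᗮ

/-- The local parametrization `w ↦ w + √(1 - |w|²) n` of the unit sphere near the unit vector `n`,
with `w ∈ n^⊥`. The first derivatives of the metric vanish at `w = 0` in these coordinates, hence
the matrix of second derivatives at `w = 0` of a function written in them is its Hessian on the
sphere at `n`. -/
def sphereChart {d : ℕ} (n : EuclideanSpace ℝ (Fin d)) (w : SphereTangent n) :
    EuclideanSpace ℝ (Fin d) :=
  (w : EuclideanSpace ℝ (Fin d)) + Real.sqrt (1 - ‖w‖ ^ 2) • n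

/-- `B` is the Hessian at `n`, in the sense of Alexandrov, of the restriction of `u` to the unit
sphere. -/
def HasSphericalAlexandrovHessianAt {d : ℕ} (u : EuclideanSpace ℝ (Fin d) → ℝ)
    (n : EuclideanSpace ℝ (Fin d)) (B : SphereTangent n →L[ℝ] SphereTangent n) : Prop :=
  ∃ g : SphereTangent n, HasAlexandrovHessianAt (fun w => u (sphereChart n w)) 0 g B

/-- The classical Hessian at `n` of the restriction of `u` to the unit sphere, as an operator on the
tangent space (derivative of the gradient). -/
def sphericalHessian {d : ℕ} (u : EuclideanSpace ℝ (Fin d) → ℝ) (n : EuclideanSpace ℝ (Fin d)) :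
    SphereTangent n →L[ℝ] SphereTangent n :=
  fderiv ℝ (fun w : SphereTangent n => ∇ (fun z : SphereTangent n => u (sphereChart n z)) w) 0

/-! ### Gauss curvature of the boundary of a convex set -/

/-- The support function `H_S(p) = sup_{x ∈ S} ⟪p, x⟫`. -/
def convexSupportFunction {d : ℕ} (S : Set (EuclideanSpace ℝ (Fin d)))
    (p : EuclideanSpace ℝ (Fin d)) : ℝ :=
  sSup ((fun x => inner ℝ p x) '' S)

/-- `n` is a unit outer normal to `S` at `x`. -/
def IsUnitOuterNormal {d : ℕ} (S : Set (EuclideanSpace ℝ (Fin d)))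
    (x n : EuclideanSpace ℝ (Fin d)) : Prop :=
  ‖n‖ = 1 ∧ ∀ y ∈ S, inner ℝ n y ≤ inner ℝ n x

/-- `k = 1 / det (H · Id + D²_θ H)(n)`, where `H` is the support function of `S`, `n` is the unique
unit outer normal to `S` at `x`, `H` is twice differentiable at `n` on the sphere in the sense of
Alexandrov, and the determinant does not vanish. -/
def IsGaussCurvatureAt {d : ℕ} (S : Set (EuclideanSpace ℝ (Fin d)))
    (x : EuclideanSpace ℝ (Fin d)) (k : ℝ) : Prop :=
  ∃ (n : EuclideanSpace ℝ (Fin d)) (B : SphereTangent n →L[ℝ] SphereTangent n),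
    (∀ n', IsUnitOuterNormal S x n' ↔ n' = n) ∧
    HasSphericalAlexandrovHessianAt (convexSupportFunction S) n B ∧
    (convexSupportFunction S n • ContinuousLinearMap.id ℝ (SphereTangent n) + B).det ≠ 0 ∧
    k = 1 / (convexSupportFunction S n • ContinuousLinearMap.id ℝ (SphereTangent n) + B).det

open Classical in
/-- The Gauss curvature of the boundary of the convex set `S` at `x ∈ ∂S`; it is `0` where the
normal is unique and the support function is not twice differentiable there. (The value at the
remaining points, where the curvature is undefined, is set to `0` too. A contact point `x` of a
superlevel set `{v x ≤ v y}` of a `C²` function with `∇ v x ≠ 0` is never such a point, because the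
superlevel set contains a ball with `x` on its boundary and has a unique normal there.) -/
def convexGaussCurvature {d : ℕ} (S : Set (EuclideanSpace ℝ (Fin d)))
    (x : EuclideanSpace ℝ (Fin d)) : ℝ :=
  if h : ∃ k, IsGaussCurvatureAt S x k then h.choose else 0

/-! ### Contact points of sublevel sets -/

/-- The sublevel set `A_t = {f ≤ t}` of a function on `A`. -/
def sublevelSet {d : ℕ} (A : Set (EuclideanSpace ℝ (Fin d))) (f : EuclideanSpace ℝ (Fin d) → ℝ)
    (t : ℝ) : Set (EuclideanSpace ℝ (Fin d)) :=
  {y | y ∈ A ∧ f y ≤ t}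

/-- `𝒞_{f,l}`: the points `x` of the interior of `A` with `x ∈ A_t ∩ ∂ conv(A_t)` for some `t`. -/
def levelContactSet {d : ℕ} (A : Set (EuclideanSpace ℝ (Fin d)))
    (f : EuclideanSpace ℝ (Fin d) → ℝ) : Set (EuclideanSpace ℝ (Fin d)) :=
  {x | x ∈ interior A ∧
    ∃ t : ℝ, x ∈ sublevelSet A f t ∧ x ∈ frontier (convexHull ℝ (sublevelSet A f t))}

/-- `K(x)`: the Gauss curvature at `x` of the boundary of `conv {y ∈ A : v x ≤ v y}`. -/
def superlevelHullCurvature {d : ℕ} (A : Set (EuclideanSpace ℝ (Fin d)))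
    (v : EuclideanSpace ℝ (Fin d) → ℝ) (x : EuclideanSpace ℝ (Fin d)) : ℝ :=
  convexGaussCurvature (convexHull ℝ {y | y ∈ A ∧ v x ≤ v y}) x

/-! ### Spherical cylinders -/

/-- The upper half `S^{d-1}_+` of the unit sphere. -/
def upperHemisphere (d : ℕ) [NeZero d] : Set (EuclideanSpace ℝ (Fin d)) :=
  {x | ‖x‖ = 1 ∧ 0 ≤ x ⟨d - 1, Nat.sub_one_lt (NeZero.ne d)⟩}

/-- The boundary `∂S^{d-1}_+` of the upper half of the unit sphere. -/
def equatorSphere (d : ℕ) [NeZero d] : Set (EuclideanSpace ℝ (Fin d)) :=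
  {x | ‖x‖ = 1 ∧ x ⟨d - 1, Nat.sub_one_lt (NeZero.ne d)⟩ = 0}

/-- With any two non-antipodal points, `Q` contains the shortest great circle arc between them. -/
def SphericallyConvex {d : ℕ} (Q : Set (EuclideanSpace ℝ (Fin d))) : Prop :=
  ∀ p ∈ Q, ∀ q ∈ Q, p + q ≠ 0 → ∀ a b : ℝ, 0 ≤ a → 0 ≤ b → 0 < a + b →
    (1 / ‖a • p + b • q‖) • (a • p + b • q) ∈ Q

/-- The boundary of `Q` relative to the unit sphere. -/
def sphereFrontier {d : ℕ} (Q : Set (EuclideanSpace ℝ (Fin d))) :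
    Set (EuclideanSpace ℝ (Fin d)) :=
  closure Q ∩ closure (Metric.sphere 0 1 \ Q)

/-- `{r θ : R₁ ≤ r ≤ R₂, θ ∈ Q}`. -/
def sphericalCylinder {d : ℕ} (R₁ R₂ : ℝ) (Q : Set (EuclideanSpace ℝ (Fin d))) :
    Set (EuclideanSpace ℝ (Fin d)) :=
  {x | ∃ r ∈ Set.Icc R₁ R₂, ∃ θ ∈ Q, x = r • θ}

/-- The parabolic boundary: the points `R₂ θ` with `θ ∈ Q`, and the points `r θ` with
`R₁ ≤ r ≤ R₂`, `θ ∈ ∂Q`. -/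
def parabolicBoundary {d : ℕ} (R₁ R₂ : ℝ) (Q : Set (EuclideanSpace ℝ (Fin d))) :
    Set (EuclideanSpace ℝ (Fin d)) :=
  {x | ∃ θ ∈ Q, x = R₂ • θ} ∪ {x | ∃ r ∈ Set.Icc R₁ R₂, ∃ θ ∈ sphereFrontier Q, x = r • θ}

/-- The radial derivative `f_r` at `x = r n`, with `r = |x|`. -/
def radialDeriv {d : ℕ} (f : EuclideanSpace ℝ (Fin d) → ℝ) (x : EuclideanSpace ℝ (Fin d)) : ℝ :=
  deriv (fun r : ℝ => f (r • ((1 / ‖x‖) • x))) ‖x‖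

/-- The operator `f · Id + D²_θ f` at `x = r n`, with `r = |x|`: here `D²_θ f` is the Hessian at `n`
of the function `θ ↦ f (r θ)` on the unit sphere. -/
def angularOperator {d : ℕ} (f : EuclideanSpace ℝ (Fin d) → ℝ) (x : EuclideanSpace ℝ (Fin d)) :
    SphereTangent ((1 / ‖x‖) • x) →L[ℝ] SphereTangent ((1 / ‖x‖) • x) :=
  f x • ContinuousLinearMap.id ℝ (SphereTangent ((1 / ‖x‖) • x)) +
    sphericalHessian (fun θ => f (‖x‖ • θ)) ((1 / ‖x‖) • x)

/-- `Γ_f = {x ∈ Ω : f_r ≤ 0, f · Id + D²_θ f ≤ 0}`. -/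
def parabolicContactSet {d : ℕ} (Ω : Set (EuclideanSpace ℝ (Fin d)))
    (f : EuclideanSpace ℝ (Fin d) → ℝ) : Set (EuclideanSpace ℝ (Fin d)) :=
  {x | x ∈ Ω ∧ radialDeriv f x ≤ 0 ∧
    ∀ w : SphereTangent ((1 / ‖x‖) • x), inner ℝ (angularOperator f x w) w ≤ 0}

end

/-! Both estimates follow the Aleksandrov–Bakelman scheme: a map built from first derivatives covers
a ball whose radius is proportional to the excess of the function over its boundary supremum, while
the area formula bounds the volume of that ball by the integral of the Jacobian over contact points.

For level sets, let `t₀` be the boundary supremum, `t₁` the maximum and `M = t₁ - t₀ > 0`. The map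
is `x ↦ (v x + c) ν`, with `ν = -∇v/|∇v|` the outer normal of the superlevel set and `c = M - t₀`.
Its Jacobian is, up to sign, `|∇v| (v + c)^(d-1)` times the determinant of the shape operator of the
level surface (`exists_hasFDerivAt_levelNormalMap`). Given `p` with `M < |p| < 2M`, maximize `⟪p,
·⟫` over `{v ≥ |p| - c}`. A maximizer is an interior point on the level `|p| - c`, and when it is
not critical its normal is `p/|p|`, so it is sent to `p`. Hence almost all of the shell is covered
(`volume_le_volume_image_levelNormalMap`). The exceptions are those `p` with a critical or a
non-unique maximizer. They are null in the space of pairs `(p, t)`, because the support function is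
monotone in `t` and Lipschitz in `p`, and a scaling argument carries this to the hypersurface `t =
|p| - c`. At the remaining contact points `K` must be identified through the support function of the
hull. If the shape operator `W` is invertible, the superlevel set is squeezed near `x` between
paraboloids, whose support functions are given by Legendre duality. So `H·Id + D²H = W⁻¹` and `K =
det W` (`superlevelHullCurvature_eq_det_shapeOperator`). If `det W = 0`, the Jacobian is zero and
`K` plays no role.

For spherical cylinders, the map sends `x` to the gradient of the one-homogeneous extension of `f`
restricted to the sphere through `x`, with Jacobian `f_r det(f·Id + D²_θ f)/r^(d-1)`
(`exists_hasFDerivAt_sphericalGradientMap`). If a linear function `⟪X, ·⟫` dominates `f` on the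
parabolic boundary but lies below its maximum, then at the largest radius where it fails to lie
strictly above `f` it touches `f` from above, and the map takes the value `X` there
(`exists_mem_sphericalContactSet`). Since `Q` stays away from the equator, such `X` fill a ball of
radius comparable to the excess of `f`. -/

open Set Filter MeasureTheory

/-! ### Linear algebra relative to a unit vector -/

section LinearAlgebra

variable {E : Type*} [NormedAddCommGroup E] [InnerProductSpace ℝ E]

theorem sub_inner_smul_mem_orthogonal {n : E} (hn : ‖n‖ = 1) (x : E) :
    x - inner ℝ n x • n ∈ (Submodule.span ℝ {n})ᗮ := by
  rw [Submodule.mem_orthogonal_singleton_iff_inner_right]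
  simp [inner_sub_right, inner_smul_right, hn]

theorem inner_left_orthogonal_singleton {n : E} (k : (Submodule.span ℝ {n})ᗮ) :
    inner ℝ n (k : E) = 0 :=
  Submodule.mem_orthogonal_singleton_iff_inner_right.1 k.2

theorem inner_right_orthogonal_singleton {n : E} (k : (Submodule.span ℝ {n})ᗮ) :
    inner ℝ (k : E) n = 0 :=
  Submodule.mem_orthogonal_singleton_iff_inner_left.1 k.2

/-- The component of a vector orthogonal to a unit vector `n`. -/
noncomputable def orthogonalPart (n : E) : E →L[ℝ] (Submodule.span ℝ {n})ᗮ :=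
  (Submodule.span ℝ {n})ᗮ.orthogonalProjectionOnto

theorem coe_orthogonalPart {n : E} (hn : ‖n‖ = 1) (x : E) :
    (orthogonalPart n x : E) = x - inner ℝ n x • n := by
  have h := Submodule.starProjection_orthogonal_val (K := Submodule.span ℝ {n}) x
  rw [Submodule.starProjection_unit_singleton ℝ hn] at h
  exact h

theorem inner_orthogonalPart {n : E} (hn : ‖n‖ = 1) (x : E) (k : (Submodule.span ℝ {n})ᗮ) :
    inner ℝ (orthogonalPart n x) k = inner ℝ x (k : E) := by
  rw [Submodule.coe_inner, coe_orthogonalPart hn, inner_sub_left, inner_smul_left,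
    inner_left_orthogonal_singleton]
  simp

/-- In a splitting along `n` and `n^⊥` the operator is block triangular: `n^⊥` is invariant, and on
the one-dimensional quotient it acts by the scalar `⟪n, L n⟫`. Both Jacobians are computed this way.
-/
theorem det_eq_inner_mul_det_of_map_orthogonal [FiniteDimensional ℝ E] (L : E →L[ℝ] E) {n : E}
    (hn : ‖n‖ = 1) (S : (Submodule.span ℝ {n})ᗮ →L[ℝ] (Submodule.span ℝ {n})ᗮ)
    (hS : ∀ k : (Submodule.span ℝ {n})ᗮ, L (k : E) = (S k : E)) : L.det = inner ℝ n (L n) * S.det := by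
  let W : Submodule ℝ E := (Submodule.span ℝ {n})ᗮ
  have hW : W = (Submodule.span ℝ {n})ᗮ := rfl
  have hle : W ≤ W.comap (L : E →ₗ[ℝ] E) := fun k hk => by
    have := (S ⟨k, hk⟩).2
    rw [← hS] at this
    exact this
  have hrank : Module.finrank ℝ (E ⧸ W) = 1 := by
    have h1 := Submodule.finrank_quotient_add_finrank W
    have h2 := Submodule.finrank_add_finrank_orthogonal (Submodule.span ℝ {n})
    have h3 : Module.finrank ℝ (Submodule.span ℝ {n}) = 1 :=
      finrank_span_singleton (by rintro rfl; simp at hn)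
    rw [← hW] at h2
    omega
  have hmk : ∀ x : E, W.mkQ x = inner ℝ n x • W.mkQ n := fun x => by
    rw [← map_smul, ← sub_eq_zero, ← map_sub]
    exact (Submodule.Quotient.mk_eq_zero W).2 (sub_inner_smul_mem_orthogonal hn x)
  have hQ : W.mapQ W (L : E →ₗ[ℝ] E) hle = inner ℝ n (L n) • LinearMap.id := by
    refine Submodule.linearMap_qext _ (LinearMap.ext fun x => ?_)
    have h1 := hmk (L x)
    have h2 := hmk (L n)
    have h3 : L x = inner ℝ n x • L n + L (x - inner ℝ n x • n) := by
      rw [map_sub, map_smul]; abel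
    have h4 : inner ℝ n (L (x - inner ℝ n x • n)) = 0 :=
      Submodule.mem_orthogonal_singleton_iff_inner_right.1
        (hle (sub_inner_smul_mem_orthogonal hn x))
    change W.mkQ (L x) = inner ℝ n (L n) • W.mkQ x
    rw [h1, hmk x, h3, inner_add_right, h4, inner_smul_right, smul_smul]
    ring_nf
  have hR : (L : E →ₗ[ℝ] E).restrict hle = (S : W →ₗ[ℝ] W) := by
    refine LinearMap.ext fun k => Subtype.ext ?_
    exact hS k
  change LinearMap.det (L : E →ₗ[ℝ] E) = inner ℝ n (L n) * LinearMap.det (S : W →ₗ[ℝ] W)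
  rw [LinearMap.det_eq_det_mul_det W _ hle, hQ, hR, LinearMap.det_smul, hrank]
  simp [mul_comm]

end LinearAlgebra

/-! ### Second order calculus -/

section Calculus

variable {E : Type*} [NormedAddCommGroup E] [InnerProductSpace ℝ E] [CompleteSpace E]

theorem contDiffAt_gradient {f : E → ℝ} {x : E} (hf : ContDiffAt ℝ 2 f x) :
    ContDiffAt ℝ 1 (∇ f) x := by
  have h : ContDiffAt ℝ 1 (fderiv ℝ f) x := hf.fderiv_right (by norm_num)
  exact (InnerProductSpace.toDual ℝ E).symm.toContinuousLinearEquiv.contDiff.contDiffAt.comp x h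

theorem eventually_hasGradientAt_of_contDiffAt {f : E → ℝ} {x : E} (hf : ContDiffAt ℝ 2 f x) :
    ∀ᶠ y in 𝓝 x, HasGradientAt f (∇ f y) y := by
  filter_upwards [hf.eventually (by simp)] with y hy
  exact (hy.differentiableAt (by norm_num)).hasGradientAt

theorem hasFDerivAt_gradient_of_contDiffAt {f : E → ℝ} {x : E} (hf : ContDiffAt ℝ 2 f x) :
    HasFDerivAt (∇ f) (fderiv ℝ (∇ f) x) x :=
  ((contDiffAt_gradient hf).differentiableAt (by norm_num)).hasFDerivAt

theorem isSymmetric_fderiv_gradient {f : E → ℝ} {x : E} (hf : ContDiffAt ℝ 2 f x) :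
    ((fderiv ℝ (∇ f) x : E →L[ℝ] E) : E →ₗ[ℝ] E).IsSymmetric := by
  have hs : IsSymmSndFDerivAt ℝ f x := hf.isSymmSndFDerivAt (by simp)
  have key : ∀ u w : E, inner ℝ (fderiv ℝ (∇ f) x u) w = fderiv ℝ (fderiv ℝ f) x u w := by
    intro u w
    have h1 : HasFDerivAt (fderiv ℝ f) (fderiv ℝ (fderiv ℝ f) x) x :=
      ((hf.fderiv_right (m := 1) (by norm_num)).differentiableAt (by norm_num)).hasFDerivAt
    have h2 := ((InnerProductSpace.toDual ℝ E).symm.toContinuousLinearEquiv.hasFDerivAt).comp x h1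
    have h3 : fderiv ℝ (∇ f) x = _ := h2.fderiv
    rw [h3]
    exact InnerProductSpace.toDual_symm_apply
  intro u w
  change inner ℝ (fderiv ℝ (∇ f) x u) w = inner ℝ u (fderiv ℝ (∇ f) x w)
  rw [key, real_inner_comm, key]
  exact hs u w

/-- The remainder has gradient `G (x + z) - G x - B z`, where symmetry of `B` turns the derivative
of `½⟪B z, z⟫` into `B z`. This is `o(|z|)`, and the mean value inequality on the ball of radius
`|w|` gains one more order. -/
theorem taylor_two_isLittleO {f : E → ℝ} {x : E} {G : E → E} {B : E →L[ℝ] E}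
    (hG : ∀ᶠ y in 𝓝 x, HasGradientAt f (G y) y) (hB : HasFDerivAt G B x)
    (hsymm : (B : E →ₗ[ℝ] E).IsSymmetric) :
    (fun w : E => f (x + w) - f x - inner ℝ (G x) w - inner ℝ (B w) w / 2)
      =o[𝓝 0] fun w : E => ‖w‖ ^ 2 := by
  rw [Asymptotics.isLittleO_iff]
  intro c hc
  rw [hasFDerivAt_iff_isLittleO_nhds_zero, Asymptotics.isLittleO_iff] at hB
  have hG' : ∀ᶠ w in 𝓝 (0 : E), HasGradientAt f (G (x + w)) (x + w) := by
    have : Tendsto (fun w : E => x + w) (𝓝 0) (𝓝 x) := by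
      simpa using (continuous_const_add x).tendsto (0 : E)
    exact this.eventually hG
  obtain ⟨δ, hδ, H⟩ := Metric.eventually_nhds_iff_ball.1 (hG'.and (hB hc))
  filter_upwards [Metric.ball_mem_nhds (0 : E) hδ] with w hw
  set R : E → ℝ := fun w => f (x + w) - f x - inner ℝ (G x) w - inner ℝ (B w) w / 2 with hR
  have hball : ∀ z ∈ Metric.closedBall (0 : E) ‖w‖, z ∈ Metric.ball (0 : E) δ := fun z hz => by
    rw [mem_ball_zero_iff] at hw ⊢
    exact lt_of_le_of_lt (mem_closedBall_zero_iff.1 hz) hw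
  have hd : ∀ z ∈ Metric.closedBall (0 : E) ‖w‖, HasFDerivWithinAt R
      (InnerProductSpace.toDual ℝ E (G (x + z) - G x - B z)) (Metric.closedBall (0 : E) ‖w‖) z := by
    intro z hz
    have h1 : HasFDerivAt (fun w => f (x + w)) (InnerProductSpace.toDual ℝ E (G (x + z))) z :=
      by
      have := (H z (hball z hz)).1.hasFDerivAt.comp z ((hasFDerivAt_id z).const_add x)
      exact this
    have h2 : HasFDerivAt (fun w => inner ℝ (G x) w) (InnerProductSpace.toDual ℝ E (G x)) z :=
      (InnerProductSpace.toDual ℝ E (G x)).hasFDerivAt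
    have h3 := (B.hasFDerivAt (x := z)).inner ℝ (hasFDerivAt_id z)
    have h4 := ((h1.sub_const (f x)).sub h2).sub (h3.mul_const (1 / 2))
    refine HasFDerivAt.hasFDerivWithinAt ?_
    have h5 : InnerProductSpace.toDual ℝ E (G (x + z) - G x - B z) =
        InnerProductSpace.toDual ℝ E (G (x + z)) - InnerProductSpace.toDual ℝ E (G x) -
          (1 / 2 : ℝ) • (fderivInnerCLM ℝ (B z, id z)).comp
            (B.prod (ContinuousLinearMap.id ℝ E)) := by
      ext u
      have : inner ℝ (B u) z = inner ℝ (B z) u := by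
        rw [real_inner_comm]; exact (hsymm z u).symm
      simp [this]
      ring
    rw [h5]
    refine h4.congr_of_eventuallyEq (Eventually.of_forall fun u => ?_)
    simp [hR]
    ring
  have hbound : ∀ z ∈ Metric.closedBall (0 : E) ‖w‖,
      ‖InnerProductSpace.toDual ℝ E (G (x + z) - G x - B z)‖ ≤ c * ‖w‖ := fun z hz => by
    rw [LinearIsometryEquiv.norm_map]
    exact (H z (hball z hz)).2.trans (mul_le_mul_of_nonneg_left (mem_closedBall_zero_iff.1 hz) hc.le)
  have := (convex_closedBall (0 : E) ‖w‖).norm_image_sub_le_of_norm_hasFDerivWithin_le hd hbound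
    (Metric.mem_closedBall_self (norm_nonneg _)) (mem_closedBall_zero_iff.2 le_rfl : w ∈ _)
  have h0 : R 0 = 0 := by simp [hR]
  rw [h0, sub_zero, sub_zero] at this
  calc ‖R w‖ ≤ c * ‖w‖ * ‖w‖ := this
    _ = c * ‖‖w‖ ^ 2‖ := by rw [norm_pow, norm_norm]; ring

theorem hasAlexandrovHessianAt_of_contDiffAt {f : E → ℝ} {x : E} (hf : ContDiffAt ℝ 2 f x) :
    HasAlexandrovHessianAt f x (∇ f x) (fderiv ℝ (∇ f) x) :=
  ⟨isSymmetric_fderiv_gradient hf, taylor_two_isLittleO (eventually_hasGradientAt_of_contDiffAt hf)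
    (hasFDerivAt_gradient_of_contDiffAt hf) (isSymmetric_fderiv_gradient hf)⟩

end Calculus

/-! ### Angular derivatives -/

section Angular

variable {d : ℕ}

local notation "𝔼" => EuclideanSpace ℝ (Fin d)

theorem norm_one_div_smul_self {x : 𝔼} (hx : x ≠ 0) : ‖(1 / ‖x‖) • x‖ = 1 := by
  rw [norm_smul, norm_div, norm_one, norm_norm, one_div_mul_cancel (norm_ne_zero_iff.2 hx)]

theorem norm_smul_one_div_smul_self {x : 𝔼} (hx : x ≠ 0) : ‖x‖ • (1 / ‖x‖) • x = x := by
  rw [smul_smul, mul_one_div_cancel (norm_ne_zero_iff.2 hx), one_smul]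

theorem sphereChart_zero (n : 𝔼) : sphereChart n 0 = n := by simp [sphereChart]

theorem norm_sphereChart {n : 𝔼} (hn : ‖n‖ = 1) {w : SphereTangent n} (hw : ‖w‖ ≤ 1) :
    ‖sphereChart n w‖ = 1 := by
  have h : ‖sphereChart n w‖ ^ 2 = 1 := by
    rw [sphereChart, norm_add_sq_real, inner_smul_right, inner_right_orthogonal_singleton,
      norm_smul, hn, mul_one, Real.norm_eq_abs, sq_abs, Real.sq_sqrt]
    · simp
    · nlinarith [norm_nonneg w]
  nlinarith [norm_nonneg (sphereChart n w)]

theorem hasFDerivAt_sphereChart (n : 𝔼) {w : SphereTangent n} (hw : ‖w‖ < 1) :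
    HasFDerivAt (sphereChart n) ((SphereTangent n).subtypeL -
      ((1 / Real.sqrt (1 - ‖w‖ ^ 2)) • innerSL ℝ w).smulRight n) w := by
  have h0 : 1 - ‖w‖ ^ 2 ≠ 0 := by nlinarith [norm_nonneg w]
  have h1 : HasFDerivAt (fun w : SphereTangent n => 1 - ‖w‖ ^ 2) (-(2 • innerSL ℝ w)) w :=
    (hasStrictFDerivAt_norm_sq w).hasFDerivAt.const_sub 1
  have h2 := (h1.sqrt h0).smul_const n
  have h3 := ((SphereTangent n).subtypeL.hasFDerivAt (x := w)).add h2
  refine h3.congr_fderiv ?_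
  ext1 u
  simp only [add_apply, ContinuousLinearMap.smulRight_apply, smul_apply, neg_apply, sub_eq_add_neg, ← neg_smul, smul_eq_mul, nsmul_eq_mul]
  congr 2
  push_cast
  field_simp

/-- The gradient of a function of a point of the sphere of radius `r`, in the coordinates given by
`sphereChart`. -/
theorem hasGradientAt_comp_sphereChart {f : 𝔼 → ℝ} {r : ℝ} {n : 𝔼} (hn : ‖n‖ = 1)
    {w : SphereTangent n} (hw : ‖w‖ < 1) {g : 𝔼} (hf : HasGradientAt f g (r • sphereChart n w)) :
    HasGradientAt (fun z : SphereTangent n => f (r • sphereChart n z))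
      (r • (orthogonalPart n g - (inner ℝ g n / Real.sqrt (1 - ‖w‖ ^ 2)) • w)) w := by
  have h := hf.hasFDerivAt.comp w ((hasFDerivAt_sphereChart n hw).const_smul r)
  refine hasGradientAt_iff_hasFDerivAt.2 (h.congr_fderiv ?_)
  ext1 u
  have e1 : inner ℝ g (u : 𝔼) = inner ℝ (orthogonalPart n g) u := (inner_orthogonalPart hn g u).symm
  simp only [ContinuousLinearMap.comp_apply, smul_apply, sub_apply,
    ContinuousLinearMap.smulRight_apply, InnerProductSpace.toDual_apply_apply, inner_smul_right,
    inner_sub_right, Submodule.subtypeL_apply, innerSL_apply_apply, smul_eq_mul, e1,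
    inner_smul_left, inner_sub_left]
  simp only [conj_trivial]
  ring

/-- The Hessian on the sphere of radius `r` is `r²` times the projected Euclidean Hessian minus `r`
times the radial derivative; the latter term comes from the curvature of the chart. -/
theorem hasFDerivAt_orthogonal_gradient {G : 𝔼 → 𝔼} {B : 𝔼 →L[ℝ] 𝔼} {r : ℝ} {n : 𝔼}
    (hG : HasFDerivAt G B (r • n)) :
    HasFDerivAt (fun w : SphereTangent n => r • (orthogonalPart n (G (r • sphereChart n w)) -
        (inner ℝ (G (r • sphereChart n w)) n / Real.sqrt (1 - ‖w‖ ^ 2)) • w))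
      (r • (r • (orthogonalPart n).comp (B.comp (SphereTangent n).subtypeL) -
        inner ℝ (G (r • n)) n • ContinuousLinearMap.id ℝ (SphereTangent n))) 0 := by
  have hc := (hasFDerivAt_sphereChart n (w := 0) (by simp)).const_smul r
  have hG' : HasFDerivAt G B (r • sphereChart n 0) := by rwa [sphereChart_zero]
  have h1 : HasFDerivAt (fun w : SphereTangent n => G (r • sphereChart n w)) _ 0 := hG'.comp 0 hc
  have h2 := (orthogonalPart n).hasFDerivAt.comp (0 : SphereTangent n) h1
  have h3 : HasFDerivAt (fun w : SphereTangent n => Real.sqrt (1 - ‖w‖ ^ 2)) _ 0 :=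
    HasFDerivAt.sqrt ((hasStrictFDerivAt_norm_sq (0 : SphereTangent n)).hasFDerivAt.const_sub 1)
      (by simp)
  have h4 := (h1.inner ℝ (hasFDerivAt_const n (0 : SphereTangent n))).mul
    ((hasDerivAt_inv (by simp)).comp_hasFDerivAt (0 : SphereTangent n) h3)
  have h5 := (h2.sub (h4.smul (hasFDerivAt_id (0 : SphereTangent n)))).const_smul r
  refine (h5.congr_fderiv ?_).congr_of_eventuallyEq (Eventually.of_forall fun w => ?_)
  · ext1 u
    simp [sphereChart_zero]
  · simp [div_eq_mul_inv]

theorem radialDeriv_eq_inner_gradient {f : 𝔼 → ℝ} {x : 𝔼} (hx : x ≠ 0)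
    (hf : DifferentiableAt ℝ f x) :
    radialDeriv f x = inner ℝ (∇ f x) ((1 / ‖x‖) • x) := by
  have hg : HasFDerivAt f (InnerProductSpace.toDual ℝ 𝔼 (∇ f x)) (‖x‖ • (1 / ‖x‖) • x) := by
    rw [norm_smul_one_div_smul_self hx]; exact hf.hasGradientAt.hasFDerivAt
  have h := hg.comp_hasDerivAt ‖x‖ ((hasDerivAt_id ‖x‖).smul_const ((1 / ‖x‖) • x))
  have h' := h.deriv
  simp only [one_smul, InnerProductSpace.toDual_apply_apply] at h'
  exact h'

/-- Writes `f·Id + D²_θ f` as `(f - r f_r) Id + r² P D²f` on the tangent space, with `P` the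
tangential projection, using `⟪∇f, x⟫ = r f_r`. -/
theorem hasFDerivAt_gradient_comp_sphereChart {f : 𝔼 → ℝ} {x : 𝔼} (hx : x ≠ 0)
    (hf : ContDiffAt ℝ 2 f x) :
    HasFDerivAt (∇ (fun z : SphereTangent ((1 / ‖x‖) • x) =>
        f (‖x‖ • sphereChart ((1 / ‖x‖) • x) z)))
      (angularOperator f x - f x • ContinuousLinearMap.id ℝ _) 0 ∧
    (∀ᶠ w in 𝓝 (0 : SphereTangent ((1 / ‖x‖) • x)), HasGradientAt
      (fun z : SphereTangent ((1 / ‖x‖) • x) => f (‖x‖ • sphereChart ((1 / ‖x‖) • x) z))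
      (∇ (fun z : SphereTangent ((1 / ‖x‖) • x) => f (‖x‖ • sphereChart ((1 / ‖x‖) • x) z)) w) w) ∧
    ∀ w : SphereTangent ((1 / ‖x‖) • x), angularOperator f x w =
      (f x - inner ℝ (∇ f x) x) • w +
        ‖x‖ ^ 2 • orthogonalPart ((1 / ‖x‖) • x) (fderiv ℝ (∇ f) x w) := by
  set n : 𝔼 := (1 / ‖x‖) • x with hn_def
  have hn : ‖n‖ = 1 := norm_one_div_smul_self hx
  have hxn : ‖x‖ • n = x := norm_smul_one_div_smul_self hx
  have hev : ∀ᶠ w in 𝓝 (0 : SphereTangent n),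
      HasGradientAt f (∇ f (‖x‖ • sphereChart n w)) (‖x‖ • sphereChart n w) := by
    have hc : ContinuousAt (fun w : SphereTangent n => ‖x‖ • sphereChart n w) 0 :=
      ((hasFDerivAt_sphereChart n (w := 0) (by simp)).const_smul ‖x‖).continuousAt
    have hc' : Tendsto (fun w : SphereTangent n => ‖x‖ • sphereChart n w) (𝓝 0) (𝓝 x) := by
      have := hc.tendsto
      rwa [sphereChart_zero, hxn] at this
    exact hc'.eventually (eventually_hasGradientAt_of_contDiffAt hf)
  have hlt : ∀ᶠ w in 𝓝 (0 : SphereTangent n), ‖w‖ < 1 := by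
    filter_upwards [Metric.ball_mem_nhds (0 : SphereTangent n) one_pos] with w hw
    simpa using hw
  have hgrad : ∀ᶠ w in 𝓝 (0 : SphereTangent n), HasGradientAt
      (fun z : SphereTangent n => f (‖x‖ • sphereChart n z))
      (‖x‖ • (orthogonalPart n (∇ f (‖x‖ • sphereChart n w)) -
        (inner ℝ (∇ f (‖x‖ • sphereChart n w)) n / Real.sqrt (1 - ‖w‖ ^ 2)) • w)) w := by
    filter_upwards [hev, hlt] with w h1 h2
    exact hasGradientAt_comp_sphereChart hn h2 h1
  have hB : HasFDerivAt (∇ f) (fderiv ℝ (∇ f) x) (‖x‖ • n) := by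
    rw [hxn]; exact hasFDerivAt_gradient_of_contDiffAt hf
  have hD := (hasFDerivAt_orthogonal_gradient hB).congr_of_eventuallyEq
    (hgrad.mono fun w hw => hw.gradient)
  have hH : angularOperator f x = f x • ContinuousLinearMap.id ℝ (SphereTangent n) +
      fderiv ℝ (∇ (fun z : SphereTangent n => f (‖x‖ • sphereChart n z))) 0 := rfl
  refine ⟨?_, hgrad.mono fun w hw => ?_, fun (w : SphereTangent n) => ?_⟩
  · rw [hH, add_sub_cancel_left]
    exact hD.differentiableAt.hasFDerivAt
  · exact hw.differentiableAt.hasGradientAt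
  · rw [hH, hD.fderiv, hxn]
    have e : inner ℝ (∇ f x) x = ‖x‖ * inner ℝ (∇ f x) n := by
      conv_lhs => rw [← hxn, inner_smul_right]
      rw [hxn]
    have e2 : (ContinuousLinearMap.id ℝ (SphereTangent n)) w = w := rfl
    rw [e]
    simp only [add_apply, smul_apply, sub_apply, e2,
      ContinuousLinearMap.comp_apply, Submodule.subtypeL_apply]
    module

/-- The gradient with respect to `p` of the positively homogeneous extension `|p| f (|x| p / |p|)`
of the restriction of `f` to the sphere through `x`, at `p = x / |x|`. -/
noncomputable def sphericalGradientMap (f : 𝔼 → ℝ) (x : 𝔼) : 𝔼 :=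
  ‖x‖ • ∇ f x + (f x - inner ℝ (∇ f x) x) • (1 / ‖x‖) • x

/-- Differentiating along a tangent vector gives `(1/r)(f·Id + D²_θ f)`, which stays tangent.
Differentiating along `n`, the second derivatives cancel from the normal component and leave `f_r`.
-/
theorem exists_hasFDerivAt_sphericalGradientMap {f : 𝔼 → ℝ} {x : 𝔼} (hx : x ≠ 0)
    (hf : ContDiffAt ℝ 2 f x) :
    ∃ L : 𝔼 →L[ℝ] 𝔼, HasFDerivAt (sphericalGradientMap f) L x ∧
      L.det = radialDeriv f x * (angularOperator f x).det / ‖x‖ ^ (d - 1) := by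
  have hr : ‖x‖ ≠ 0 := norm_ne_zero_iff.2 hx
  have hB := hasFDerivAt_gradient_of_contDiffAt hf
  have hfd := hf.differentiableAt (by norm_num)
  have hn1 : HasFDerivAt (fun x : 𝔼 => ‖x‖) ((1 / ‖x‖) • innerSL ℝ x) x := by
    have h := (hasStrictFDerivAt_norm_sq x).hasFDerivAt.sqrt (by positivity)
    refine (h.congr_fderiv ?_).congr_of_eventuallyEq (Eventually.of_forall fun y => ?_)
    · ext u
      simp [Real.sqrt_sq (norm_nonneg x)]
      field_simp
    · simp [Real.sqrt_sq (norm_nonneg y)]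
  have hn2 := ((hasDerivAt_inv hr).comp_hasFDerivAt x hn1).smul (hasFDerivAt_id x)
  have h := (hn1.smul hB).add
    ((hfd.hasGradientAt.hasFDerivAt.sub (hB.inner ℝ (hasFDerivAt_id x))).smul hn2)
  refine ⟨_, h.congr_of_eventuallyEq (Eventually.of_forall fun y => ?_), ?_⟩
  · simp [sphericalGradientMap]
  set n : 𝔼 := (1 / ‖x‖) • x with hn_def
  have hn : ‖n‖ = 1 := norm_one_div_smul_self hx
  have hxn : x = ‖x‖ • n := (norm_smul_one_div_smul_self hx).symm
  have hxx : inner ℝ x n = ‖x‖ := by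
    rw [hn_def, inner_smul_right, real_inner_self_eq_norm_sq]; field_simp
  rw [det_eq_inner_mul_det_of_map_orthogonal _ hn ((1 / ‖x‖) • angularOperator f x)]
  · have hrank : Module.finrank ℝ (SphereTangent n) = d - 1 := by
      have h2 : _ + Module.finrank ℝ (SphereTangent n) = _ :=
        Submodule.finrank_add_finrank_orthogonal (Submodule.span ℝ {n})
      have h3 : Module.finrank ℝ (Submodule.span ℝ {n}) = 1 :=
        finrank_span_singleton (by rintro h0; simp [h0] at hn)
      rw [h3, finrank_euclideanSpace_fin] at h2
      omega
    have hdet : ((1 / ‖x‖) • angularOperator f x).det =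
        (1 / ‖x‖) ^ (d - 1) * (angularOperator f x).det := by
      rw [← hrank]
      exact LinearMap.det_smul _ _
    rw [hdet, radialDeriv_eq_inner_gradient hx hfd]
    have e1 : inner ℝ x x = ‖x‖ * ‖x‖ := by rw [real_inner_self_eq_norm_sq]; ring
    simp [inner_add_right, inner_smul_right, inner_smul_left, hn_def]
    have hn' : ‖‖x‖⁻¹ • x‖ = 1 := by simpa [hn_def] using hn
    rw [hn', real_inner_comm x]
    field_simp
    ring
  · intro k
    have hk : inner ℝ x (k : 𝔼) = 0 := by
      rw [hxn, inner_smul_left, inner_left_orthogonal_singleton, mul_zero]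
    have h1 := (hasFDerivAt_gradient_comp_sphereChart hx hf).2.2 k
    have h2 : ((angularOperator f x k : SphereTangent n) : 𝔼) = (f x - inner ℝ (∇ f x) x) • (k : 𝔼) +
        ‖x‖ ^ 2 • (fderiv ℝ (∇ f) x k - inner ℝ n (fderiv ℝ (∇ f) x k) • n) := by
      rw [h1, ← coe_orthogonalPart hn]
      rfl
    simp [hk]
    have h3 : ∀ u : 𝔼, inner ℝ n u • n = (‖x‖⁻¹ * ‖x‖⁻¹ * inner ℝ u x) • x := fun u => by
      simp only [hn_def, inner_smul_left, conj_trivial, smul_smul, real_inner_comm x u, one_div]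
      congr 1
      ring
    rw [h2, h3]
    simp only [inner_gradient_left]
    match_scalars <;> field_simp

/-- Second order condition at a local maximum. -/
theorem inner_fderiv_gradient_nonpos_of_isLocalMax {F : Type*} [NormedAddCommGroup F]
    [InnerProductSpace ℝ F] [CompleteSpace F] {φ : F → ℝ} {G : F → F} {B : F →L[ℝ] F} {x : F}
    (hG : ∀ᶠ y in 𝓝 x, HasGradientAt φ (G y) y) (hB : HasFDerivAt G B x)
    (hmax : IsLocalMax φ x) (w : F) : inner ℝ (B w) w ≤ 0 := by
  by_contra! hpos
  have hline : HasDerivAt (fun s : ℝ => x + s • w) w 0 := by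
    simpa using ((hasDerivAt_id (0 : ℝ)).smul_const w).const_add x
  have ht : Tendsto (fun s : ℝ => x + s • w) (𝓝 0) (𝓝 x) := by
    simpa using hline.continuousAt.tendsto
  have hGx : G x = 0 := by
    have h1 := hmax.hasFDerivAt_eq_zero hG.self_of_nhds.hasFDerivAt
    exact (InnerProductSpace.toDual ℝ F).map_eq_zero_iff.1 h1
  have hderiv : ∀ᶠ s in 𝓝 (0 : ℝ),
      HasDerivAt (fun s : ℝ => φ (x + s • w)) (inner ℝ (G (x + s • w)) w) s := by
    filter_upwards [ht.eventually hG] with s hs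
    have h2 : HasDerivAt (fun s : ℝ => x + s • w) w s := by
      simpa using ((hasDerivAt_id s).smul_const w).const_add x
    have h3 := hs.hasFDerivAt.comp_hasDerivAt s h2
    simp only [InnerProductSpace.toDual_apply_apply] at h3
    exact h3
  have hsecond : HasDerivAt (fun s : ℝ => inner ℝ (G (x + s • w)) w) (inner ℝ (B w) w) 0 := by
    have hB' : HasFDerivAt G B (x + (0 : ℝ) • w) := by simpa using hB
    have h4 := (hB'.comp_hasDerivAt 0 hline).inner ℝ (hasDerivAt_const (0 : ℝ) w)
    simpa using h4
  have hde : deriv (fun s : ℝ => φ (x + s • w)) =ᶠ[𝓝 0]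
      fun s : ℝ => inner ℝ (G (x + s • w)) w := hderiv.mono fun s hs => hs.deriv
  have hdd : deriv (deriv fun s : ℝ => φ (x + s • w)) 0 = inner ℝ (B w) w := by
    rw [hde.deriv_eq, hsecond.deriv]
  -- A positive second derivative makes `0` a local minimum as well, so `φ` is constant along the
  -- line near `x` and the second derivative is zero, a contradiction.
  have hmin := isLocalMin_of_deriv_deriv_pos (hdd ▸ hpos)
    (by rw [hde.self_of_nhds]; simp [hGx]) hderiv.self_of_nhds.continuousAt
  have hconst : (fun s : ℝ => φ (x + s • w)) =ᶠ[𝓝 0] fun _ => φ x := by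
    filter_upwards [hmin, ht.eventually hmax] with s h1 h2
    simp only [zero_smul, add_zero] at h1
    exact le_antisymm h2 h1
  have hzero : deriv (deriv fun s : ℝ => φ (x + s • w)) 0 = 0 := by
    have h5 : deriv (fun s : ℝ => φ (x + s • w)) =ᶠ[𝓝 0] fun _ => 0 := by
      have h6 := hconst.deriv
      simpa using h6
    rw [h5.deriv_eq]
    simp
  rw [hdd] at hzero
  exact hpos.ne' hzero

/-- If the restriction of `f` to the sphere through `x` touches a linear function from below
at `x`, then that function is determined by `f` and the second order condition holds. -/
theorem contact_conditions {f : 𝔼 → ℝ} {x X : 𝔼} (hx : x ≠ 0) (hf : ContDiffAt ℝ 2 f x)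
    (heq : f x = inner ℝ X ((1 / ‖x‖) • x))
    (hle : ∀ᶠ θ in 𝓝 ((1 / ‖x‖) • x), ‖θ‖ = 1 → f (‖x‖ • θ) ≤ inner ℝ X θ) :
    sphericalGradientMap f x = X ∧
      ∀ w : SphereTangent ((1 / ‖x‖) • x), inner ℝ (angularOperator f x w) w ≤ 0 := by
  have hr : ‖x‖ ≠ 0 := norm_ne_zero_iff.2 hx
  -- On the sphere through `x`, `g (|x| θ) = f (|x| θ) - ⟪X, θ⟫`, so the contact becomes a local
  -- maximum of `g` with value `0`.
  set g : 𝔼 → ℝ := fun y => f y - inner ℝ ((1 / ‖x‖) • X) y with hg_def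
  have hlin : ∀ y : 𝔼, HasGradientAt (fun y : 𝔼 => inner ℝ ((1 / ‖x‖) • X) y)
      ((1 / ‖x‖) • X) y := fun y =>
    (InnerProductSpace.toDual ℝ 𝔼 ((1 / ‖x‖) • X)).hasFDerivAt
  have hg : ContDiffAt ℝ 2 g x :=
    hf.sub (InnerProductSpace.toDual ℝ 𝔼 ((1 / ‖x‖) • X)).contDiff.contDiffAt
  have hgrad : ∀ᶠ y in 𝓝 x, ∇ g y = ∇ f y - (1 / ‖x‖) • X := by
    filter_upwards [eventually_hasGradientAt_of_contDiffAt hf] with y hy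
    have h1 : HasGradientAt g (∇ f y - (1 / ‖x‖) • X) y := by
      rw [hasGradientAt_iff_hasFDerivAt, map_sub]
      exact hy.hasFDerivAt.sub (hlin y).hasFDerivAt
    exact h1.gradient
  have hBg : fderiv ℝ (∇ g) x = fderiv ℝ (∇ f) x := by
    rw [Filter.EventuallyEq.fderiv_eq hgrad, fderiv_sub_const]
  obtain ⟨h1, h2, h3⟩ := hasFDerivAt_gradient_comp_sphereChart hx hg
  have h3f := (hasFDerivAt_gradient_comp_sphereChart hx hf).2.2
  set n : 𝔼 := (1 / ‖x‖) • x with hn_def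
  have hn : ‖n‖ = 1 := norm_one_div_smul_self hx
  have hxn : ‖x‖ • n = x := norm_smul_one_div_smul_self hx
  have hXx : inner ℝ X x = ‖x‖ * inner ℝ X n := by
    conv_lhs => rw [← hxn, inner_smul_right]
  have hgx : g x = 0 := by
    simp only [hg_def, inner_smul_left, hXx, heq, conj_trivial]
    field_simp
    simp
  have hc : Tendsto (sphereChart n) (𝓝 0) (𝓝 n) := by
    have := (hasFDerivAt_sphereChart n (w := 0) (by simp)).continuousAt.tendsto
    rwa [sphereChart_zero] at this
  have hmax : IsLocalMax (fun z : SphereTangent n => g (‖x‖ • sphereChart n z)) 0 := by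
    filter_upwards [hc.eventually hle, Metric.ball_mem_nhds (0 : SphereTangent n) one_pos]
      with w hw1 hw2
    have hw3 := hw1 (norm_sphereChart hn (by simpa using (mem_ball_zero_iff.1 hw2).le))
    rw [sphereChart_zero, hxn, hgx]
    simp only [hg_def, inner_smul_left, inner_smul_right, conj_trivial]
    field_simp
    linarith
  -- A linear function `h` satisfies `h·Id + D²_θ h = 0`, so subtracting it changes nothing.
  have hang : ∀ w : SphereTangent n, angularOperator f x w = angularOperator g x w := by
    intro w
    rw [h3, h3f, hBg, hgrad.self_of_nhds, hgx, inner_sub_left, inner_smul_left, hXx, heq]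
    congr 2
    simp
    field_simp
  refine ⟨?_, fun w => ?_⟩
  -- Vanishing of the chart gradient determines the tangential part of `X`; the contact equation
  -- `heq` determines its normal part.
  · have h4 := hmax.hasFDerivAt_eq_zero h2.self_of_nhds.hasFDerivAt
    have h5 := (InnerProductSpace.toDual ℝ _).map_eq_zero_iff.1 h4
    have h6 : HasGradientAt g (∇ g x) (‖x‖ • sphereChart n 0) := by
      rw [sphereChart_zero, hxn]
      exact (eventually_hasGradientAt_of_contDiffAt hg).self_of_nhds
    have h7 := (hasGradientAt_comp_sphereChart hn (w := 0) (by simp) h6).gradient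
    rw [h5, hgrad.self_of_nhds] at h7
    have h8 : orthogonalPart n (∇ f x - (1 / ‖x‖) • X) = 0 := by
      rw [smul_zero, sub_zero] at h7
      exact (smul_eq_zero.1 h7.symm).resolve_left hr
    have h9 := coe_orthogonalPart hn (∇ f x - (1 / ‖x‖) • X)
    rw [h8, eq_comm, ZeroMemClass.coe_zero, sub_eq_zero] at h9
    have h10 : ‖x‖ • ∇ f x = X + ‖x‖ • (inner ℝ n (∇ f x - (1 / ‖x‖) • X)) • n := by
      rw [← h9, smul_sub, smul_smul, mul_one_div_cancel hr, one_smul]; abel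
    rw [sphericalGradientMap, h10, heq]
    have h11 : inner ℝ (∇ f x) x = ‖x‖ * inner ℝ n (∇ f x) := by
      conv_lhs => rw [← hxn, inner_smul_right, real_inner_comm]
      rw [hxn]
    rw [h11, inner_sub_right, inner_smul_right, real_inner_comm X n, ← hn_def]
    match_scalars
    · simp
    · field_simp
      ring
  · rw [hang]
    have h4 := inner_fderiv_gradient_nonpos_of_isLocalMax h2 h1 hmax w
    rw [hgx] at h4
    simpa using h4

end Angular

/-! ### Contact sets in spherical cylinders -/

section SphericalCylinder

variable {d : ℕ}

local notation "𝔼" => EuclideanSpace ℝ (Fin d)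

variable {R₁ R₂ : ℝ} {Q : Set (EuclideanSpace ℝ (Fin d))} {f : EuclideanSpace ℝ (Fin d) → ℝ}

theorem norm_mem_Icc_of_mem_sphericalCylinder (hR : 0 ≤ R₁) (hQ : Q ⊆ Metric.sphere 0 1) {x : 𝔼}
    (hx : x ∈ sphericalCylinder R₁ R₂ Q) : ‖x‖ ∈ Icc R₁ R₂ := by
  obtain ⟨r, hr, θ, hθ, rfl⟩ := hx
  rwa [norm_smul, mem_sphere_zero_iff_norm.1 (hQ hθ), mul_one, Real.norm_of_nonneg (hR.trans hr.1)]

theorem closure_subset_sphere (hQ : Q ⊆ Metric.sphere 0 1) : closure Q ⊆ Metric.sphere 0 1 :=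
  closure_minimal hQ Metric.isClosed_sphere

theorem smul_mem_closure_sphericalCylinder {r : ℝ} (hr : r ∈ Icc R₁ R₂) {θ : 𝔼}
    (hθ : θ ∈ closure Q) : r • θ ∈ closure (sphericalCylinder R₁ R₂ Q) :=
  map_mem_closure (continuous_const_smul r) hθ fun _ hq => ⟨r, hr, _, hq, rfl⟩

theorem eventually_mem_of_mem_closure {θ : 𝔼} (hθ : θ ∈ closure Q) (hθ' : θ ∉ sphereFrontier Q) :
    ∀ᶠ η in 𝓝 θ, ‖η‖ = 1 → η ∈ Q := by
  have h1 : θ ∈ (closure (Metric.sphere 0 1 \ Q))ᶜ := fun h => hθ' ⟨hθ, h⟩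
  filter_upwards [isClosed_closure.isOpen_compl.mem_nhds h1] with η hη h
  by_contra hn
  exact hη (subset_closure ⟨mem_sphere_zero_iff_norm.2 h, hn⟩)

theorem smul_mem_interior_sphericalCylinder (hR : 0 ≤ R₁) (hQ : Q ⊆ Metric.sphere 0 1) {r : ℝ}
    (hr : r ∈ Ioo R₁ R₂) {θ : 𝔼} (hθ : θ ∈ closure Q) (hθ' : θ ∉ sphereFrontier Q) :
    r • θ ∈ interior (sphericalCylinder R₁ R₂ Q) := by
  have hr0 : 0 < r := lt_of_le_of_lt hR hr.1
  have hn : ‖r • θ‖ = r := by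
    rw [norm_smul, mem_sphere_zero_iff_norm.1 (closure_subset_sphere hQ hθ), mul_one,
      Real.norm_of_nonneg hr0.le]
  have hx0 : r • θ ≠ 0 := norm_ne_zero_iff.1 (by rw [hn]; exact hr0.ne')
  have hnorm : ContinuousAt (fun x : 𝔼 => ‖x‖) (r • θ) := continuous_norm.continuousAt
  have hdir : ContinuousAt (fun x : 𝔼 => (1 / ‖x‖) • x) (r • θ) :=
    (continuousAt_const.div hnorm (norm_ne_zero_iff.2 hx0)).smul continuousAt_id
  have hθeq : (1 / ‖r • θ‖) • r • θ = θ := by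
    rw [hn, smul_smul, one_div_mul_cancel hr0.ne', one_smul]
  rw [mem_interior_iff_mem_nhds]
  have h1 := hdir.tendsto
  rw [hθeq] at h1
  have h2 := hnorm.tendsto
  rw [hn] at h2
  filter_upwards [h1.eventually (eventually_mem_of_mem_closure hθ hθ'),
    h2.eventually (isOpen_Ioo.mem_nhds hr), isOpen_compl_singleton.mem_nhds hx0] with x e1 e2 e3
  exact ⟨‖x‖, Ioo_subset_Icc_self e2, _, e1 (norm_one_div_smul_self e3),
    (norm_smul_one_div_smul_self e3).symm⟩

theorem norm_lt_of_mem_interior_sphericalCylinder (hR : 0 ≤ R₁) (hQ : Q ⊆ Metric.sphere 0 1)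
    {x : 𝔼} (hx : x ∈ interior (sphericalCylinder R₁ R₂ Q)) (hx0 : x ≠ 0) : ‖x‖ < R₂ := by
  have hc : Tendsto (fun s : ℝ => s • x) (𝓝[>] 1) (𝓝 x) := by
    have : Tendsto (fun s : ℝ => s • x) (𝓝 1) (𝓝 ((1 : ℝ) • x)) :=
      (continuous_id.smul continuous_const).tendsto 1
    rw [one_smul] at this
    exact this.mono_left nhdsWithin_le_nhds
  obtain ⟨s, hs1, hs2⟩ := ((hc.eventually (mem_interior_iff_mem_nhds.1 hx)).and
    self_mem_nhdsWithin).exists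
  have h1 := (norm_mem_Icc_of_mem_sphericalCylinder hR hQ hs1).2
  have hs3 : 1 < s := hs2
  rw [norm_smul, Real.norm_of_nonneg (by linarith)] at h1
  nlinarith [norm_pos_iff.2 hx0]

theorem eventually_norm_smul_mem_sphericalCylinder {x : 𝔼}
    (hx : x ∈ interior (sphericalCylinder R₁ R₂ Q)) (hx0 : x ≠ 0) :
    ∀ᶠ θ in 𝓝 ((1 / ‖x‖) • x), ‖x‖ • θ ∈ sphericalCylinder R₁ R₂ Q := by
  have hc : Tendsto (fun θ : 𝔼 => ‖x‖ • θ) (𝓝 ((1 / ‖x‖) • x)) (𝓝 x) := by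
    have := (continuous_const_smul ‖x‖ : Continuous fun θ : 𝔼 => ‖x‖ • θ).tendsto ((1 / ‖x‖) • x)
    rwa [norm_smul_one_div_smul_self hx0] at this
  exact hc.eventually (mem_interior_iff_mem_nhds.1 hx)

theorem mem_of_norm_smul_mem_sphericalCylinder (hR : 0 ≤ R₁) (hQ : Q ⊆ Metric.sphere 0 1)
    {x θ : 𝔼} (hx0 : x ≠ 0) (hθ : ‖θ‖ = 1) (h : ‖x‖ • θ ∈ sphericalCylinder R₁ R₂ Q) : θ ∈ Q := by
  obtain ⟨r, hr, η, hη, he⟩ := h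
  have hn : ‖x‖ = r := by
    have := congrArg norm he
    rwa [norm_smul, norm_smul, hθ, mem_sphere_zero_iff_norm.1 (hQ hη), norm_norm, mul_one, mul_one,
      Real.norm_of_nonneg (hR.trans hr.1)] at this
  rw [← hn] at he
  rwa [smul_right_injective 𝔼 (norm_ne_zero_iff.2 hx0) he]

/-- The points `x` of the interior of the cylinder such that a linear function touches `f` from
above at `x` on the sphere through `x`, and stays above `f` outside that sphere. -/
def sphericalContactSet (R₁ R₂ : ℝ) (Q : Set 𝔼) (f : 𝔼 → ℝ) : Set 𝔼 :=
  {x | x ∈ interior (sphericalCylinder R₁ R₂ Q) \ {0} ∧ ∀ τ ∈ Icc (0 : ℝ) 1, ∀ θ ∈ closure Q,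
    f ((‖x‖ + τ * (R₂ - ‖x‖)) • θ) ≤ inner ℝ (sphericalGradientMap f x) θ}

theorem contDiffAt_of_mem_interior {S : Set 𝔼} (hf : ContDiffOn ℝ 2 f (interior S)) {x : 𝔼}
    (hx : x ∈ interior S) : ContDiffAt ℝ 2 f x :=
  hf.contDiffAt (isOpen_interior.mem_nhds hx)

/-- With the radius written as `|x| + τ (R₂ - |x|)`, the parameters `τ ∈ [0, 1]` and `θ` range over
sets independent of `x`. Each violated inequality is then an open condition on `x`, and the contact
set is an open set minus an open set. -/
theorem measurableSet_sphericalContactSet (hR : 0 ≤ R₁) (hQ : Q ⊆ Metric.sphere 0 1)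
    (hc : ContinuousOn f (closure (sphericalCylinder R₁ R₂ Q)))
    (hf : ContDiffOn ℝ 2 f (interior (sphericalCylinder R₁ R₂ Q))) :
    MeasurableSet (sphericalContactSet R₁ R₂ Q f) := by
  set U : Set 𝔼 := interior (sphericalCylinder R₁ R₂ Q) \ {0} with hU_def
  have hU : IsOpen U := isOpen_interior.sdiff isClosed_singleton
  have hΨ : ContinuousOn (sphericalGradientMap f) U := fun x hx => by
    obtain ⟨L, hL, -⟩ := exists_hasFDerivAt_sphericalGradientMap hx.2
      (contDiffAt_of_mem_interior hf hx.1)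
    exact hL.continuousAt.continuousWithinAt
  have heq : sphericalContactSet R₁ R₂ Q f = U \ ⋃ τ ∈ Icc (0 : ℝ) 1, ⋃ θ ∈ closure Q,
      {x | x ∈ U ∧ inner ℝ (sphericalGradientMap f x) θ <
        f ((‖x‖ + τ * (R₂ - ‖x‖)) • θ)} := by
    ext x
    simp only [sphericalContactSet, mem_ofPred_eq, Set.mem_sdiff, mem_iUnion, not_exists, not_and, not_lt]
    constructor
    · rintro ⟨h1, h2⟩
      exact ⟨h1, fun τ hτ θ hθ _ => h2 τ hτ θ hθ⟩
    · rintro ⟨h1, h2⟩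
      exact ⟨h1, fun τ hτ θ hθ => h2 τ hτ θ hθ h1⟩
  rw [heq]
  refine hU.measurableSet.diff (isOpen_biUnion fun τ hτ => isOpen_biUnion fun θ hθ => ?_).measurableSet
  have h1 : ContinuousOn (fun x : 𝔼 => inner ℝ (sphericalGradientMap f x) θ) U :=
    hΨ.inner continuousOn_const
  have h2 : ContinuousOn (fun x : 𝔼 => f ((‖x‖ + τ * (R₂ - ‖x‖)) • θ)) U := by
    refine hc.comp (Continuous.continuousOn (by fun_prop)) fun x hx => ?_
    have h3 := norm_mem_Icc_of_mem_sphericalCylinder hR hQ (interior_subset hx.1)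
    refine smul_mem_closure_sphericalCylinder ⟨?_, ?_⟩ hθ
    · nlinarith [hτ.1, h3.1, h3.2]
    · nlinarith [hτ.2, h3.1, h3.2]
  have h4 := (h1.sub h2).isOpen_inter_preimage hU isOpen_Iio (t := Iio 0)
  convert h4 using 1
  ext x
  simp [sub_neg]

/-- The value of the linear function at `n = x/|x|` is `f x` automatically. Taking `θ = n` gives `f
(s n) ≤ f x` for `s` above `|x|`, hence `f_r ≤ 0`; taking `τ = 0` gives the contact on the sphere,
hence the second order condition. -/
theorem sphericalContactSet_subset (hR : 0 ≤ R₁) (hQ : Q ⊆ Metric.sphere 0 1)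
    (hf : ContDiffOn ℝ 2 f (interior (sphericalCylinder R₁ R₂ Q))) :
    sphericalContactSet R₁ R₂ Q f ⊆ parabolicContactSet (sphericalCylinder R₁ R₂ Q) f := by
  rintro x ⟨⟨hx, hx0⟩, H⟩
  have hx0 : x ≠ 0 := hx0
  have hfx := contDiffAt_of_mem_interior hf hx
  have hr : ‖x‖ ≠ 0 := norm_ne_zero_iff.2 hx0
  set n : 𝔼 := (1 / ‖x‖) • x with hn_def
  have hn : ‖n‖ = 1 := norm_one_div_smul_self hx0
  have hxn : ‖x‖ • n = x := norm_smul_one_div_smul_self hx0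
  have hlt := norm_lt_of_mem_interior_sphericalCylinder hR hQ hx hx0
  have hval : f x = inner ℝ (sphericalGradientMap f x) n := by
    have e1 : inner ℝ (∇ f x) x = ‖x‖ * inner ℝ (∇ f x) n := by
      conv_lhs => rw [← hxn, inner_smul_right]
      rw [hxn]
    rw [sphericalGradientMap, ← hn_def, inner_add_left, inner_smul_left, inner_smul_left,
      real_inner_self_eq_norm_sq, hn, e1]
    simp
  have hnQ : n ∈ Q := mem_of_norm_smul_mem_sphericalCylinder hR hQ hx0 hn
    (by rw [hxn]; exact interior_subset hx)
  refine ⟨interior_subset hx, ?_, ?_⟩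
  · rw [radialDeriv]
    have hd : DifferentiableAt ℝ (fun r : ℝ => f (r • n)) ‖x‖ := by
      have h1 : DifferentiableAt ℝ f (‖x‖ • n) := by
        rw [hxn]; exact hfx.differentiableAt (by norm_num)
      exact h1.comp ‖x‖ (differentiableAt_id.smul_const n)
    have h2 := hd.hasDerivAt.hasDerivWithinAt (s := Ioi ‖x‖)
    have h3 := (hasDerivWithinAt_iff_tendsto_slope' self_notMem_Ioi).1 h2
    refine le_of_tendsto h3 ?_
    filter_upwards [Ioo_mem_nhdsGT hlt] with s hs
    have h4 := H ((s - ‖x‖) / (R₂ - ‖x‖)) ⟨div_nonneg (by linarith [hs.1]) (by linarith),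
      (div_le_one (by linarith)).2 (by linarith [hs.2])⟩ n (subset_closure hnQ)
    rw [div_mul_cancel₀ _ (by linarith), add_sub_cancel, ← hval] at h4
    rw [slope_def_field, hxn]
    exact div_nonpos_of_nonpos_of_nonneg (by linarith) (by linarith [hs.1])
  · refine (contact_conditions hx0 hfx hval ?_).2
    filter_upwards [eventually_norm_smul_mem_sphericalCylinder hx hx0] with θ hθ h1
    have h2 := H 0 ⟨le_rfl, zero_le_one⟩ θ
      (subset_closure (mem_of_norm_smul_mem_sphericalCylinder hR hQ hx0 h1 hθ))
    simpa using h2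

/-- Take the largest `r` for which `f (r θ) ≥ ⟪X, θ⟫` for some `θ`. Beyond `r` the linear function
is strictly larger, so by continuity it is at least `f` at radius `r`, with equality at `θ`. The
strict inequalities `htop` and `hside` keep the contact point off the parabolic boundary. -/
theorem exists_mem_sphericalContactSet (hR : 0 ≤ R₁) (hQ : Q ⊆ Metric.sphere 0 1)
    (hc : ContinuousOn f (closure (sphericalCylinder R₁ R₂ Q)))
    (hf : ContDiffOn ℝ 2 f (interior (sphericalCylinder R₁ R₂ Q))) {X : 𝔼}
    (htop : ∀ θ ∈ closure Q, f (R₂ • θ) < inner ℝ X θ)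
    (hside : ∀ r ∈ Icc R₁ R₂, ∀ θ ∈ sphereFrontier Q, f (r • θ) < inner ℝ X θ)
    {r₀ : ℝ} (hr₀ : r₀ ∈ Icc R₁ R₂) {θ₀ : 𝔼} (hθ₀ : θ₀ ∈ closure Q)
    (h₀ : inner ℝ X θ₀ < f (r₀ • θ₀)) :
    ∃ x ∈ sphericalContactSet R₁ R₂ Q f, sphericalGradientMap f x = X := by
  have hQ' := closure_subset_sphere hQ
  have hQc : IsCompact (closure Q) := (isCompact_sphere 0 1).of_isClosed_subset isClosed_closure hQ'
  have hgc : ContinuousOn (fun p : ℝ × 𝔼 => f (p.1 • p.2)) (Icc R₁ R₂ ×ˢ closure Q) :=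
    hc.comp (Continuous.continuousOn (by fun_prop)) fun p hp =>
      smul_mem_closure_sphericalCylinder hp.1 hp.2
  set K : Set (ℝ × 𝔼) := {p ∈ Icc R₁ R₂ ×ˢ closure Q | inner ℝ X p.2 ≤ f (p.1 • p.2)} with hK_def
  have hbox : IsCompact (Icc R₁ R₂ ×ˢ closure Q) := isCompact_Icc.prod hQc
  have hK : IsCompact K := by
    refine hbox.of_isClosed_subset ?_ fun p hp => hp.1
    exact hbox.isClosed.isClosed_le (Continuous.continuousOn (by fun_prop)) hgc
  obtain ⟨⟨r, θ⟩, ⟨⟨hr, hθ⟩, hrθ⟩, hmax⟩ := hK.exists_isMaxOn ⟨(r₀, θ₀), ⟨hr₀, hθ₀⟩, h₀.le⟩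
    continuous_fst.continuousOn
  simp only at hr hθ hrθ
  have habove : ∀ s ∈ Icc R₁ R₂, r < s → ∀ η ∈ closure Q, f (s • η) < inner ℝ X η := by
    intro s hs hrs η hη
    by_contra! h
    have h1 : s ≤ r := hmax (show (s, η) ∈ K from ⟨⟨hs, hη⟩, h⟩)
    linarith
  have hr2 : r < R₂ := lt_of_le_of_ne hr.2 fun h => by
    have := htop θ hθ
    rw [← h] at this
    linarith
  have hle : ∀ η ∈ closure Q, f (r • η) ≤ inner ℝ X η := by
    intro η hη
    have h1 : ContinuousWithinAt (fun s : ℝ => f (s • η)) (Icc R₁ R₂) r :=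
      (hc.comp (Continuous.continuousOn (by fun_prop)) fun s hs =>
        smul_mem_closure_sphericalCylinder hs hη : ContinuousOn (fun s : ℝ => f (s • η)) _) r hr
    have h2 := h1.mono (s := Ioo r R₂) fun s hs => ⟨hr.1.trans hs.1.le, hs.2.le⟩
    have h3 : (𝓝[Ioo r R₂] r).NeBot := by
      rw [← mem_closure_iff_nhdsWithin_neBot, closure_Ioo hr2.ne]
      exact ⟨le_rfl, hr2.le⟩
    refine le_of_tendsto h2.tendsto ?_
    filter_upwards [self_mem_nhdsWithin] with s hs
    exact (habove s ⟨hr.1.trans hs.1.le, hs.2.le⟩ hs.1 η hη).le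
  have heq : f (r • θ) = inner ℝ X θ := le_antisymm (hle θ hθ) hrθ
  -- The inequality `h₀` is strict, so `r₀` cannot be the contact radius and `r₀ < r`. This keeps
  -- the contact point off the inner sphere.
  have hr1 : R₁ < r := by
    have h1 : r₀ ≤ r := hmax (show (r₀, θ₀) ∈ K from ⟨⟨hr₀, hθ₀⟩, h₀.le⟩)
    refine lt_of_le_of_lt hr₀.1 (lt_of_le_of_ne h1 fun h => ?_)
    have := hle θ₀ hθ₀
    rw [← h] at this
    linarith
  have hθ' : θ ∉ sphereFrontier Q := fun h => by
    have := hside r hr θ h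
    linarith
  have hint := smul_mem_interior_sphericalCylinder hR hQ ⟨hr1, hr2⟩ hθ hθ'
  have hr0 : 0 < r := lt_of_le_of_lt hR hr1
  have hn : ‖r • θ‖ = r := by
    rw [norm_smul, mem_sphere_zero_iff_norm.1 (hQ' hθ), mul_one, Real.norm_of_nonneg hr0.le]
  have hx0 : r • θ ≠ 0 := norm_ne_zero_iff.1 (by rw [hn]; exact hr0.ne')
  have hθeq : (1 / ‖r • θ‖) • r • θ = θ := by
    rw [hn, smul_smul, one_div_mul_cancel hr0.ne', one_smul]
  have hcontact := contact_conditions (X := X) hx0 (contDiffAt_of_mem_interior hf hint)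
    (by rw [hθeq, heq]) (by
      rw [hθeq, hn]
      filter_upwards [eventually_mem_of_mem_closure hθ hθ'] with η h1 h2
      exact hle η (subset_closure (h1 h2)))
  refine ⟨r • θ, ⟨⟨hint, hx0⟩, fun τ hτ η hη => ?_⟩, hcontact.1⟩
  rw [hcontact.1, hn]
  rcases eq_or_lt_of_le hτ.1 with h | h
  · simpa [← h] using hle η hη
  · refine (habove _ ⟨?_, ?_⟩ ?_ η hη).le
    · nlinarith
    · nlinarith [hτ.2]
    · nlinarith

/-- The area formula is applied on the measurable contact set, and the nonnegative integrand is then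
integrated over the larger set `Γ_f`. -/
theorem volume_le_lintegral_parabolicContactSet (hR : 0 ≤ R₁) (hQ : Q ⊆ Metric.sphere 0 1)
    (hc : ContinuousOn f (closure (sphericalCylinder R₁ R₂ Q)))
    (hf : ContDiffOn ℝ 2 f (interior (sphericalCylinder R₁ R₂ Q))) {S : Set 𝔼}
    (hS : S ⊆ sphericalGradientMap f '' sphericalContactSet R₁ R₂ Q f) :
    volume S ≤ ∫⁻ x in parabolicContactSet (sphericalCylinder R₁ R₂ Q) f,
      ENNReal.ofReal (|radialDeriv f x * (angularOperator f x).det| / ‖x‖ ^ (d - 1)) := by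
  have hm := measurableSet_sphericalContactSet hR hQ hc hf
  have hex : ∀ x : 𝔼, ∃ L : 𝔼 →L[ℝ] 𝔼, x ∈ sphericalContactSet R₁ R₂ Q f →
      HasFDerivAt (sphericalGradientMap f) L x ∧
      L.det = radialDeriv f x * (angularOperator f x).det / ‖x‖ ^ (d - 1) := by
    intro x
    by_cases hx : x ∈ sphericalContactSet R₁ R₂ Q f
    · obtain ⟨L, hL⟩ := exists_hasFDerivAt_sphericalGradientMap hx.1.2
        (contDiffAt_of_mem_interior hf hx.1.1)
      exact ⟨L, fun _ => hL⟩
    · exact ⟨0, fun h => absurd h hx⟩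
  choose L hL using hex
  calc volume S ≤ volume (sphericalGradientMap f '' sphericalContactSet R₁ R₂ Q f) :=
        measure_mono hS
    _ ≤ ∫⁻ x in sphericalContactSet R₁ R₂ Q f, ENNReal.ofReal |(L x).det| :=
        addHaar_image_le_lintegral_abs_det_fderiv volume hm
          fun x hx => (hL x hx).1.hasFDerivWithinAt
    _ = ∫⁻ x in sphericalContactSet R₁ R₂ Q f,
          ENNReal.ofReal (|radialDeriv f x * (angularOperator f x).det| / ‖x‖ ^ (d - 1)) := by
        refine setLIntegral_congr_fun hm fun x hx => ?_
        rw [(hL x hx).2, abs_div, abs_of_nonneg (pow_nonneg (norm_nonneg x) _)]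
    _ ≤ _ := lintegral_mono_set (sphericalContactSet_subset hR hQ hf)

end SphericalCylinder

/-! ### The maximum principle on spherical cylinders -/

theorem EReal.coe_le_coe_add_coe_ennreal {a b : ℝ} {I : ℝ≥0∞} (h : ENNReal.ofReal (a - b) ≤ I) :
    (a : EReal) ≤ (b : EReal) + (I : EReal) := by
  induction I with
  | top => simp
  | coe I =>
    have h1 : a - b ≤ I := by
      rw [ENNReal.ofReal_le_iff_le_toReal ENNReal.coe_ne_top] at h
      simpa using h
    have h2 : a ≤ b + I := by linarith
    rw [show ((I : ℝ≥0∞) : EReal) = ((I : ℝ) : EReal) from EReal.coe_nnreal_eq_coe_real I]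
    exact_mod_cast h2

section

variable {d : ℕ}

local notation "𝔼" => EuclideanSpace ℝ (Fin d)

theorem inner_single_one_left (i : Fin d) (x : 𝔼) :
    inner ℝ (EuclideanSpace.single i (1 : ℝ)) x = x i := by
  simp [EuclideanSpace.inner_single_left]

theorem norm_le_of_abs_last (i : Fin d) (x : 𝔼) : x i ≤ ‖x‖ := by
  rw [← inner_single_one_left]
  have := real_inner_le_norm (EuclideanSpace.single i (1 : ℝ)) x
  simpa using this

/-- Let `s` be the last coordinate of `q` and `q'` its projection to the equatorial hyperplane. The
equator point `q'/|q'|` is at squared distance `2 - 2|q'| ≤ 2 s²` from `q`, so `ε² ≤ 2 s²`. If `q' =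
0` then `s = 1`; this is the only case when `d = 1`. -/
theorem exists_pos_le_last_coordinate [NeZero d] {Q : Set 𝔼} (hQ : Q ⊆ upperHemisphere d)
    (h : ∃ ε : ℝ, 0 < ε ∧ ∀ q ∈ Q, ∀ p ∈ equatorSphere d, ε ≤ dist q p) :
    ∃ κ : ℝ, 0 < κ ∧ ∀ q ∈ Q, κ ≤ q ⟨d - 1, Nat.sub_one_lt (NeZero.ne d)⟩ := by
  obtain ⟨ε, hε, H⟩ := h
  refine ⟨min (ε / 2) (1 / 2), by positivity, fun q hq => ?_⟩
  obtain ⟨hq1, hq2⟩ := hQ hq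
  set i : Fin d := ⟨d - 1, Nat.sub_one_lt (NeZero.ne d)⟩
  set e : 𝔼 := EuclideanSpace.single i (1 : ℝ)
  set s : ℝ := q i with hs
  have he : ‖e‖ = 1 := by simp [e]
  have hes : inner ℝ e q = s := inner_single_one_left i q
  set q' : 𝔼 := q - s • e with hq'
  have hq'i : q' i = 0 := by simp [hq', e, hs]
  have hee : inner ℝ e e = (1 : ℝ) := by rw [real_inner_self_eq_norm_sq, he]; norm_num
  have hqq : inner ℝ q q = (1 : ℝ) := by rw [real_inner_self_eq_norm_sq, hq1]; norm_num
  have hnq : ‖q'‖ ^ 2 = 1 - s ^ 2 := by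
    rw [← real_inner_self_eq_norm_sq, hq', inner_sub_left, inner_sub_right, inner_sub_right,
      inner_smul_left, inner_smul_right, inner_smul_right, inner_smul_left, hee, hes, hqq,
      real_inner_comm, hes]
    simp
    ring
  by_cases h0 : q' = 0
  · refine (min_le_right _ _).trans ?_
    rw [h0] at hnq
    simp at hnq
    nlinarith
  · refine (min_le_left _ _).trans ?_
    have hpos : 0 < ‖q'‖ := norm_pos_iff.2 h0
    have hp : (1 / ‖q'‖) • q' ∈ equatorSphere d :=
      ⟨norm_one_div_smul_self h0, by
        change ((1 / ‖q'‖) • q') i = 0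
        simp [hq'i]⟩
    have h1 := H q hq _ hp
    have h2 : inner ℝ q q' = ‖q'‖ ^ 2 := by
      rw [hnq, hq', inner_sub_right, inner_smul_right, real_inner_comm e q, hes, hqq]
      ring
    have h3 : dist q ((1 / ‖q'‖) • q') ^ 2 = 2 - 2 * ‖q'‖ := by
      rw [dist_eq_norm, norm_sub_sq_real, norm_one_div_smul_self h0, hq1, inner_smul_right, h2]
      field_simp
      ring
    have h4 : ε ^ 2 ≤ 2 - 2 * ‖q'‖ := by rw [← h3]; gcongr
    have h5 : ‖q'‖ ≤ 1 := by nlinarith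
    have h6 : ε ^ 2 ≤ 2 * s ^ 2 := by nlinarith
    nlinarith

theorem closure_coordinate_ge {Q : Set 𝔼} {κ : ℝ} {i : Fin d} (h : ∀ q ∈ Q, κ ≤ q i) :
    ∀ q ∈ closure Q, κ ≤ q i := fun q hq =>
  le_on_closure (f := fun _ => κ) (g := fun q : 𝔼 => q i) h continuousOn_const
    (Continuous.continuousOn (by fun_prop)) hq

theorem spherical_parabolic_maximum_principle [NeZero d] (Q : Set 𝔼) (hne : Q.Nonempty)
    (hQ : Q ⊆ upperHemisphere d)
    (hdist : ∃ ε : ℝ, 0 < ε ∧ ∀ q ∈ Q, ∀ p ∈ equatorSphere d, ε ≤ dist q p) :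
    ∃ C₁ C₂ : ℝ≥0, 0 < C₁ ∧ 0 < C₂ ∧ ∀ (R₁ R₂ : ℝ) (f : 𝔼 → ℝ), 0 ≤ R₁ → R₁ ≤ R₂ →
      ContinuousOn f (closure (sphericalCylinder R₁ R₂ Q)) →
      ContDiffOn ℝ 2 f (interior (sphericalCylinder R₁ R₂ Q)) →
      0 ≤ sSup (f '' parabolicBoundary R₁ R₂ Q) →
      ((sSup (f '' sphericalCylinder R₁ R₂ Q) : ℝ) : EReal) ≤
        (((C₁ : ℝ) * sSup (f '' parabolicBoundary R₁ R₂ Q) : ℝ) : EReal) +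
          (((C₂ : ℝ≥0∞) *
            (∫⁻ x in parabolicContactSet (sphericalCylinder R₁ R₂ Q) f,
              ENNReal.ofReal
                (|radialDeriv f x * (angularOperator f x).det| / ‖x‖ ^ (d - 1))) ^
              (1 / (d : ℝ)) : ℝ≥0∞) : EReal) := by
  obtain ⟨κ, hκ, hκQ⟩ := exists_pos_le_last_coordinate hQ hdist
  set i : Fin d := ⟨d - 1, Nat.sub_one_lt (NeZero.ne d)⟩
  have hκQ := closure_coordinate_ge hκQ
  have hQs : Q ⊆ Metric.sphere 0 1 := fun q hq => mem_sphere_zero_iff_norm.2 (hQ hq).1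
  set ω : ℝ≥0∞ := volume (Metric.ball (0 : 𝔼) 1) with hω
  have hω0 : ω ≠ 0 := (Metric.measure_ball_pos volume _ one_pos).ne'
  have hωt : ω ≠ ⊤ := measure_ball_lt_top.ne
  have hd0 : (0 : ℝ) < d := Nat.cast_pos.2 (NeZero.pos d)
  have hωp0 : (ω⁻¹) ^ (1 / (d : ℝ)) ≠ 0 := by simp [hωt, hω0]
  have hωpt : (ω⁻¹) ^ (1 / (d : ℝ)) ≠ ⊤ := by
    refine ENNReal.rpow_ne_top_of_nonneg (by positivity) (by simp [hω0])
  set W : ℝ≥0 := ((ω⁻¹) ^ (1 / (d : ℝ))).toNNReal with hW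
  have hWc : (W : ℝ≥0∞) = (ω⁻¹) ^ (1 / (d : ℝ)) := ENNReal.coe_toNNReal hωpt
  have hW0 : 0 < W := ENNReal.toNNReal_pos hωp0 hωpt
  -- `C₁ = 1/κ` and `C₂ = (1 + 1/κ) ω^(-1/d)`, with `κ` the lower bound for the last coordinate on
  -- `Q` and `ω` the volume of the unit ball.
  refine ⟨Real.toNNReal (1 / κ), Real.toNNReal (1 + 1 / κ) * W, ?_, ?_, ?_⟩
  · exact Real.toNNReal_pos.2 (by positivity)
  · exact mul_pos (Real.toNNReal_pos.2 (by positivity)) hW0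
  intro R₁ R₂ f hR hRR hc hf hm0
  refine EReal.coe_le_coe_add_coe_ennreal ?_
  set m : ℝ := sSup (f '' parabolicBoundary R₁ R₂ Q) with hm
  set I : ℝ≥0∞ := ∫⁻ x in parabolicContactSet (sphericalCylinder R₁ R₂ Q) f,
              ENNReal.ofReal
                (|radialDeriv f x * (angularOperator f x).det| / ‖x‖ ^ (d - 1)) with hI
  have hQc : IsCompact (closure Q) := (isCompact_sphere 0 1).of_isClosed_subset isClosed_closure
    (closure_subset_sphere hQs)
  have hgc : ContinuousOn (fun p : ℝ × 𝔼 => f (p.1 • p.2)) (Icc R₁ R₂ ×ˢ closure Q) :=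
    hc.comp (Continuous.continuousOn (by fun_prop)) fun p hp =>
      smul_mem_closure_sphericalCylinder hp.1 hp.2
  obtain ⟨⟨r₀, θ₀⟩, ⟨hr₀, hθ₀⟩, hmax⟩ := (isCompact_Icc.prod hQc).exists_isMaxOn
    ((nonempty_Icc.2 hRR).prod hne.closure) hgc
  simp only at hr₀ hθ₀
  have hmax' : ∀ r ∈ Icc R₁ R₂, ∀ θ ∈ closure Q, f (r • θ) ≤ f (r₀ • θ₀) := fun r hr θ hθ =>
    hmax (show (r, θ) ∈ Icc R₁ R₂ ×ˢ closure Q from ⟨hr, hθ⟩)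
  set M : ℝ := f (r₀ • θ₀) with hM
  have hsup : sSup (f '' sphericalCylinder R₁ R₂ Q) ≤ M := by
    obtain ⟨q, hq⟩ := hne
    refine csSup_le ⟨_, mem_image_of_mem f ⟨R₁, left_mem_Icc.2 hRR, q, hq, rfl⟩⟩ ?_
    rintro _ ⟨_, ⟨r, hr, θ, hθ, rfl⟩, rfl⟩
    exact hmax' r hr θ (subset_closure hθ)
  have hbdd : BddAbove (f '' parabolicBoundary R₁ R₂ Q) := by
    refine ⟨M, ?_⟩
    rintro _ ⟨_, ⟨θ, hθ, rfl⟩ | ⟨r, hr, θ, hθ, rfl⟩, rfl⟩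
    · exact hmax' R₂ (right_mem_Icc.2 hRR) θ (subset_closure hθ)
    · exact hmax' r hr θ hθ.1
  have htop : ∀ θ ∈ closure Q, f (R₂ • θ) ≤ m := fun θ hθ =>
    le_on_closure (f := fun θ => f (R₂ • θ)) (g := fun _ => m)
      (fun q hq => le_csSup hbdd ⟨_, Or.inl ⟨q, hq, rfl⟩, rfl⟩)
      (hc.comp (Continuous.continuousOn (by fun_prop)) fun q hq =>
        smul_mem_closure_sphericalCylinder (right_mem_Icc.2 hRR) hq) continuousOn_const hθ
  have hside : ∀ r ∈ Icc R₁ R₂, ∀ θ ∈ sphereFrontier Q, f (r • θ) ≤ m := fun r hr θ hθ =>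
    le_csSup hbdd ⟨_, Or.inr ⟨r, hr, θ, hθ, rfl⟩, rfl⟩
  have hnorm : ∀ θ ∈ closure Q, ‖θ‖ = 1 := fun θ hθ =>
    mem_sphere_zero_iff_norm.1 (closure_subset_sphere hQs hθ)
  refine (ENNReal.ofReal_le_ofReal (sub_le_sub_right hsup _)).trans ?_
  rw [Real.coe_toNNReal _ (by positivity)]
  rcases le_or_gt M (1 / κ * m) with h | h
  · rw [ENNReal.ofReal_of_nonpos (by linarith)]
    exact zero_le
  -- The radius `ρ` and the height `a` of the centre solve `a κ = m + ρ` and `a + ρ = M`. For `X` in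
  -- the ball the first gives `⟪X, θ⟫ > m` on `closure Q`, the second `⟪X, θ₀⟫ < M`.
  set ρ : ℝ := (M - 1 / κ * m) / (1 + 1 / κ) with hρ
  have hρ0 : 0 < ρ := div_pos (by linarith) (by positivity)
  have hMρ : M - 1 / κ * m = (1 + 1 / κ) * ρ := by rw [hρ]; field_simp
  set a : ℝ := (m + ρ) / κ with ha
  have ha0 : 0 ≤ a := by positivity
  have haκ : a * κ = m + ρ := by rw [ha]; field_simp
  have haM : a + ρ = M := by
    have : a = 1 / κ * m + 1 / κ * ρ := by rw [ha]; ring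
    linarith
  have hball : Metric.ball (a • EuclideanSpace.single i (1 : ℝ)) ρ ⊆
      sphericalGradientMap f '' sphericalContactSet R₁ R₂ Q f := by
    intro X hX
    have hXρ : ‖X - a • EuclideanSpace.single i (1 : ℝ)‖ < ρ := mem_ball_iff_norm.1 hX
    have hXθ : ∀ θ ∈ closure Q, |inner ℝ X θ - a * θ i| < ρ := fun θ hθ => by
      have h1 := abs_real_inner_le_norm (X - a • EuclideanSpace.single i (1 : ℝ)) θ
      rw [inner_sub_left, inner_smul_left, inner_single_one_left, hnorm θ hθ, mul_one] at h1
      exact lt_of_le_of_lt h1 hXρ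
    have hlow : ∀ θ ∈ closure Q, m < inner ℝ X θ := fun θ hθ => by
      have h1 := (abs_lt.1 (hXθ θ hθ)).1
      have h2 := mul_le_mul_of_nonneg_left (hκQ θ hθ) ha0
      linarith
    obtain ⟨x, hx, he⟩ := exists_mem_sphericalContactSet hR hQs hc hf (X := X)
      (fun θ hθ => (htop θ hθ).trans_lt (hlow θ hθ))
      (fun r hr θ hθ => (hside r hr θ hθ).trans_lt (hlow θ hθ.1)) hr₀ hθ₀ (by
        have h1 := (abs_lt.1 (hXθ θ₀ hθ₀)).2
        have h2 := mul_le_mul_of_nonneg_left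
          ((norm_le_of_abs_last i θ₀).trans_eq (hnorm θ₀ hθ₀)) ha0
        linarith)
    exact ⟨x, hx, he⟩
  have hvol := volume_le_lintegral_parabolicContactSet hR hQs hc hf hball
  rw [Measure.addHaar_ball _ _ hρ0.le, finrank_euclideanSpace_fin, ← hω, ← hI,
    ENNReal.ofReal_pow hρ0.le] at hvol
  have h1 : ENNReal.ofReal ρ ^ d ≤ I * ω⁻¹ := by
    rw [← div_eq_mul_inv]
    exact ENNReal.le_div_iff_mul_le (Or.inl hω0) (Or.inl hωt) |>.2 hvol
  have h2 : ENNReal.ofReal ρ ≤ (I * ω⁻¹) ^ (1 / (d : ℝ)) := by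
    rw [one_div, ENNReal.le_rpow_inv_iff hd0, ENNReal.rpow_natCast]
    exact h1
  rw [ENNReal.mul_rpow_of_nonneg _ _ (by positivity), ← hWc] at h2
  rw [hMρ, ENNReal.ofReal_mul (by positivity), ENNReal.coe_mul, mul_assoc]
  rw [mul_comm (W : ℝ≥0∞)]
  exact mul_le_mul_right h2 _

end

/-! ### Uniqueness of the Gauss curvature -/

/-- Adding the two expansions at `s w` and at `-s w` cancels the linear terms, so the quadratic form
of `B - B'` is `o(s²)` along every line and vanishes. A symmetric operator with zero quadratic form
is zero. -/
theorem HasAlexandrovHessianAt.unique {F : Type*} [NormedAddCommGroup F] [InnerProductSpace ℝ F]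
    {h : F → ℝ} {x g g' : F} {B B' : F →L[ℝ] F} (H : HasAlexandrovHessianAt h x g B)
    (H' : HasAlexandrovHessianAt h x g' B') : B = B' := by
  have hlin : ((B - B' : F →L[ℝ] F) : F →ₗ[ℝ] F) = 0 := by
    have hs : ((B - B' : F →L[ℝ] F) : F →ₗ[ℝ] F).IsSymmetric := H.1.sub H'.1
    refine hs.inner_map_self_eq_zero.1 fun w => ?_
    change inner ℝ ((B - B') w) w = 0
    have hd := H'.2.sub H.2
    rw [Asymptotics.isLittleO_iff] at hd
    by_contra hne
    have hw : w ≠ 0 := by rintro rfl; simp at hne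
    have hwp : 0 < ‖w‖ := norm_pos_iff.2 hw
    set q : ℝ := inner ℝ ((B - B') w) w with hq
    have hc : 0 < |q| / (4 * ‖w‖ ^ 2) := by positivity
    have t1 : Tendsto (fun s : ℝ => s • w) (𝓝[>] 0) (𝓝 0) := by
      have : Tendsto (fun s : ℝ => s • w) (𝓝 0) (𝓝 ((0 : ℝ) • w)) :=
        (continuous_id.smul continuous_const).tendsto 0
      rw [zero_smul] at this
      exact this.mono_left nhdsWithin_le_nhds
    have t2 : Tendsto (fun s : ℝ => -(s • w)) (𝓝[>] 0) (𝓝 0) := by simpa using t1.neg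
    obtain ⟨s, ⟨h1, h2⟩, hs0⟩ := (((t1.eventually (hd hc)).and (t2.eventually (hd hc))).and
      self_mem_nhdsWithin).exists
    have hs0 : 0 < s := hs0
    simp only [norm_neg, map_neg, inner_neg_left, inner_neg_right, map_smul, inner_smul_left,
      inner_smul_right, conj_trivial, norm_pow, norm_smul, Real.norm_eq_abs, sq_abs,
      abs_of_pos hs0] at h1 h2
    have e : s * (s * q) = s * (s * inner ℝ (B w) w) - s * (s * inner ℝ (B' w) w) := by
      rw [hq, sub_apply, inner_sub_left]; ring
    have h3 : |s * (s * q)| ≤ 2 * (|q| / (4 * ‖w‖ ^ 2) * (s * ‖w‖) ^ 2) := by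
      rw [e, abs_le]
      rw [abs_le] at h1 h2
      constructor <;> linarith [h1.1, h1.2, h2.1, h2.2]
    have h4 : 2 * (|q| / (4 * ‖w‖ ^ 2) * (s * ‖w‖) ^ 2) = s * s * |q| / 2 := by
      field_simp
      norm_num
    rw [h4, abs_mul, abs_mul, abs_of_pos hs0] at h3
    have h5 : 0 < s * s * |q| := by positivity
    linarith
  exact sub_eq_zero.1 (ContinuousLinearMap.ext fun w => LinearMap.congr_fun hlin w)

section

variable {d : ℕ}

local notation "𝔼" => EuclideanSpace ℝ (Fin d)

theorem IsGaussCurvatureAt.unique {S : Set 𝔼} {x : 𝔼} {k k' : ℝ} (h : IsGaussCurvatureAt S x k)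
    (h' : IsGaussCurvatureAt S x k') : k = k' := by
  obtain ⟨n, B, hn, ⟨g, hB⟩, -, rfl⟩ := h
  obtain ⟨n', B', hn', ⟨g', hB'⟩, -, rfl⟩ := h'
  obtain rfl : n = n' := (hn' n).1 ((hn n).2 rfl)
  rw [hB.unique hB']

theorem IsGaussCurvatureAt.convexGaussCurvature_eq {S : Set 𝔼} {x : 𝔼} {k : ℝ}
    (h : IsGaussCurvatureAt S x k) : convexGaussCurvature S x = k := by
  have hex : ∃ k, IsGaussCurvatureAt S x k := ⟨k, h⟩
  rw [convexGaussCurvature, dif_pos hex]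
  exact hex.choose_spec.unique h

/-! ### Second order expansion of the support function -/

theorem convexSupportFunction_le {S : Set 𝔼} (hS : S.Nonempty) {p : 𝔼} {b : ℝ}
    (h : ∀ y ∈ S, inner ℝ p y ≤ b) : convexSupportFunction (convexHull ℝ S) p ≤ b := by
  refine csSup_le (hS.convexHull.image _) ?_
  rintro _ ⟨y, hy, rfl⟩
  have hconv : Convex ℝ {y : 𝔼 | inner ℝ p y ≤ b} :=
    convex_halfSpace_le (innerSL ℝ p).isLinear b
  exact convexHull_min h hconv hy

theorem le_convexSupportFunction {S : Set 𝔼} (hS : Bornology.IsBounded S) (p : 𝔼) {y : 𝔼}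
    (hy : y ∈ S) : inner ℝ p y ≤ convexSupportFunction (convexHull ℝ S) p := by
  refine le_csSup ?_ ⟨y, subset_convexHull ℝ S hy, rfl⟩
  obtain ⟨C, hC⟩ := (isBounded_convexHull.2 hS).exists_norm_le
  refine ⟨‖p‖ * C, ?_⟩
  rintro _ ⟨z, hz, rfl⟩
  exact (real_inner_le_norm p z).trans (mul_le_mul_of_nonneg_left (hC z hz) (norm_nonneg _))

theorem abs_sqrt_one_sub_sub_le {u : ℝ} (h0 : 0 ≤ u) (h1 : u ≤ 1) :
    |Real.sqrt (1 - u) - 1 + u / 2| ≤ u ^ 2 := by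
  have hs := Real.sq_sqrt (show 0 ≤ 1 - u by linarith)
  have hp := Real.sqrt_nonneg (1 - u)
  rw [abs_le]
  constructor
  · have : 1 - u / 2 - u ^ 2 / 2 ≤ Real.sqrt (1 - u) := by
      apply Real.le_sqrt_of_sq_le
      nlinarith [mul_nonneg h0 h0, mul_nonneg (mul_nonneg h0 h0) h0,
        mul_nonneg (mul_nonneg h0 h0) (sub_nonneg.2 h1)]
    nlinarith
  · nlinarith [sq_nonneg (Real.sqrt (1 - u) - 1)]

theorem inner_sphereChart {n : 𝔼} (hn : ‖n‖ = 1) (w : SphereTangent n) (h : 𝔼) :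
    inner ℝ (sphereChart n w) h =
      inner ℝ w (orthogonalPart n h) + Real.sqrt (1 - ‖w‖ ^ 2) * inner ℝ n h := by
  rw [sphereChart, inner_add_left, inner_smul_left, real_inner_comm (orthogonalPart n h),
    inner_orthogonalPart hn, real_inner_comm h]
  simp

/-- Fenchel's inequality for the quadratic forms of `t W` and of its inverse `t⁻¹ V`, by expanding
`⟪W z, z⟫ ≥ 0` at `z = t k - V w`. -/
theorem inner_sub_mul_inner_le {F : Type*} [NormedAddCommGroup F] [InnerProductSpace ℝ F]
    {W V : F →L[ℝ] F} (hW : (W : F →ₗ[ℝ] F).IsSymmetric) (hV : ∀ w, W (V w) = w)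
    (hpos : ∀ k, 0 ≤ inner ℝ (W k) k) (w k : F) {t : ℝ} (ht : 0 < t) :
    inner ℝ w k - t * (inner ℝ (W k) k / 2) ≤ t⁻¹ * (inner ℝ (V w) w / 2) := by
  have h4 := hpos (t • k - V w)
  have h5 : inner ℝ (W k) (V w) = inner ℝ w k := by
    have : inner ℝ (W k) (V w) = inner ℝ k (W (V w)) := hW k (V w)
    rw [this, hV, real_inner_comm]
  rw [map_sub, map_smul, hV, inner_sub_left, inner_sub_right, inner_sub_right,
    inner_smul_left, inner_smul_left, inner_smul_right, inner_smul_right, h5,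
    real_inner_comm (V w)] at h4
  simp only [conj_trivial] at h4
  rw [inv_mul_eq_div, le_div_iff₀ ht]
  nlinarith

-- Near `x` the set lies between paraboloids of height `-τ ⟪W k, k⟫/2` over `x + n^⊥`, with `τ` as
-- close to `1` as desired on either side. By Legendre duality the support function in direction
-- `sphereChart n w` is `⟪sphereChart n w, x⟫ + ⟪V w, w⟫/2 + o(|w|²)`. In the first term `√(1 -
-- |w|²) ⟪n, x⟫` contributes `-H(n)|w|²/2`, hence the Hessian `V - H(n) Id`.
set_option maxHeartbeats 1000000 in
theorem hasSphericalAlexandrovHessianAt_convexSupportFunction {S : Set 𝔼}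
    (hS : Bornology.IsBounded S) {x n : 𝔼} (hx : x ∈ S) (hn : ‖n‖ = 1)
    {W V : SphereTangent n →L[ℝ] SphereTangent n}
    (hW : (W : SphereTangent n →ₗ[ℝ] SphereTangent n).IsSymmetric)
    (hVs : (V : SphereTangent n →ₗ[ℝ] SphereTangent n).IsSymmetric) (hV : ∀ w, W (V w) = w)
    (hpos : ∀ k, 0 ≤ inner ℝ (W k) k) (hH : ∀ y ∈ S, inner ℝ n (y - x) ≤ 0)
    (hfar : ∀ δ > 0, ∃ η > 0, ∀ y ∈ S, δ ≤ ‖y - x‖ → inner ℝ n (y - x) ≤ -η)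
    (hup : ∀ τ : ℝ, 0 < τ → τ < 1 → ∃ δ > 0, ∀ y ∈ S, ‖y - x‖ < δ → inner ℝ n (y - x) ≤
      -(τ * (inner ℝ (W (orthogonalPart n (y - x))) (orthogonalPart n (y - x)) / 2)))
    (hlow : ∀ τ : ℝ, 1 < τ → ∃ δ > 0, ∀ k : SphereTangent n, ‖k‖ < δ →
      x + (k : 𝔼) - (τ * (inner ℝ (W k) k / 2)) • n ∈ S) :
    convexSupportFunction (convexHull ℝ S) n = inner ℝ n x ∧
    HasSphericalAlexandrovHessianAt (convexSupportFunction (convexHull ℝ S)) n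
      (V - convexSupportFunction (convexHull ℝ S) n • ContinuousLinearMap.id ℝ _) := by
  have hHn : convexSupportFunction (convexHull ℝ S) n = inner ℝ n x := by
    refine le_antisymm (convexSupportFunction_le ⟨x, hx⟩ fun y hy => ?_)
      (le_convexSupportFunction hS n hx)
    have := hH y hy
    rw [inner_sub_right] at this
    linarith
  refine ⟨hHn, ?_⟩
  have hVpos : ∀ w, 0 ≤ inner ℝ (V w) w := fun w => by
    have := hpos (V w)
    rw [hV, real_inner_comm] at this
    exact this
  have hVle : ∀ w, inner ℝ (V w) w ≤ ‖V‖ * ‖w‖ ^ 2 := fun w => by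
    refine (real_inner_le_norm _ _).trans ?_
    rw [pow_two, ← mul_assoc]
    exact mul_le_mul_of_nonneg_right (V.le_opNorm w) (norm_nonneg _)
  refine ⟨orthogonalPart n x, ?_, ?_⟩
  · exact hVs.sub (LinearMap.IsSymmetric.id.smul (by simp))
  rw [Asymptotics.isLittleO_iff]
  intro c hc
  set h₀ : ℝ := inner ℝ n x with hh₀
  -- Makes `3ε ⟪V w, w⟫ ≤ c |w|²`. The Legendre estimate then costs at most `c/2 · |w|²`; the other
  -- half is spent on expanding the square root.
  set ε : ℝ := min 1 (c / (3 * (‖V‖ + 1))) with hε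
  have hε0 : 0 < ε := lt_min one_pos (by positivity)
  have hε1 : ε ≤ 1 := min_le_left _ _
  have hεc : 3 * ε * (‖V‖ + 1) ≤ c := by
    have h1 : ε ≤ c / (3 * (‖V‖ + 1)) := min_le_right _ _
    rw [le_div_iff₀ (by positivity)] at h1
    linarith
  have hτ1 : (1 + ε)⁻¹ < 1 := inv_lt_one_of_one_lt₀ (by linarith)
  obtain ⟨δ₁, hδ₁, hup⟩ := hup (1 + ε)⁻¹ (by positivity) hτ1
  obtain ⟨δ₂, hδ₂, hlow⟩ := hlow (1 + ε) (by linarith)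
  obtain ⟨η, hη, hfar⟩ := hfar δ₁ hδ₁
  obtain ⟨R, hR⟩ := hS.exists_norm_le
  have hs : Tendsto (fun w : SphereTangent n => Real.sqrt (1 - ‖w‖ ^ 2)) (𝓝 0) (𝓝 1) := by
    have : Continuous (fun w : SphereTangent n => Real.sqrt (1 - ‖w‖ ^ 2)) := by fun_prop
    simpa using this.tendsto 0
  have hnz : Tendsto (fun w : SphereTangent n => ‖w‖) (𝓝 0) (𝓝 0) := by
    simpa using (continuous_norm (E := SphereTangent n)).tendsto 0
  have hVz : Tendsto (fun w : SphereTangent n => ‖V w‖) (𝓝 0) (𝓝 0) := by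
    simpa using V.continuous.norm.tendsto 0
  have hs2 : ∀ᶠ w in 𝓝 (0 : SphereTangent n), (1 + ε)⁻¹ < Real.sqrt (1 - ‖w‖ ^ 2) :=
    hs.eventually (lt_mem_nhds hτ1)
  have hs3 : ∀ᶠ w in 𝓝 (0 : SphereTangent n), (1 / 2 : ℝ) < Real.sqrt (1 - ‖w‖ ^ 2) :=
    hs.eventually (lt_mem_nhds (by norm_num))
  have hw1 : ∀ᶠ w in 𝓝 (0 : SphereTangent n), ‖w‖ < 1 := hnz.eventually (gt_mem_nhds one_pos)
  have hw2 : ∀ᶠ w in 𝓝 (0 : SphereTangent n), ‖w‖ * (2 * R) < η / 2 :=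
    (by simpa using hnz.mul_const (2 * R) :
      Tendsto (fun w : SphereTangent n => ‖w‖ * (2 * R)) (𝓝 0) (𝓝 0)).eventually
      (gt_mem_nhds (by positivity))
  have hw3 : ∀ᶠ w in 𝓝 (0 : SphereTangent n), |h₀| * ‖w‖ ^ 2 < c / 2 :=
    (by simpa using (hnz.pow 2).const_mul |h₀| :
      Tendsto (fun w : SphereTangent n => |h₀| * ‖w‖ ^ 2) (𝓝 0) (𝓝 0)).eventually
      (gt_mem_nhds (by positivity))
  filter_upwards [hs2, hs3, hw1, hw2, hw3, hVz.eventually (gt_mem_nhds hδ₂)]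
    with w e1 e2 e3 e4 e5 e6
  set s : ℝ := Real.sqrt (1 - ‖w‖ ^ 2) with hs_def
  have hs1 : s ≤ 1 := Real.sqrt_le_one.2 (by nlinarith [norm_nonneg w])
  have hs0 : 0 < s := by linarith
  set H : ℝ := convexSupportFunction (convexHull ℝ S) (sphereChart n w) with hHdef
  have hxw : inner ℝ (sphereChart n w) x = inner ℝ w (orthogonalPart n x) + s * h₀ :=
    inner_sphereChart hn w x
  have hV0 := hVpos w
  have hV1 := hVle w
  have hwsq : 0 ≤ ‖w‖ ^ 2 := sq_nonneg _
  have hVw : ε * inner ℝ (V w) w * 3 ≤ c * ‖w‖ ^ 2 := by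
    have h1 : ε * inner ℝ (V w) w ≤ ε * ((‖V‖ + 1) * ‖w‖ ^ 2) :=
      mul_le_mul_of_nonneg_left (by nlinarith) hε0.le
    nlinarith
  have hupper : H ≤ inner ℝ (sphereChart n w) x + (inner ℝ (V w) w / 2 + c / 2 * ‖w‖ ^ 2) := by
    refine convexSupportFunction_le ⟨x, hx⟩ fun y hy => ?_
    rw [← sub_le_iff_le_add', ← inner_sub_right, inner_sphereChart hn]
    rcases lt_or_ge ‖y - x‖ δ₁ with hnear | hfar'
    · have h1 := hup y hy hnear
      set k := orthogonalPart n (y - x) with hk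
      -- Both `s` and `(1 + ε)⁻¹` are near `1`: from `s⁻¹ ≤ 1 + ε` and `ε ≤ 1` comes `t⁻¹ ≤ (1 + ε)²
      -- ≤ 1 + 3ε`.
      set t : ℝ := s * (1 + ε)⁻¹ with ht
      have ht0 : 0 < t := by positivity
      have h2 : s * inner ℝ n (y - x) ≤ -(t * (inner ℝ (W k) k / 2)) := by
        have := mul_le_mul_of_nonneg_left h1 hs0.le
        rw [ht]; linarith
      have h6 : t⁻¹ ≤ 1 + 3 * ε := by
        have h7 : t⁻¹ = s⁻¹ * (1 + ε) := by rw [ht, mul_inv, inv_inv]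
        have h8 : s⁻¹ ≤ 1 + ε := inv_le_of_inv_le₀ (by positivity) e1.le
        rw [h7]
        nlinarith
      have h9 := inner_sub_mul_inner_le hW hV hpos w k ht0
      have h10 : t⁻¹ * (inner ℝ (V w) w / 2) ≤ (1 + 3 * ε) * (inner ℝ (V w) w / 2) :=
        mul_le_mul_of_nonneg_right h6 (by positivity)
      linarith
    -- Away from `x` the loss `s η ≥ η/2` in the normal direction outweighs the tangential gain `2R
    -- |w|`.
    · have h1 := hfar y hy hfar'
      have h2 : inner ℝ w (orthogonalPart n (y - x)) ≤ ‖w‖ * (2 * R) := by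
        rw [real_inner_comm, inner_orthogonalPart hn]
        have h3 := real_inner_le_norm (y - x) (w : 𝔼)
        have h4 : ‖y - x‖ ≤ 2 * R := (norm_sub_le _ _).trans (by linarith [hR y hy, hR x hx])
        have h5 : ‖(w : 𝔼)‖ = ‖w‖ := rfl
        rw [h5] at h3
        nlinarith [norm_nonneg w]
      have h6 : s * inner ℝ n (y - x) ≤ 1 / 2 * -η := by nlinarith
      nlinarith
  have hlower : inner ℝ (sphereChart n w) x + (inner ℝ (V w) w / 2 - c / 2 * ‖w‖ ^ 2) ≤ H := by
    -- The test point lies over `k = V w`, where `⟪w, k⟫ - ⟪W k, k⟫/2` is maximal.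
    have h1 := le_convexSupportFunction hS (sphereChart n w) (hlow (V w) e6)
    refine le_trans ?_ h1
    have h2 : inner ℝ (sphereChart n w) ((V w : SphereTangent n) : 𝔼) = inner ℝ (V w) w := by
      rw [sphereChart, inner_add_left, inner_smul_left, inner_left_orthogonal_singleton, mul_zero,
        add_zero, real_inner_comm]
      rfl
    have h3 : inner ℝ (sphereChart n w) n = s := by
      rw [sphereChart, inner_add_left, inner_smul_left, inner_right_orthogonal_singleton,
        real_inner_self_eq_norm_sq, hn]
      simp [hs_def]
    rw [inner_sub_right, inner_add_right, h2, inner_smul_right, h3, hV, real_inner_comm (V w) w]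
    have h4 : (1 + ε) * (inner ℝ (V w) w / 2) * s ≤ (1 + ε) * (inner ℝ (V w) w / 2) :=
      mul_le_of_le_one_right (by positivity) hs1
    nlinarith
  have hsq := abs_sqrt_one_sub_sub_le hwsq (by nlinarith [norm_nonneg w])
  rw [← hs_def] at hsq
  have hrem : |h₀ * (s - 1 + ‖w‖ ^ 2 / 2)| ≤ c / 2 * ‖w‖ ^ 2 := by
    rw [abs_mul]
    calc |h₀| * |s - 1 + ‖w‖ ^ 2 / 2| ≤ |h₀| * (‖w‖ ^ 2) ^ 2 :=
          mul_le_mul_of_nonneg_left hsq (abs_nonneg _)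
      _ = |h₀| * ‖w‖ ^ 2 * ‖w‖ ^ 2 := by ring
      _ ≤ _ := mul_le_mul_of_nonneg_right e5.le hwsq
  rw [zero_add, sphereChart_zero, hHn, ← hHdef]
  have hB : inner ℝ ((V - h₀ • ContinuousLinearMap.id ℝ (SphereTangent n)) w) w =
      inner ℝ (V w) w - h₀ * ‖w‖ ^ 2 := by
    rw [sub_apply, smul_apply, ContinuousLinearMap.id_apply, inner_sub_left, inner_smul_left,
      real_inner_self_eq_norm_sq]
    rfl
  rw [hB, Real.norm_eq_abs, norm_pow, norm_norm, abs_le]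
  rw [abs_le] at hrem
  rw [hxw, real_inner_comm (orthogonalPart n x) w] at hupper hlower
  constructor <;> linarith [hrem.1, hrem.2]

end

/-! ### Shape operator of a level surface -/

/-- If `⟪W k, k⟫ = 0`, positivity at `k + s W k` for all `s` forces `W k = 0`; so the form is
positive definite, and its minimum on the unit sphere serves as `μ`. -/
theorem exists_pos_mul_norm_sq_le_inner {F : Type*} [NormedAddCommGroup F] [InnerProductSpace ℝ F]
    [FiniteDimensional ℝ F] {W : F →L[ℝ] F} (hs : (W : F →ₗ[ℝ] F).IsSymmetric)
    (hpos : ∀ k, 0 ≤ inner ℝ (W k) k) (hinj : ∀ k, W k = 0 → k = 0) :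
    ∃ μ : ℝ, 0 < μ ∧ ∀ k, μ * ‖k‖ ^ 2 ≤ inner ℝ (W k) k := by
  have hpos' : ∀ k, k ≠ 0 → 0 < inner ℝ (W k) k := by
    intro k hk
    refine lt_of_le_of_ne (hpos k) fun h0 => hk (hinj k ?_)
    have h1 : ∀ s : ℝ, 0 ≤ s * (2 * inner ℝ (W k) (W k)) + s * s * inner ℝ (W (W k)) (W k) := by
      intro s
      have h2 := hpos (k + s • W k)
      have h3 : inner ℝ (W (W k)) k = inner ℝ (W k) (W k) := hs (W k) k
      rw [map_add, map_smul, inner_add_left, inner_add_right, inner_add_right, inner_smul_left,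
        inner_smul_left, inner_smul_right, inner_smul_right, ← h0, h3] at h2
      simp only [conj_trivial] at h2
      linarith
    set a : ℝ := inner ℝ (W k) (W k) with ha
    set b : ℝ := inner ℝ (W (W k)) (W k) with hb
    have hb0 : 0 ≤ b := hpos (W k)
    have ha0 : 0 ≤ a := real_inner_self_nonneg
    -- For small negative `s` the linear term `2 s a` dominates `s² b`; this `s` is small enough and
    -- avoids dividing by a possibly zero `b`.
    have h4 := h1 (-(a / (b + 1)))
    have h5 : a / (b + 1) * (b + 1) = a := div_mul_cancel₀ _ (by linarith)
    set q := a / (b + 1) with hq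
    have hq0 : 0 ≤ q := by positivity
    have h6 : q * (2 * a - q * b) ≤ 0 := by linarith
    have h7 : a ≤ 2 * a - q * b := by nlinarith
    have h8 : q * a ≤ 0 := (mul_le_mul_of_nonneg_left h7 hq0).trans h6
    have h9 : a = 0 := by
      rw [← h5] at h8
      have h10 : q = 0 := by nlinarith [mul_nonneg (mul_nonneg hq0 hq0) hb0]
      rw [← h5, h10, zero_mul]
    exact inner_self_eq_zero.1 h9
  rcases subsingleton_or_nontrivial F with hF | hF
  · exact ⟨1, one_pos, fun k => by rw [Subsingleton.elim k 0]; simp⟩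
  have hne : (Metric.sphere (0 : F) 1).Nonempty := NormedSpace.sphere_nonempty.2 zero_le_one
  obtain ⟨k₀, hk₀, hmin⟩ := (isCompact_sphere (0 : F) 1).exists_isMinOn hne
    (f := fun k => inner ℝ (W k) k) (Continuous.continuousOn (by fun_prop))
  have hk₀' : k₀ ≠ 0 := by
    rintro rfl
    simp at hk₀
  refine ⟨inner ℝ (W k₀) k₀, hpos' k₀ hk₀', fun k => ?_⟩
  rcases eq_or_ne k 0 with rfl | hk
  · simp
  have hkp : 0 < ‖k‖ := norm_pos_iff.2 hk
  have h1 : inner ℝ (W k₀) k₀ ≤ inner ℝ (W (‖k‖⁻¹ • k)) (‖k‖⁻¹ • k) :=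
    hmin (show ‖k‖⁻¹ • k ∈ Metric.sphere (0 : F) 1 by
      rw [mem_sphere_zero_iff_norm, norm_smul, norm_inv, norm_norm, inv_mul_cancel₀ hkp.ne'])
  rw [map_smul, inner_smul_left, inner_smul_right, conj_trivial] at h1
  calc inner ℝ (W k₀) k₀ * ‖k‖ ^ 2 ≤ ‖k‖⁻¹ * (‖k‖⁻¹ * inner ℝ (W k) k) * ‖k‖ ^ 2 := by gcongr
    _ = inner ℝ (W k) k := by field_simp

section

variable {d : ℕ}

local notation "𝔼" => EuclideanSpace ℝ (Fin d)

/-- If `∇ v x = - m n` with a unit vector `n`, the shape operator at `x` of the boundary of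
`{v x ≤ v}` with respect to the outer normal `n`. -/
noncomputable def shapeOperator (v : 𝔼 → ℝ) (x n : 𝔼) (m : ℝ) :
    SphereTangent n →L[ℝ] SphereTangent n :=
  (-m⁻¹) • (orthogonalPart n).comp ((fderiv ℝ (∇ v) x).comp (SphereTangent n).subtypeL)

theorem inner_shapeOperator {v : 𝔼 → ℝ} {x n : 𝔼} (m : ℝ) (hn : ‖n‖ = 1)
    (k l : SphereTangent n) :
    inner ℝ (shapeOperator v x n m k) l = -m⁻¹ * inner ℝ (fderiv ℝ (∇ v) x k) (l : 𝔼) := by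
  rw [shapeOperator, smul_apply, inner_smul_left, ContinuousLinearMap.comp_apply,
    inner_orthogonalPart hn]
  rfl

theorem isSymmetric_shapeOperator {v : 𝔼 → ℝ} {x n : 𝔼} (m : ℝ) (hn : ‖n‖ = 1)
    (hv : ContDiffAt ℝ 2 v x) :
    (shapeOperator v x n m : SphereTangent n →ₗ[ℝ] SphereTangent n).IsSymmetric := by
  intro k l
  change inner ℝ (shapeOperator v x n m k) l = inner ℝ k (shapeOperator v x n m l)
  rw [real_inner_comm _ k, inner_shapeOperator m hn, inner_shapeOperator m hn,
    real_inner_comm (k : 𝔼)]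
  congr 1
  exact isSymmetric_fderiv_gradient hv k l

/-- The map sending a point of a level surface to the level times the normal. -/
noncomputable def levelNormalMap (v : 𝔼 → ℝ) (c : ℝ) (x : 𝔼) : 𝔼 :=
  -((v x + c) • ‖∇ v x‖⁻¹ • ∇ v x)

/-- The map is `(v + c) ν` with `ν` the unit normal. Along the level surface `v` is stationary and
`ν` varies by the shape operator. Across it the variation of `ν` is orthogonal to `n`, which leaves
`⟪∇v, n⟫ = -m`. -/
theorem exists_hasFDerivAt_levelNormalMap {v : 𝔼 → ℝ} {x n : 𝔼} {m : ℝ} (c : ℝ) (hn : ‖n‖ = 1)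
    (hm : 0 < m) (hv : ContDiffAt ℝ 2 v x) (hg : ∇ v x = -(m • n)) :
    ∃ L : 𝔼 →L[ℝ] 𝔼, HasFDerivAt (levelNormalMap v c) L x ∧
      L.det = -m * ((v x + c) ^ (d - 1) * (shapeOperator v x n m).det) := by
  have hB := hasFDerivAt_gradient_of_contDiffAt hv
  have hvd := (hv.differentiableAt (by norm_num)).hasGradientAt.hasFDerivAt
  have hgm : ‖∇ v x‖ = m := by rw [hg, norm_neg, norm_smul, hn, mul_one, Real.norm_of_nonneg hm.le]
  have hnm : ‖-(m • n)‖ = m := hg ▸ hgm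
  have hg0 : ∇ v x ≠ 0 := norm_ne_zero_iff.1 (by rw [hgm]; exact hm.ne')
  have hn1 : HasFDerivAt (fun x : 𝔼 => ‖x‖) ((1 / ‖∇ v x‖) • innerSL ℝ (∇ v x)) (∇ v x) := by
    have h := (hasStrictFDerivAt_norm_sq (∇ v x)).hasFDerivAt.sqrt
      (pow_ne_zero 2 (norm_ne_zero_iff.2 hg0))
    refine (h.congr_fderiv ?_).congr_of_eventuallyEq (Eventually.of_forall fun y => ?_)
    · ext u
      simp [Real.sqrt_sq (norm_nonneg (∇ v x))]
      field_simp
    · simp [Real.sqrt_sq (norm_nonneg y)]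
  have hn2 := ((hasDerivAt_inv (norm_ne_zero_iff.2 hg0)).comp_hasFDerivAt x (hn1.comp x hB)).smul hB
  have h := ((hvd.add_const c).smul hn2).neg
  refine ⟨_, h, ?_⟩
  have hnk : ∀ k : SphereTangent n, inner ℝ n (k : 𝔼) = 0 := inner_left_orthogonal_singleton
  have hnn : inner ℝ n n = (1 : ℝ) := by rw [real_inner_self_eq_norm_sq, hn]; norm_num
  have hrank : Module.finrank ℝ (SphereTangent n) = d - 1 := by
    have h2 : _ + Module.finrank ℝ (SphereTangent n) = _ :=
      Submodule.finrank_add_finrank_orthogonal (Submodule.span ℝ {n})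
    have h3 : Module.finrank ℝ (Submodule.span ℝ {n}) = 1 :=
      finrank_span_singleton (by rintro h0; simp [h0] at hn)
    rw [h3, finrank_euclideanSpace_fin] at h2
    omega
  have hdet : ((v x + c) • shapeOperator v x n m).det =
      (v x + c) ^ (d - 1) * (shapeOperator v x n m).det := by
    rw [← hrank]
    exact LinearMap.det_smul _ _
  rw [det_eq_inner_mul_det_of_map_orthogonal _ hn ((v x + c) • shapeOperator v x n m), hdet]
  · congr 1
    simp only [neg_apply, add_apply, smul_apply, ContinuousLinearMap.smulRight_apply,
      ContinuousLinearMap.comp_apply, InnerProductSpace.toDual_apply_apply, innerSL_apply_apply,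
      hg, hnm, inner_neg_right, inner_neg_left, inner_add_right, inner_smul_right, inner_smul_left,
      hnn, conj_trivial, smul_eq_mul, Function.comp_apply, Pi.smul_apply']
    field_simp
    ring
  · intro k
    have hS : ((shapeOperator v x n m k : SphereTangent n) : 𝔼) =
        (-m⁻¹) • (fderiv ℝ (∇ v) x k - inner ℝ n (fderiv ℝ (∇ v) x k) • n) := by
      rw [← coe_orthogonalPart hn]
      rfl
    have hS' : ((((v x + c) • shapeOperator v x n m) k : SphereTangent n) : 𝔼) =
        (v x + c) • ((shapeOperator v x n m k : SphereTangent n) : 𝔼) := rfl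
    rw [hS', hS]
    simp only [neg_apply, add_apply, smul_apply, ContinuousLinearMap.smulRight_apply,
      ContinuousLinearMap.comp_apply, InnerProductSpace.toDual_apply_apply, innerSL_apply_apply,
      hg, hnm, inner_neg_left, inner_smul_left, hnk, conj_trivial, smul_eq_mul,
      Function.comp_apply, Pi.smul_apply']
    match_scalars <;> field_simp
    all_goals ring

end

/-! ### Local form of a superlevel set and the Gauss curvature of its hull -/

section

variable {d : ℕ}

local notation "𝔼" => EuclideanSpace ℝ (Fin d)

/-- Points near `x` inside a level surface, in terms of the shape operator. -/
theorem exists_abs_sub_add_shapeOperator_le {v : 𝔼 → ℝ} {x n : 𝔼} {m μ : ℝ} {A : Set 𝔼}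
    (hA : A ∈ 𝓝 x) (hn : ‖n‖ = 1) (hm : 0 < m) (hv : ContDiffAt ℝ 2 v x)
    (hg : ∇ v x = -(m • n)) (hμ : 0 < μ)
    (hW : ∀ k, μ * ‖k‖ ^ 2 ≤ inner ℝ (shapeOperator v x n m k) k) {κ : ℝ} (hκ : 0 < κ) :
    ∃ δ > 0, ∀ (k : SphereTangent n) (a : ℝ), ‖k‖ < δ → |a| < δ → x + (k + a • n) ∈ A ∧
      |v (x + (k + a • n)) - v x + m * (a + inner ℝ (shapeOperator v x n m k) k / 2)| ≤
        κ * m * (|a| + inner ℝ (shapeOperator v x n m k) k / 2) := by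
  set B := fderiv ℝ (∇ v) x with hB
  have hT := (hasAlexandrovHessianAt_of_contDiffAt hv).2
  rw [Asymptotics.isLittleO_iff] at hT
  -- The Taylor error `ε (|k|² + a²)` is absorbed piecewise: `|k|²` by coercivity of the shape
  -- operator, `a²` by `a² ≤ |a|`.
  set ε : ℝ := min (κ * m * μ / 2) (κ * m / 2) with hε
  have hε0 : 0 < ε := lt_min (by positivity) (by positivity)
  have hAx : ∀ᶠ h in 𝓝 (0 : 𝔼), x + h ∈ A := by
    have : Tendsto (fun h : 𝔼 => x + h) (𝓝 0) (𝓝 x) := by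
      simpa using (continuous_const_add x).tendsto (0 : 𝔼)
    exact this.eventually hA
  obtain ⟨r, hr, H⟩ := Metric.eventually_nhds_iff_ball.1 (hAx.and (hT hε0))
  set δ : ℝ := min (r / 2) (min 1 (κ * m / (6 * (‖B‖ + 1)))) with hδ
  have hδ0 : 0 < δ := lt_min (by positivity) (lt_min one_pos (by positivity))
  refine ⟨δ / 2, by positivity, fun k a hk ha => ?_⟩
  have hδr : δ ≤ r / 2 := min_le_left _ _
  have hδ1 : δ ≤ 1 := (min_le_right _ _).trans (min_le_left _ _)
  have hδB : δ * (6 * (‖B‖ + 1)) ≤ κ * m := by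
    have : δ ≤ κ * m / (6 * (‖B‖ + 1)) := (min_le_right _ _).trans (min_le_right _ _)
    rwa [le_div_iff₀ (by positivity)] at this
  have hkn : ‖(k : 𝔼)‖ = ‖k‖ := rfl
  have hnn : ‖a • n‖ = |a| := by rw [norm_smul, hn, mul_one, Real.norm_eq_abs]
  have hle : ‖(k : 𝔼) + a • n‖ ≤ ‖k‖ + |a| := by rw [← hnn, ← hkn]; exact norm_add_le _ _
  obtain ⟨h1, h2⟩ := H ((k : 𝔼) + a • n) (mem_ball_zero_iff.2 (by linarith))
  refine ⟨h1, ?_⟩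
  have hsq : ‖(k : 𝔼) + a • n‖ ^ 2 = ‖k‖ ^ 2 + a ^ 2 := by
    rw [norm_add_sq_real, hnn, hkn, inner_smul_right, inner_right_orthogonal_singleton, sq_abs]
    ring
  have hlin : inner ℝ (∇ v x) ((k : 𝔼) + a • n) = -(m * a) := by
    rw [hg, inner_neg_left, inner_smul_left, inner_add_right, inner_left_orthogonal_singleton,
      inner_smul_right, real_inner_self_eq_norm_sq, hn]
    simp
  have hquad : inner ℝ (B ((k : 𝔼) + a • n)) ((k : 𝔼) + a • n) =
      -(m * inner ℝ (shapeOperator v x n m k) k) + a * (2 * inner ℝ (B n) (k : 𝔼) +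
        a * inner ℝ (B n) n) := by
    have hs : inner ℝ (B (k : 𝔼)) n = inner ℝ (B n) (k : 𝔼) := by
      rw [real_inner_comm (k : 𝔼)]
      exact isSymmetric_fderiv_gradient hv k n
    rw [inner_shapeOperator m hn, ← hB, map_add, map_smul, inner_add_left, inner_add_right,
      inner_add_right, inner_smul_left, inner_smul_left, inner_smul_right, inner_smul_right, hs]
    simp only [conj_trivial]
    field_simp
    ring
  set ω : ℝ := inner ℝ (shapeOperator v x n m k) k with hω
  rw [hlin, hquad, norm_pow, norm_norm, hsq, Real.norm_eq_abs] at h2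
  have hBn : ‖B n‖ ≤ ‖B‖ := by simpa [hn] using B.le_opNorm n
  have e1 : |inner ℝ (B n) (k : 𝔼)| ≤ ‖B‖ * δ := by
    refine (abs_real_inner_le_norm _ _).trans ?_
    rw [hkn]
    exact mul_le_mul hBn (by linarith) (norm_nonneg _) (norm_nonneg _)
  have e2 : |inner ℝ (B n) n| ≤ ‖B‖ := by
    refine (abs_real_inner_le_norm _ _).trans ?_
    rwa [hn, mul_one]
  -- The Hessian terms involving the normal carry a factor `a`; the cofactor is at most `3 ‖B‖ δ ≤ κ
  -- m / 2`.
  have e3 : |a * (2 * inner ℝ (B n) (k : 𝔼) + a * inner ℝ (B n) n)| ≤ |a| * (κ * m / 2) := by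
    rw [abs_mul]
    refine mul_le_mul_of_nonneg_left ?_ (abs_nonneg a)
    refine (abs_add_le _ _).trans ?_
    rw [abs_mul, abs_mul, abs_two]
    have e4 : |a| * |inner ℝ (B n) n| ≤ δ * ‖B‖ :=
      mul_le_mul (by linarith) e2 (abs_nonneg _) hδ0.le
    nlinarith [norm_nonneg B]
  have hWk := hW k
  have e5 : ε * (‖k‖ ^ 2 + a ^ 2) ≤ κ * m * (ω / 2) + |a| * (κ * m / 2) := by
    have e6 : ε * ‖k‖ ^ 2 ≤ κ * m * μ / 2 * ‖k‖ ^ 2 :=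
      mul_le_mul_of_nonneg_right (min_le_left _ _) (sq_nonneg _)
    have e7 : κ * m * (μ * ‖k‖ ^ 2) ≤ κ * m * ω := mul_le_mul_of_nonneg_left hWk (by positivity)
    have e8 : a ^ 2 ≤ |a| := by
      rw [← sq_abs]; nlinarith [abs_nonneg a]
    have e9 : ε * a ^ 2 ≤ κ * m / 2 * |a| :=
      mul_le_mul (min_le_right _ _) e8 (sq_nonneg _) (by positivity)
    linarith
  rw [abs_le] at h2 e3 ⊢
  constructor <;> linarith [h2.1, h2.2, e3.1, e3.2]

/-- Otherwise `v` would increase to second order along the tangent direction `k`, and points `x + s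
k` of the superlevel set would lie on the supporting hyperplane. -/
theorem inner_shapeOperator_nonneg {v : 𝔼 → ℝ} {x n : 𝔼} {m : ℝ} {A : Set 𝔼}
    (hA : A ∈ 𝓝 x) (hn : ‖n‖ = 1) (hm : 0 < m) (hv : ContDiffAt ℝ 2 v x)
    (hg : ∇ v x = -(m • n))
    (hstrict : ∀ y ∈ A, v x ≤ v y → y ≠ x → inner ℝ n (y - x) < 0) (k : SphereTangent n) :
    0 ≤ inner ℝ (shapeOperator v x n m k) k := by
  by_contra! hneg
  have hk : k ≠ 0 := by rintro rfl; simp at hneg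
  have hkp : 0 < ‖(k : 𝔼)‖ := norm_pos_iff.2 (by simpa using hk)
  rw [inner_shapeOperator m hn] at hneg
  set q : ℝ := inner ℝ (fderiv ℝ (∇ v) x k) (k : 𝔼) with hq
  have hq0 : 0 < q := by
    have : 0 < m⁻¹ * q := by linarith
    exact (mul_pos_iff_of_pos_left (inv_pos.2 hm)).1 this
  have hT := (hasAlexandrovHessianAt_of_contDiffAt hv).2
  rw [Asymptotics.isLittleO_iff] at hT
  have t1 : Tendsto (fun s : ℝ => s • (k : 𝔼)) (𝓝[>] 0) (𝓝 0) := by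
    have : Tendsto (fun s : ℝ => s • (k : 𝔼)) (𝓝 0) (𝓝 ((0 : ℝ) • (k : 𝔼))) :=
      (continuous_id.smul continuous_const).tendsto 0
    rw [zero_smul] at this
    exact this.mono_left nhdsWithin_le_nhds
  have t2 : Tendsto (fun s : ℝ => x + s • (k : 𝔼)) (𝓝[>] 0) (𝓝 x) := by
    simpa using t1.const_add x
  have hc : 0 < q / (4 * ‖(k : 𝔼)‖ ^ 2) := by positivity
  obtain ⟨s, ⟨h1, h2⟩, h3⟩ := (((t1.eventually (hT hc)).and (t2.eventually hA)).and
    self_mem_nhdsWithin).exists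
  have hs : 0 < s := h3
  have hlin : inner ℝ (∇ v x) (s • (k : 𝔼)) = 0 := by
    rw [hg, inner_neg_left, inner_smul_left, inner_smul_right, inner_left_orthogonal_singleton]
    simp
  rw [hlin, map_smul, inner_smul_left, inner_smul_right, ← hq, norm_pow, norm_norm, norm_smul,
    Real.norm_eq_abs, Real.norm_eq_abs, abs_of_pos hs, conj_trivial] at h1
  have h4 : q / (4 * ‖(k : 𝔼)‖ ^ 2) * (s * ‖(k : 𝔼)‖) ^ 2 = s * (s * q) / 4 := by field_simp
  rw [h4, abs_le] at h1
  have h5 : 0 < s * (s * q) := by positivity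
  have h6 := hstrict _ h2 (by linarith [h1.1]) (by
    simp [hs.ne', hk])
  rw [add_sub_cancel_left, inner_smul_right, inner_left_orthogonal_singleton, mul_zero] at h6
  exact lt_irrefl _ h6

/-- If `n' ≠ n`, moving in the direction `n' - n` increases `v` to first order, hence stays in the
superlevel set, yet also increases `⟪n', ·⟫`. -/
theorem IsUnitOuterNormal.eq_of_gradient {v : 𝔼 → ℝ} {x n n' : 𝔼} {m : ℝ} {A : Set 𝔼}
    (h : IsUnitOuterNormal (convexHull ℝ {y | y ∈ A ∧ v x ≤ v y}) x n')
    (hA : A ∈ 𝓝 x) (hn : ‖n‖ = 1) (hm : 0 < m) (hv : DifferentiableAt ℝ v x)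
    (hg : ∇ v x = -(m • n)) : n' = n := by
  obtain ⟨hn', H⟩ := h
  by_contra hne
  have hlt : inner ℝ n n' < 1 := inner_lt_one_iff_real_of_norm_eq_one hn hn' |>.2 (Ne.symm hne)
  set u : 𝔼 := n' - n with hu
  have hd : HasDerivAt (fun s : ℝ => v (x + s • u)) (inner ℝ (∇ v x) u) 0 := by
    have h1 : HasDerivAt (fun s : ℝ => x + s • u) u 0 := by
      simpa using ((hasDerivAt_id (0 : ℝ)).smul_const u).const_add x
    have h2 : HasFDerivAt v (InnerProductSpace.toDual ℝ 𝔼 (∇ v x)) (x + (0 : ℝ) • u) := by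
      simpa using hv.hasGradientAt.hasFDerivAt
    exact h2.comp_hasDerivAt 0 h1
  have hpos : 0 < inner ℝ (∇ v x) u := by
    rw [hg, inner_neg_left, inner_smul_left, hu, inner_sub_right, real_inner_self_eq_norm_sq, hn,
      conj_trivial]
    nlinarith
  have h3 := (hasDerivWithinAt_iff_tendsto_slope' self_notMem_Ioi).1
    (hd.hasDerivWithinAt (s := Ioi 0))
  have t2 : Tendsto (fun s : ℝ => x + s • u) (𝓝[>] 0) (𝓝 x) := by
    have : Tendsto (fun s : ℝ => x + s • u) (𝓝 0) (𝓝 (x + (0 : ℝ) • u)) :=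
      (continuous_const.add (continuous_id.smul continuous_const)).tendsto 0
    rw [zero_smul, add_zero] at this
    exact this.mono_left nhdsWithin_le_nhds
  obtain ⟨s, ⟨h4, h5⟩, h6⟩ := (((h3.eventually (lt_mem_nhds hpos)).and (t2.eventually hA)).and
    self_mem_nhdsWithin).exists
  have hs : 0 < s := h6
  rw [slope_def_field, sub_zero, zero_smul, add_zero] at h4
  have h7 : v x ≤ v (x + s • u) := by
    have := (div_pos_iff_of_pos_right hs).1 h4
    linarith
  have h8 := H _ (subset_convexHull ℝ _ ⟨h5, h7⟩)
  rw [inner_add_right, inner_smul_right, hu, inner_sub_right, real_inner_self_eq_norm_sq, hn',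
    real_inner_comm n n'] at h8
  nlinarith

theorem isUnitOuterNormal_convexHull {x n : 𝔼} {S : Set 𝔼} (hn : ‖n‖ = 1)
    (hmax : ∀ y ∈ S, inner ℝ n (y - x) ≤ 0) : IsUnitOuterNormal (convexHull ℝ S) x n := by
  refine ⟨hn, fun y hy => ?_⟩
  have hconv : Convex ℝ {y : 𝔼 | inner ℝ n y ≤ inner ℝ n x} :=
    convex_halfSpace_le (innerSL ℝ n).isLinear _
  refine convexHull_min (fun z hz => ?_) hconv hy
  have := hmax z hz
  rw [inner_sub_right] at this
  simpa using this

/-- Since `det W ≠ 0`, the nonnegative shape operator is positive definite and the local expansion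
traps the superlevel set between paraboloids. Strict maximality with compactness controls the far
points. The support function then gives `H·Id + D²H = W⁻¹`, of determinant `1 / det W`. -/
theorem superlevelHullCurvature_eq_det_shapeOperator {v : 𝔼 → ℝ} {x n : 𝔼} {m : ℝ} {A : Set 𝔼}
    (hAb : Bornology.IsBounded A) (hA : A ∈ 𝓝 x) (hc : ContinuousOn v (closure A)) (hn : ‖n‖ = 1)
    (hm : 0 < m) (hv : ContDiffAt ℝ 2 v x) (hg : ∇ v x = -(m • n))
    (hstrict : ∀ y ∈ closure A, v x ≤ v y → y ≠ x → inner ℝ n (y - x) < 0)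
    (hdet : (shapeOperator v x n m).det ≠ 0) :
    superlevelHullCurvature A v x = (shapeOperator v x n m).det := by
  set W := shapeOperator v x n m with hWdef
  set S : Set 𝔼 := {y | y ∈ A ∧ v x ≤ v y} with hS
  have hxA : x ∈ A := mem_of_mem_nhds hA
  have hxS : x ∈ S := ⟨hxA, le_rfl⟩
  have hSb : Bornology.IsBounded S := hAb.subset fun y hy => hy.1
  have hstrict' : ∀ y ∈ A, v x ≤ v y → y ≠ x → inner ℝ n (y - x) < 0 := fun y hy =>
    hstrict y (subset_closure hy)
  have hmax : ∀ y ∈ A, v x ≤ v y → inner ℝ n (y - x) ≤ 0 := fun y hy h => by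
    rcases eq_or_ne y x with rfl | hne
    · simp
    · exact (hstrict' y hy h hne).le
  have hWs := isSymmetric_shapeOperator m hn hv
  rw [← hWdef] at hWs
  have hpos := inner_shapeOperator_nonneg hA hn hm hv hg hstrict'
  rw [← hWdef] at hpos
  set e := W.toContinuousLinearEquivOfDetNeZero hdet with he
  have heW : ∀ k, e k = W k := fun k => rfl
  set V : SphereTangent n →L[ℝ] SphereTangent n := (e.symm : SphereTangent n →L[ℝ] SphereTangent n) with hVdef
  have hV : ∀ w, W (V w) = w := fun w => by
    rw [← heW]; exact e.apply_symm_apply w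
  have hV' : ∀ w, V (W w) = w := fun w => by
    rw [← heW]; exact e.symm_apply_apply w
  have hVs : (V : SphereTangent n →ₗ[ℝ] SphereTangent n).IsSymmetric := fun a b => by
    have h1 := hWs (V a) (V b)
    change inner ℝ (W (V a)) (V b) = inner ℝ (V a) (W (V b)) at h1
    rw [hV, hV] at h1
    exact h1.symm
  have hVdet : W.det * V.det = 1 := by
    have h1 : (W : SphereTangent n →ₗ[ℝ] SphereTangent n) * (V : SphereTangent n →ₗ[ℝ] _) = 1 :=
      LinearMap.ext fun w => hV w
    have h2 := congrArg LinearMap.det h1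
    rw [map_mul, map_one] at h2
    exact h2
  obtain ⟨μ, hμ, hcoer⟩ := exists_pos_mul_norm_sq_le_inner hWs hpos fun k hk => by
    rw [← hV' k, hk, map_zero]
  have hlocal := fun {κ : ℝ} (hκ : 0 < κ) =>
    exists_abs_sub_add_shapeOperator_le hA hn hm hv hg hμ hcoer hκ
  have hfar : ∀ δ > 0, ∃ η > 0, ∀ y ∈ S, δ ≤ ‖y - x‖ → inner ℝ n (y - x) ≤ -η := by
    intro δ hδ
    set K : Set 𝔼 := {y ∈ closure A | v x ≤ v y} ∩ {y | δ ≤ ‖y - x‖} with hK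
    have hKc : IsCompact K := by
      refine hAb.isCompact_closure.of_isClosed_subset (IsClosed.inter ?_ ?_) fun y hy => hy.1.1
      · exact isClosed_closure.isClosed_le continuousOn_const hc
      · exact isClosed_le continuous_const (by fun_prop)
    rcases K.eq_empty_or_nonempty with hKe | hKn
    · refine ⟨1, one_pos, fun y hy hyδ => ?_⟩
      have : y ∈ K := ⟨⟨subset_closure hy.1, hy.2⟩, hyδ⟩
      rw [hKe] at this
      exact absurd this (notMem_empty _)
    · obtain ⟨y₀, hy₀, hmaxy⟩ := hKc.exists_isMaxOn hKn (f := fun y => inner ℝ n (y - x))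
        (Continuous.continuousOn (by fun_prop))
      refine ⟨-inner ℝ n (y₀ - x), ?_, fun y hy hyδ => ?_⟩
      · have := hstrict y₀ hy₀.1.1 hy₀.1.2 (by
          rintro rfl
          have h1 : δ ≤ ‖y₀ - y₀‖ := hy₀.2
          rw [sub_self, norm_zero] at h1
          linarith)
        linarith
      · rw [neg_neg]
        exact hmaxy (show y ∈ K from ⟨⟨subset_closure hy.1, hy.2⟩, hyδ⟩)
  have hup : ∀ τ : ℝ, 0 < τ → τ < 1 → ∃ δ > 0, ∀ y ∈ S, ‖y - x‖ < δ → inner ℝ n (y - x) ≤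
      -(τ * (inner ℝ (W (orthogonalPart n (y - x))) (orthogonalPart n (y - x)) / 2)) := by
    intro τ hτ0 hτ1
    -- Solves `τ = (1 - κ)/(1 + κ)`: for `a ≤ 0`, `a + ω ≤ κ (|a| + ω)` becomes `a ≤ -τ ω`. For `a >
    -- 0` it is impossible since `κ < 1`.
    set κ : ℝ := (1 - τ) / (1 + τ) with hκ
    have hκ0 : 0 < κ := div_pos (by linarith) (by linarith)
    obtain ⟨δ, hδ, H⟩ := hlocal hκ0
    refine ⟨δ, hδ, fun y hy hyδ => ?_⟩
    set k := orthogonalPart n (y - x) with hk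
    set a : ℝ := inner ℝ n (y - x) with ha
    have hdecomp : (k : 𝔼) + a • n = y - x := by rw [hk, coe_orthogonalPart hn, ← ha]; abel
    have hkle : ‖k‖ ≤ ‖y - x‖ := Submodule.norm_orthogonalProjectionOnto_apply_le _ _
    have hale : |a| ≤ ‖y - x‖ := by
      simpa [hn] using abs_real_inner_le_norm n (y - x)
    have h1 := (H k a (by linarith) (by linarith)).2
    rw [hdecomp, add_sub_cancel, ← hWdef, abs_le] at h1
    have hω := hpos k
    set ω : ℝ := inner ℝ (W k) k / 2 with hωd
    have hω0 : 0 ≤ ω := by positivity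
    have h2 : v x ≤ v y := hy.2
    have h3 : m * (a + ω) ≤ m * (κ * (|a| + ω)) := by linarith [h1.2]
    have h4 := le_of_mul_le_mul_left h3 hm
    have hκτ : κ * (1 + τ) = 1 - τ := div_mul_cancel₀ _ (by linarith)
    rcases le_or_gt a 0 with ha0 | ha0
    · rw [abs_of_nonpos ha0] at h4
      have h5 : (1 + κ) * (a + τ * ω) ≤ 0 := by nlinarith
      nlinarith
    · rw [abs_of_pos ha0] at h4
      nlinarith
  have hlow : ∀ τ : ℝ, 1 < τ → ∃ δ > 0, ∀ k : SphereTangent n, ‖k‖ < δ →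
      x + (k : 𝔼) - (τ * (inner ℝ (W k) k / 2)) • n ∈ S := by
    intro τ hτ
    -- With this `κ` and `a = -τ ω`, the allowed error `κ m (τ + 1) ω` equals the gain `m (τ - 1)
    -- ω`, so `v` is still at least `v x`.
    set κ : ℝ := (τ - 1) / (τ + 1) with hκ
    have hκ0 : 0 < κ := div_pos (by linarith) (by linarith)
    have hκτ : κ * (τ + 1) = τ - 1 := div_mul_cancel₀ _ (by linarith)
    obtain ⟨δ, hδ, H⟩ := hlocal hκ0
    have hcont : Tendsto (fun k : SphereTangent n => τ * (inner ℝ (W k) k / 2)) (𝓝 0) (𝓝 0) := by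
      have : Continuous fun k : SphereTangent n => τ * (inner ℝ (W k) k / 2) := by fun_prop
      simpa using this.tendsto 0
    obtain ⟨r, hr, Hr⟩ := Metric.eventually_nhds_iff_ball.1 (hcont.eventually (gt_mem_nhds hδ))
    refine ⟨min δ r, lt_min hδ hr, fun k hk => ?_⟩
    have hω := hpos k
    have h0 := Hr k (mem_ball_zero_iff.2 (hk.trans_le (min_le_right _ _)))
    have hω0 : 0 ≤ inner ℝ (W k) k / 2 := by positivity
    have hτω : 0 ≤ τ * (inner ℝ (W k) k / 2) := by positivity
    obtain ⟨h1, h2⟩ := H k (-(τ * (inner ℝ (W k) k / 2))) (hk.trans_le (min_le_left _ _))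
      (by rwa [abs_neg, abs_of_nonneg hτω])
    have heq : x + ((k : 𝔼) + -(τ * (inner ℝ (W k) k / 2)) • n) =
        x + (k : 𝔼) - (τ * (inner ℝ (W k) k / 2)) • n := by module
    rw [heq] at h1 h2
    refine ⟨h1, ?_⟩
    rw [abs_neg, abs_of_nonneg hτω, ← hWdef, abs_le] at h2
    set ω : ℝ := inner ℝ (W k) k / 2 with hωd
    have h3 : κ * m * (τ * ω + ω) = m * ((τ - 1) * ω) := by rw [← hκτ]; ring
    linarith [h2.1]
  obtain ⟨hHn, hA2⟩ := hasSphericalAlexandrovHessianAt_convexSupportFunction hSb hxS hn hWs hVs hV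
    hpos (fun y hy => hmax y hy.1 hy.2) hfar hup hlow
  have hcurv : IsGaussCurvatureAt (convexHull ℝ S) x W.det := by
    refine ⟨n, _, fun n' => ⟨fun h => h.eq_of_gradient hA hn hm
      (hv.differentiableAt (by norm_num)) hg, ?_⟩, hA2, ?_, ?_⟩
    · rintro rfl
      exact isUnitOuterNormal_convexHull hn fun y hy => hmax y hy.1 hy.2
    · rw [add_sub_cancel]
      rintro h0
      rw [h0, mul_zero] at hVdet
      exact zero_ne_one hVdet
    · rw [add_sub_cancel]
      exact eq_one_div_of_mul_eq_one_left hVdet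
  exact hcurv.convexGaussCurvature_eq

end

/-! ### Support functions of superlevel sets -/

section

variable {d : ℕ}

local notation "𝔼" => EuclideanSpace ℝ (Fin d)

theorem volume_eq_zero_of_forall_fst {N : Set (𝔼 × ℝ)} (hN : MeasurableSet N)
    (h : ∀ p, volume {t | (p, t) ∈ N} = 0) : volume N = 0 := by
  rw [Measure.volume_eq_prod, Measure.prod_apply hN]
  simp only [lintegral_eq_zero_iff' (measurable_measure_prodMk_left hN).aemeasurable]
  exact Eventually.of_forall h

theorem volume_eq_zero_of_forall_snd {N : Set (𝔼 × ℝ)} (hN : MeasurableSet N)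
    (h : ∀ t, volume {p | (p, t) ∈ N} = 0) : volume N = 0 := by
  rw [Measure.volume_eq_prod, Measure.prod_apply_symm hN]
  simp only [lintegral_eq_zero_iff' (measurable_measure_prodMk_right hN).aemeasurable]
  exact Eventually.of_forall h

/-- A null subset of `𝔼 × ℝ` which is conic in the first variable meets the graph of the norm in a
null set. -/
theorem volume_setOf_norm_sub_mem_eq_zero {S : Set (𝔼 × ℝ)} (hS : volume S = 0)
    (hcone : ∀ p t, (p, t) ∈ S → ∀ r : ℝ, 0 < r → (r • p, t) ∈ S) (h0 : ∀ t, ((0 : 𝔼), t) ∉ S)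
    (c : ℝ) : volume {p : 𝔼 | (p, ‖p‖ - c) ∈ S} = 0 := by
  set T : Set (𝔼 × ℝ) := toMeasurable volume S with hT
  have hTm : MeasurableSet T := measurableSet_toMeasurable _ _
  have hT0 : volume T = 0 := by rw [hT, measure_toMeasurable, hS]
  have hsec : ∀ᵐ p : 𝔼, volume {t | (p, t) ∈ T} = 0 := by
    rw [Measure.volume_eq_prod] at hT0
    exact Measure.measure_ae_null_of_prod_null hT0
  -- The graph of `‖p‖ - c` is itself null in the product, so it is embedded in the family of graphs
  -- of `s ‖p‖ - c`. Fubini makes almost every slope `s` harmless.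
  set U : Set (𝔼 × ℝ) := {q | q.1 ≠ 0 ∧ (q.1, q.2 * ‖q.1‖ - c) ∈ T} with hU
  have hUm : MeasurableSet U := by
    refine MeasurableSet.inter ?_ ?_
    · exact measurable_fst (measurableSet_singleton (0 : 𝔼)).compl
    · exact (by fun_prop : Measurable fun q : 𝔼 × ℝ => (q.1, q.2 * ‖q.1‖ - c)) hTm
  have hU0 : volume U = 0 := by
    rw [Measure.volume_eq_prod, Measure.prod_apply hUm,
      lintegral_eq_zero_iff' (measurable_measure_prodMk_left hUm).aemeasurable]
    filter_upwards [hsec] with p hp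
    rcases eq_or_ne p 0 with rfl | hp0
    · simp [hU]
    have h1 : Prod.mk p ⁻¹' U ⊆ (fun s : ℝ => s * ‖p‖) ⁻¹' ((fun s : ℝ => s + -c) ⁻¹'
        {t | (p, t) ∈ T}) := fun s hs => by
      have := hs.2
      rwa [sub_eq_add_neg] at this
    refine measure_mono_null h1 ?_
    rw [Real.volume_preimage_mul_right (norm_ne_zero_iff.2 hp0), measure_preimage_add_right, hp,
      mul_zero]
  have hU1 : ∀ᵐ s : ℝ, volume {p | (p, s) ∈ U} = 0 := by
    rw [Measure.volume_eq_prod, Measure.prod_apply_symm hUm,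
      lintegral_eq_zero_iff' (measurable_measure_prodMk_right hUm).aemeasurable] at hU0
    exact hU0
  have hne : (ae (volume.restrict (Ioi (0 : ℝ)))).NeBot := by
    rw [ae_neBot, Ne, Measure.restrict_eq_zero]
    simp
  obtain ⟨s, hs, hs0⟩ := ((ae_restrict_of_ae hU1).and
    (ae_restrict_mem (measurableSet_Ioi (a := (0 : ℝ))))).exists
  have hs0 : 0 < s := hs0
  -- Scaling by `s⁻¹` sends the slope `1` graph to the slope `s` graph without changing the level,
  -- and conicity keeps the point in `S`.
  have hsub : {p : 𝔼 | (p, ‖p‖ - c) ∈ S} ⊆ (fun p : 𝔼 => s⁻¹ • p) ⁻¹' {p | (p, s) ∈ U} := by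
    intro p hp
    have hp0 : p ≠ 0 := by
      rintro rfl
      exact h0 _ hp
    refine ⟨smul_ne_zero (inv_ne_zero hs0.ne') hp0, subset_toMeasurable _ _ ?_⟩
    have h1 := hcone _ _ hp s⁻¹ (inv_pos.2 hs0)
    have h2 : s * ‖s⁻¹ • p‖ = ‖p‖ := by
      rw [norm_smul, Real.norm_of_nonneg (inv_pos.2 hs0).le, mul_inv_cancel_left₀ hs0.ne']
    change (s⁻¹ • p, s * ‖s⁻¹ • p‖ - c) ∈ S
    rwa [h2]
  refine measure_mono_null hsub ?_
  rw [Measure.addHaar_preimage_smul _ (inv_ne_zero hs0.ne'), hs, mul_zero]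

/-- The support function of `{y ∈ K | min t T ≤ v y}`. -/
noncomputable def superlevelSupport (K : Set 𝔼) (v : 𝔼 → ℝ) (T t : ℝ) (p : 𝔼) : ℝ :=
  sSup ((fun y => inner ℝ p y) '' {y | y ∈ K ∧ min t T ≤ v y})

variable {K : Set (EuclideanSpace ℝ (Fin d))} {v : EuclideanSpace ℝ (Fin d) → ℝ} {T : ℝ}

theorem le_superlevelSupport (hK : IsCompact K) {t : ℝ} (p : 𝔼) {y : 𝔼} (hy : y ∈ K)
    (hty : min t T ≤ v y) : inner ℝ p y ≤ superlevelSupport K v T t p := by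
  refine le_csSup ?_ ⟨y, ⟨hy, hty⟩, rfl⟩
  obtain ⟨C, hC⟩ := hK.isBounded.exists_norm_le
  refine ⟨‖p‖ * C, ?_⟩
  rintro _ ⟨z, hz, rfl⟩
  exact (real_inner_le_norm p z).trans (mul_le_mul_of_nonneg_left (hC z hz.1) (norm_nonneg _))

/-- Capping the level at `T`, a value reached or exceeded on `K`, keeps the compact superlevel set
nonempty for every `t`. -/
theorem exists_eq_superlevelSupport (hK : IsCompact K) (hv : ContinuousOn v K)
    (hT : ∃ y ∈ K, T ≤ v y) (t : ℝ) (p : 𝔼) :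
    ∃ y ∈ K, min t T ≤ v y ∧ inner ℝ p y = superlevelSupport K v T t p := by
  obtain ⟨y₁, hy₁, hTy⟩ := hT
  have hc : IsCompact {y | y ∈ K ∧ min t T ≤ v y} :=
    hK.of_isClosed_subset (hK.isClosed.isClosed_le continuousOn_const hv) fun y hy => hy.1
  obtain ⟨y, hy, he⟩ := (hc.image (f := fun y => inner ℝ p y) (by fun_prop)).sSup_mem
    ⟨_, y₁, ⟨hy₁, (min_le_right _ _).trans hTy⟩, rfl⟩
  exact ⟨y, hy.1, hy.2, he⟩

theorem superlevelSupport_sub_le (hK : IsCompact K) (hv : ContinuousOn v K)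
    (hT : ∃ y ∈ K, T ≤ v y) {R : ℝ} (hR : ∀ y ∈ K, ‖y‖ ≤ R) (t : ℝ) (p q : 𝔼) :
    superlevelSupport K v T t p - superlevelSupport K v T t q ≤ R * ‖p - q‖ := by
  obtain ⟨y, hy, hty, he⟩ := exists_eq_superlevelSupport hK hv hT t p
  have h1 := le_superlevelSupport hK q hy hty
  rw [← he]
  have h2 := real_inner_le_norm (p - q) y
  rw [inner_sub_left] at h2
  nlinarith [hR y hy, norm_nonneg (p - q)]

theorem lipschitzWith_superlevelSupport (hK : IsCompact K) (hv : ContinuousOn v K)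
    (hT : ∃ y ∈ K, T ≤ v y) : ∃ C : ℝ≥0, ∀ t, LipschitzWith C (superlevelSupport K v T t) := by
  obtain ⟨R, hR⟩ := hK.isBounded.exists_norm_le
  refine ⟨Real.toNNReal R, fun t => LipschitzWith.of_dist_le' (K := R) fun p q => ?_⟩
  rw [Real.dist_eq, dist_eq_norm, abs_le]
  have h1 := superlevelSupport_sub_le hK hv hT hR t p q
  have h2 := superlevelSupport_sub_le hK hv hT hR t q p
  rw [norm_sub_rev] at h2
  constructor <;> linarith

theorem antitone_superlevelSupport (hK : IsCompact K) (hv : ContinuousOn v K)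
    (hT : ∃ y ∈ K, T ≤ v y) (p : 𝔼) : Antitone fun t => superlevelSupport K v T t p := by
  intro s t hst
  obtain ⟨y, hy, hty, he⟩ := exists_eq_superlevelSupport hK hv hT t p
  simp only
  rw [← he]
  exact le_superlevelSupport hK p hy ((min_le_min_right T hst).trans hty)

/-- The supremum is attained, so each set `{H ≥ a}` is the projection of a closed set along the
compact `K`, hence closed. -/
theorem measurable_superlevelSupport (hK : IsCompact K) (hv : ContinuousOn v K)
    (hT : ∃ y ∈ K, T ≤ v y) :
    Measurable fun q : 𝔼 × ℝ => superlevelSupport K v T q.2 q.1 := by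
  refine measurable_of_Ici fun a => IsClosed.measurableSet ?_
  have : CompactSpace K := isCompact_iff_compactSpace.1 hK
  have hv' : Continuous fun y : K => v y := continuousOn_iff_continuous_domRestrict.1 hv
  set C : Set (K × (𝔼 × ℝ)) := {q | min q.2.2 T ≤ v q.1 ∧ a ≤ inner ℝ q.2.1 (q.1 : 𝔼)} with hC
  have hCc : IsClosed C := by
    refine IsClosed.inter 
      (isClosed_le (f := fun q : K × (𝔼 × ℝ) => min q.2.2 T) (g := fun q => v q.1) (by fun_prop)
        (hv'.comp continuous_fst))
      (isClosed_le (f := fun _ => a) (g := fun q : K × (𝔼 × ℝ) => inner ℝ q.2.1 (q.1 : 𝔼))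
        (by fun_prop) (by fun_prop))
  have heq : (fun q : 𝔼 × ℝ => superlevelSupport K v T q.2 q.1) ⁻¹' Ici a = Prod.snd '' C := by
    ext ⟨p, t⟩
    constructor
    · intro h
      obtain ⟨y, hy, hty, he⟩ := exists_eq_superlevelSupport hK hv hT t p
      refine ⟨(⟨y, hy⟩, (p, t)), ⟨hty, ?_⟩, rfl⟩
      rw [he]
      exact h
    · rintro ⟨⟨y, q⟩, ⟨h1, h2⟩, rfl⟩
      exact h2.trans (le_superlevelSupport hK p y.2 h1)
  rw [heq]
  exact isClosedMap_snd_of_compactSpace _ hCc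

/-- For almost every `(p, t)` the linear function `⟪p, ·⟫` has only one maximum point on the
superlevel set. -/
theorem volume_setOf_not_unique_maximizer (hK : IsCompact K) (hv : ContinuousOn v K)
    (hT : ∃ y ∈ K, T ≤ v y) :
    volume {q : 𝔼 × ℝ | ∃ y ∈ K, ∃ z ∈ K, y ≠ z ∧ min q.2 T ≤ v y ∧ min q.2 T ≤ v z ∧
      inner ℝ q.1 y = superlevelSupport K v T q.2 q.1 ∧
      inner ℝ q.1 z = superlevelSupport K v T q.2 q.1} = 0 := by
  set e : Fin d → 𝔼 := fun i => EuclideanSpace.single i (1 : ℝ) with he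
  set H := superlevelSupport K v T with hH
  have hHm : Measurable fun q : 𝔼 × ℝ => H q.2 q.1 := measurable_superlevelSupport hK hv hT
  set D : Fin d → ℕ → 𝔼 × ℝ → ℝ := fun i k q =>
    H q.2 (q.1 + ((k : ℝ) + 1)⁻¹ • e i) + H q.2 (q.1 - ((k : ℝ) + 1)⁻¹ • e i) - 2 * H q.2 q.1
    with hD
  have hDm : ∀ i k, Measurable (D i k) := fun i k => by
    have h1 : Measurable fun q : 𝔼 × ℝ => (q.1 + ((k : ℝ) + 1)⁻¹ • e i, q.2) := by fun_prop
    have h2 : Measurable fun q : 𝔼 × ℝ => (q.1 - ((k : ℝ) + 1)⁻¹ • e i, q.2) := by fun_prop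
    exact ((hHm.comp h1).add (hHm.comp h2)).sub (hHm.const_mul 2)
  -- Two maximizers differing in the coordinate `i` make the symmetric second difference of `H` in
  -- that direction at least linear in the step, a measurable trace of a corner.
  set N : Set (𝔼 × ℝ) := ⋃ i : Fin d, ⋃ M : ℕ, ⋂ k : ℕ,
    {q | ((k : ℝ) + 1)⁻¹ * ((M : ℝ) + 1)⁻¹ ≤ D i k q} with hN
  have hNm : MeasurableSet N := MeasurableSet.iUnion fun i => MeasurableSet.iUnion fun M =>
    MeasurableSet.iInter fun k => measurableSet_le measurable_const (hDm i k)
  refine measure_mono_null (t := N) ?_ (volume_eq_zero_of_forall_snd hNm fun t => ?_)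
  · have key : ∀ (p : 𝔼) (t : ℝ), ∀ y ∈ K, ∀ z ∈ K, ∀ i, z i < y i → min t T ≤ v y →
        min t T ≤ v z → inner ℝ p y = H t p → inner ℝ p z = H t p → (p, t) ∈ N := by
      intro p t y hy z hz i hi hty htz hey hez
      obtain ⟨M, hM⟩ := exists_nat_one_div_lt (sub_pos.2 hi)
      simp only [hN, mem_iUnion, mem_iInter]
      refine ⟨i, M, fun k => ?_⟩
      set s : ℝ := ((k : ℝ) + 1)⁻¹ with hs
      have hs0 : 0 < s := by positivity
      have h1 := le_superlevelSupport hK (p + s • e i) hy hty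
      have h2 := le_superlevelSupport hK (p - s • e i) hz htz
      rw [inner_add_left, inner_smul_left, hey, inner_single_one_left] at h1
      rw [inner_sub_left, inner_smul_left, hez, inner_single_one_left] at h2
      simp only [conj_trivial] at h1 h2
      change s * ((M : ℝ) + 1)⁻¹ ≤ H t (p + s • e i) + H t (p - s • e i) - 2 * H t p
      rw [one_div] at hM
      have h3 := mul_le_mul_of_nonneg_left hM.le hs0.le
      linarith
    rintro ⟨p, t⟩ ⟨y, hy, z, hz, hne, hty, htz, hey, hez⟩
    obtain ⟨i, hi⟩ : ∃ i, y i ≠ z i := by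
      by_contra! h
      exact hne (by ext i; exact h i)
    rcases lt_or_gt_of_ne hi with h | h
    · exact key p t z hz y hy i h htz hty hez hey
    · exact key p t y hy z hz i h hty htz hey hez
  -- For fixed `t`, Rademacher's theorem gives differentiability in `p` almost everywhere, which
  -- makes the second difference sublinear.
  · obtain ⟨C, hC⟩ := lipschitzWith_superlevelSupport hK hv hT
    have hae := (hC t).ae_differentiableAt (μ := volume)
    refine measure_mono_null (fun p hp => ?_) hae
    intro hdiff
    simp only [hN, mem_iUnion, mem_iInter, mem_ofPred_eq] at hp
    obtain ⟨i, M, hp⟩ := hp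
    have hlo := hasFDerivAt_iff_isLittleO_nhds_zero.1 hdiff.hasFDerivAt
    rw [Asymptotics.isLittleO_iff] at hlo
    have hseq : Tendsto (fun k : ℕ => ((k : ℝ) + 1)⁻¹ • e i) atTop (𝓝 0) := by
      have h1 : Tendsto (fun k : ℕ => ((k : ℝ) + 1)⁻¹) atTop (𝓝 0) := by
        simpa using tendsto_one_div_add_atTop_nhds_zero_nat (𝕜 := ℝ)
      simpa using h1.smul_const (e i)
    have hseq' : Tendsto (fun k : ℕ => -(((k : ℝ) + 1)⁻¹ • e i)) atTop (𝓝 0) := by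
      simpa using hseq.neg
    have hc : (0 : ℝ) < ((M : ℝ) + 1)⁻¹ / 4 := by positivity
    obtain ⟨k, h1, h2⟩ := ((hseq.eventually (hlo hc)).and (hseq'.eventually (hlo hc))).exists
    have h3 := hp k
    set s : ℝ := ((k : ℝ) + 1)⁻¹ with hs
    have hs0 : 0 < s := by positivity
    have hne : ‖s • e i‖ = s := by simp [he, norm_smul, abs_of_pos hs0]
    rw [norm_neg, hne, map_neg, Real.norm_eq_abs, abs_le, ← sub_eq_add_neg] at h2
    rw [hne, Real.norm_eq_abs, abs_le] at h1
    have h4 : s * ((M : ℝ) + 1)⁻¹ ≤ H t (p + s • e i) + H t (p - s • e i) - 2 * H t p := h3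
    have h5 : 0 < s * ((M : ℝ) + 1)⁻¹ := by positivity
    linarith [h1.2, h2.2]

/-- For almost every `(p, t)` no maximum point of `⟪p, ·⟫` on the superlevel set is critical. -/
theorem volume_setOf_critical_maximizer (hK : IsCompact K) (hv : ContinuousOn v K)
    (hT : ∃ y ∈ K, T ≤ v y) :
    volume {q : 𝔼 × ℝ | q.1 ≠ 0 ∧ q.2 ≤ T ∧ ∃ x, K ∈ 𝓝 x ∧ q.2 ≤ v x ∧ ContDiffAt ℝ 2 v x ∧
      ∇ v x = 0 ∧ inner ℝ q.1 x = superlevelSupport K v T q.2 q.1} = 0 := by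
  set H := superlevelSupport K v T with hH
  have hHm : Measurable fun q : 𝔼 × ℝ => H q.2 q.1 := measurable_superlevelSupport hK hv hT
  set D : ℕ → 𝔼 × ℝ → ℝ := fun k q => H (q.2 - ((k : ℝ) + 1)⁻¹) q.1 - H q.2 q.1 with hD
  have hDm : ∀ k, Measurable (D k) := fun k => by
    have h1 : Measurable fun q : 𝔼 × ℝ => (q.1, q.2 - ((k : ℝ) + 1)⁻¹) := by fun_prop
    exact (hHm.comp h1).sub hHm
  -- The pairs at which the backward difference quotients of `H` in `t`, over the steps `1/(k + 1)`,
  -- are unbounded.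
  set N : Set (𝔼 × ℝ) := ⋂ M : ℕ, ⋂ k₀ : ℕ, ⋃ k : ℕ, ⋃ _ : k₀ ≤ k,
    {q | (M : ℝ) * ((k : ℝ) + 1)⁻¹ ≤ D k q} with hN
  have hNm : MeasurableSet N := MeasurableSet.iInter fun M => MeasurableSet.iInter fun k₀ =>
    MeasurableSet.iUnion fun k => MeasurableSet.iUnion fun _ =>
      measurableSet_le measurable_const (hDm k)
  have hseq : Tendsto (fun k : ℕ => ((k : ℝ) + 1)⁻¹) atTop (𝓝 0) := by
    simpa using tendsto_one_div_add_atTop_nhds_zero_nat (𝕜 := ℝ)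
  refine measure_mono_null (t := N) ?_ (volume_eq_zero_of_forall_fst hNm fun p => ?_)
  · rintro ⟨p, t⟩ ⟨hp0, htT, x, hKx, htx, hvx, hgx, hex⟩
    simp only at hp0 htT htx hex
    simp only [hN, mem_iUnion, mem_iInter, exists_prop]
    intro M k₀
    have hpp : 0 < ‖p‖ := norm_pos_iff.2 hp0
    have hTay := (hasAlexandrovHessianAt_of_contDiffAt hvx).2
    rw [Asymptotics.isLittleO_iff] at hTay
    set B := fderiv ℝ (∇ v) x with hB
    -- At a critical point `v (x + s p) ≥ v x - C s²` for small `s`. Lowering the level by `ε = C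
    -- s²` thus gains `s |p|²`, of order `√ε`, which exceeds every multiple of `ε`.
    set C : ℝ := (‖B‖ / 2 + 1) * ‖p‖ ^ 2 with hC
    have hC0 : 0 < C := by positivity
    have hsq : Tendsto (fun k : ℕ => Real.sqrt (((k : ℝ) + 1)⁻¹ / C)) atTop (𝓝 0) := by
      have := (hseq.div_const C).sqrt
      simpa using this
    have hsp : Tendsto (fun k : ℕ => Real.sqrt (((k : ℝ) + 1)⁻¹ / C) • p) atTop (𝓝 0) := by
      simpa using hsq.smul_const p
    have hxp : Tendsto (fun k : ℕ => x + Real.sqrt (((k : ℝ) + 1)⁻¹ / C) • p) atTop (𝓝 x) := by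
      simpa using hsp.const_add x
    have hsM : Tendsto (fun k : ℕ => (M : ℝ) * C * Real.sqrt (((k : ℝ) + 1)⁻¹ / C)) atTop (𝓝 0) := by
      simpa using hsq.const_mul ((M : ℝ) * C)
    obtain ⟨k, ⟨⟨h1, h2⟩, h3⟩, h4⟩ := (((((hsp.eventually (hTay one_pos)).and
      (hxp.eventually hKx)).and (hsM.eventually (gt_mem_nhds (by positivity : 0 < ‖p‖ ^ 2)))).and
      (eventually_ge_atTop k₀))).exists
    refine ⟨k, h4, ?_⟩
    set ε : ℝ := ((k : ℝ) + 1)⁻¹ with hε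
    have hε0 : 0 < ε := by positivity
    set s : ℝ := Real.sqrt (ε / C) with hs
    have hs0 : 0 < s := Real.sqrt_pos.2 (by positivity)
    have hs2 : C * s ^ 2 = ε := by rw [hs, Real.sq_sqrt (by positivity)]; field_simp
    have hBq : |inner ℝ (B (s • p)) (s • p)| ≤ ‖B‖ * (s ^ 2 * ‖p‖ ^ 2) := by
      refine (abs_real_inner_le_norm _ _).trans ?_
      have h5 := B.le_opNorm (s • p)
      have h6 : ‖s • p‖ = s * ‖p‖ := by rw [norm_smul, Real.norm_of_nonneg hs0.le]
      rw [h6] at h5 ⊢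
      have : 0 ≤ s * ‖p‖ := by positivity
      nlinarith
    rw [hgx, inner_zero_left, norm_pow, norm_norm, norm_smul, Real.norm_of_nonneg hs0.le,
      Real.norm_eq_abs, abs_le] at h1
    rw [abs_le] at hBq
    have hval : t - ε ≤ v (x + s • p) := by
      have h5 : C * s ^ 2 = ‖B‖ * (s ^ 2 * ‖p‖ ^ 2) / 2 + (s * ‖p‖) ^ 2 := by rw [hC]; ring
      linarith [h1.1, hBq.1]
    have h6 := le_superlevelSupport (T := T) hK p h2 ((min_le_left (t - ε) T).trans hval)
    rw [inner_add_right, hex, inner_smul_right, real_inner_self_eq_norm_sq] at h6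
    change (M : ℝ) * ε ≤ H (t - ε) p - H t p
    have h7 : (M : ℝ) * ε = s * (M * C * s) := by rw [← hs2]; ring
    have h8 := mul_le_mul_of_nonneg_left h3.le hs0.le
    linarith
  -- For fixed `p` the support function is monotone in the level, hence differentiable at almost
  -- every `t`, so the quotients are bounded there.
  · have hae : ∀ᵐ t, DifferentiableAt ℝ (fun t => superlevelSupport K v T t p) t := by
      filter_upwards [(antitone_superlevelSupport hK hv hT p).neg.ae_differentiableAt] with t ht
      refine ht.neg.congr_of_eventuallyEq (Eventually.of_forall fun s => ?_)
      simp
    refine measure_mono_null (fun t ht => ?_) hae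
    intro hdiff
    simp only [hN, mem_iUnion, mem_iInter, mem_ofPred_eq, exists_prop] at ht
    have hlo := hasFDerivAt_iff_isLittleO_nhds_zero.1 hdiff.hasDerivAt.hasFDerivAt
    rw [Asymptotics.isLittleO_iff] at hlo
    set F' := deriv (fun t => superlevelSupport K v T t p) t with hF'
    obtain ⟨M, hM⟩ := exists_nat_gt (|F'| + 1)
    have hseq' : Tendsto (fun k : ℕ => -((k : ℝ) + 1)⁻¹) atTop (𝓝 0) := by simpa using hseq.neg
    obtain ⟨k₀, hk₀⟩ := eventually_atTop.1 (hseq'.eventually (hlo one_pos))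
    obtain ⟨k, hk, h1⟩ := ht M k₀
    have h2 := hk₀ k hk
    set ε : ℝ := ((k : ℝ) + 1)⁻¹ with hε
    have hε0 : 0 < ε := by positivity
    rw [norm_neg, Real.norm_of_nonneg hε0.le, ← sub_eq_add_neg, Real.norm_eq_abs, abs_le] at h2
    simp only [ContinuousLinearMap.toSpanSingleton_apply, smul_eq_mul] at h2
    have h3 : (M : ℝ) * ε ≤ H (t - ε) p - H t p := h1
    have h4 := mul_lt_mul_of_pos_right hM hε0
    have h5 := mul_le_mul_of_nonneg_right (neg_abs_le F') hε0.le
    linarith [h2.2]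

end

/-! ### The maximum principle for the Gauss curvature of level sets -/

section

variable {d : ℕ}

local notation "𝔼" => EuclideanSpace ℝ (Fin d)

variable {A : Set (EuclideanSpace ℝ (Fin d))} {v : EuclideanSpace ℝ (Fin d) → ℝ} {t₀ : ℝ}

/-- The noncritical points of `{t₀ < v}` which are the only maximum point on `{v x ≤ v}` of the
linear function with gradient `-∇ v x`. -/
def strictContactSet (A : Set 𝔼) (v : 𝔼 → ℝ) (t₀ : ℝ) : Set 𝔼 :=
  {x | (x ∈ interior A ∧ t₀ < v x ∧ ∇ v x ≠ 0) ∧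
    ∀ y ∈ closure A, v x ≤ v y → y ≠ x → 0 < inner ℝ (∇ v x) (y - x)}

/-- Strictness fails at `x` exactly when a violating `y` exists at distance at least `1/(j + 1)` for
some `j`. For each `j` such `x` form the projection of a closed set along the compact `closure A`,
closed relative to the open set `U`. -/
theorem measurableSet_strictContactSet (hb : Bornology.IsBounded A)
    (hc : ContinuousOn v (closure A)) (hv : ContDiffOn ℝ 2 v (interior A)) :
    MeasurableSet (strictContactSet A v t₀) := by
  have hvc : ContinuousOn v (interior A) := hv.continuousOn
  have hgc : ContinuousOn (∇ v) (interior A) := fun x hx =>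
    (contDiffAt_gradient (contDiffAt_of_mem_interior hv hx)).continuousAt.continuousWithinAt
  set U : Set 𝔼 := {x | x ∈ interior A ∧ t₀ < v x ∧ ∇ v x ≠ 0} with hU_def
  have hUA : U ⊆ interior A := fun x hx => hx.1
  have hU : IsOpen U := by
    have h1 := hvc.isOpen_inter_preimage isOpen_interior (isOpen_Ioi (a := t₀))
    have h2 := hgc.isOpen_inter_preimage isOpen_interior (isOpen_compl_singleton (x := (0 : 𝔼)))
    convert h1.inter h2 using 1
    ext x
    constructor
    · rintro ⟨h1, h2, h3⟩
      exact ⟨⟨h1, h2⟩, h1, h3⟩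
    · rintro ⟨⟨h1, h2⟩, -, h3⟩
      exact ⟨h1, h2, h3⟩
  have : CompactSpace (closure A) := isCompact_iff_compactSpace.1 hb.isCompact_closure
  have hc' : Continuous fun y : closure A => v y := continuousOn_iff_continuous_domRestrict.1 hc
  have hvU : Continuous fun x : U => v x :=
    continuousOn_iff_continuous_domRestrict.1 (hvc.mono hUA)
  have hgU : Continuous fun x : U => ∇ v x :=
    continuousOn_iff_continuous_domRestrict.1 (hgc.mono hUA)
  set C : ℕ → Set (closure A × U) := fun j => {q | ((j : ℝ) + 1)⁻¹ ≤ ‖(q.1 : 𝔼) - q.2‖ ∧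
    v q.2 ≤ v q.1 ∧ inner ℝ (∇ v q.2) ((q.1 : 𝔼) - q.2) ≤ 0} with hC
  have hCc : ∀ j, IsClosed (C j) := fun j => by
    refine IsClosed.inter (isClosed_le (f := fun _ => ((j : ℝ) + 1)⁻¹)
      (g := fun q : closure A × U => ‖(q.1 : 𝔼) - q.2‖) continuous_const ?_) (IsClosed.inter
      (isClosed_le (f := fun q : closure A × U => v q.2) (g := fun q => v q.1)
        (hvU.comp continuous_snd) (hc'.comp continuous_fst))
      (isClosed_le (f := fun q : closure A × U => inner ℝ (∇ v (q.2 : 𝔼)) ((q.1 : 𝔼) - q.2))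
        (g := fun _ => 0) ?_ continuous_const))
    · exact ((continuous_subtype_val.comp continuous_fst).sub
        (continuous_subtype_val.comp continuous_snd)).norm
    · exact (hgU.comp continuous_snd).inner ((continuous_subtype_val.comp continuous_fst).sub
        (continuous_subtype_val.comp continuous_snd))
  have hP : ∀ j, MeasurableSet (Subtype.val '' (Prod.snd '' C j) : Set 𝔼) := fun j =>
    hU.measurableSet.subtype_image (isClosedMap_snd_of_compactSpace _ (hCc j)).measurableSet
  have heq : strictContactSet A v t₀ = U \ ⋃ j, Subtype.val '' (Prod.snd '' C j) := by
    ext x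
    constructor
    · rintro ⟨hxU, H⟩
      refine ⟨hxU, fun hx => ?_⟩
      obtain ⟨j, hj⟩ := mem_iUnion.1 hx
      obtain ⟨_, ⟨⟨y, z⟩, ⟨h1, h2, h3⟩, rfl⟩, rfl⟩ := hj
      have hne : (y : 𝔼) ≠ z := by
        intro he
        have h1' : ((j : ℝ) + 1)⁻¹ ≤ ‖(y : 𝔼) - z‖ := h1
        rw [he, sub_self, norm_zero] at h1'
        have : (0 : ℝ) < ((j : ℝ) + 1)⁻¹ := by positivity
        linarith
      exact (H y y.2 h2 hne).not_ge h3
    · rintro ⟨hxU, hx⟩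
      refine ⟨hxU, fun y hy hxy hne => ?_⟩
      by_contra! h
      obtain ⟨j, hj⟩ := exists_nat_one_div_lt (norm_pos_iff.2 (sub_ne_zero.2 hne))
      rw [one_div] at hj
      exact hx (mem_iUnion.2 ⟨j, ⟨x, hxU⟩, ⟨(⟨y, hy⟩, ⟨x, hxU⟩), ⟨hj.le, hxy, h⟩, rfl⟩, rfl⟩)
  rw [heq]
  exact hU.measurableSet.diff (MeasurableSet.iUnion hP)

theorem inner_neg_gradient_neg {x : 𝔼} (hx : x ∈ strictContactSet A v t₀) {y : 𝔼}
    (hy : y ∈ closure A) (hxy : v x ≤ v y) (hne : y ≠ x) :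
    inner ℝ (-(‖∇ v x‖⁻¹ • ∇ v x)) (y - x) < 0 := by
  have h1 := hx.2 y hy hxy hne
  have h2 : 0 < ‖∇ v x‖⁻¹ := inv_pos.2 (norm_pos_iff.2 hx.1.2.2)
  rw [inner_neg_left, inner_smul_left, conj_trivial]
  have := mul_pos h2 h1
  linarith

theorem norm_neg_inv_smul_self {g : 𝔼} (hg : g ≠ 0) : ‖-(‖g‖⁻¹ • g)‖ = 1 := by
  rw [norm_neg, norm_smul, norm_inv, norm_norm, inv_mul_cancel₀ (norm_ne_zero_iff.2 hg)]

theorem eq_neg_norm_smul_neg_inv_smul {g : 𝔼} (hg : g ≠ 0) : g = -(‖g‖ • -(‖g‖⁻¹ • g)) := by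
  rw [smul_neg, neg_neg, smul_smul, mul_inv_cancel₀ (norm_ne_zero_iff.2 hg), one_smul]

/-- A point with a unit outer normal cannot be interior to the hull, since it could be moved along
the normal. -/
theorem strictContactSet_subset : strictContactSet A v t₀ ⊆ levelContactSet A (fun y => -v y) := by
  intro x hx
  set n : 𝔼 := -(‖∇ v x‖⁻¹ • ∇ v x) with hn_def
  have hn : ‖n‖ = 1 := norm_neg_inv_smul_self hx.1.2.2
  have hxA : x ∈ A := interior_subset hx.1.1
  have hxS : x ∈ sublevelSet A (fun y => -v y) (-v x) := ⟨hxA, le_rfl⟩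
  refine ⟨hx.1.1, -v x, hxS, subset_closure (subset_convexHull ℝ _ hxS), fun hint => ?_⟩
  have hnormal : IsUnitOuterNormal (convexHull ℝ (sublevelSet A (fun y => -v y) (-v x))) x n := by
    refine isUnitOuterNormal_convexHull hn fun y hy => ?_
    rcases eq_or_ne y x with rfl | hne
    · simp
    · exact (inner_neg_gradient_neg hx (subset_closure hy.1) (neg_le_neg_iff.1 hy.2) hne).le
  have hc : Tendsto (fun s : ℝ => x + s • n) (𝓝[>] 0) (𝓝 x) := by
    have : Tendsto (fun s : ℝ => x + s • n) (𝓝 0) (𝓝 (x + (0 : ℝ) • n)) :=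
      (continuous_const.add (continuous_id.smul continuous_const)).tendsto 0
    rw [zero_smul, add_zero] at this
    exact this.mono_left nhdsWithin_le_nhds
  obtain ⟨s, h1, h2⟩ := ((hc.eventually (mem_interior_iff_mem_nhds.1 hint)).and
    self_mem_nhdsWithin).exists
  have hs : 0 < s := h2
  have h3 := hnormal.2 _ h1
  rw [inner_add_right, inner_smul_right, real_inner_self_eq_norm_sq, hn] at h3
  linarith

/-- The Jacobian bound behind the maximum principle. -/
theorem volume_image_levelNormalMap_le (hb : Bornology.IsBounded A)
    (hc : ContinuousOn v (closure A)) (hv : ContDiffOn ℝ 2 v (interior A)) {c R : ℝ}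
    (hR : ∀ x ∈ strictContactSet A v t₀, |v x + c| ≤ R) :
    volume (levelNormalMap v c '' strictContactSet A v t₀) ≤ ENNReal.ofReal (R ^ (d - 1)) *
      ∫⁻ x in levelContactSet A (fun y => -v y),
        ENNReal.ofReal (‖∇ v x‖ * superlevelHullCurvature A v x) := by
  have hm := measurableSet_strictContactSet (t₀ := t₀) hb hc hv
  have hex : ∀ x : 𝔼, ∃ L : 𝔼 →L[ℝ] 𝔼, x ∈ strictContactSet A v t₀ →
      HasFDerivAt (levelNormalMap v c) L x ∧ ENNReal.ofReal |L.det| ≤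
        ENNReal.ofReal (R ^ (d - 1)) *
          ENNReal.ofReal (‖∇ v x‖ * superlevelHullCurvature A v x) := by
    intro x
    by_cases hx : x ∈ strictContactSet A v t₀
    swap
    · exact ⟨0, fun h => absurd h hx⟩
    have hg0 := hx.1.2.2
    have hvx := contDiffAt_of_mem_interior hv hx.1.1
    have hAx : A ∈ 𝓝 x := mem_interior_iff_mem_nhds.1 hx.1.1
    have hn := norm_neg_inv_smul_self hg0
    have hg := eq_neg_norm_smul_neg_inv_smul hg0
    have hm0 : 0 < ‖∇ v x‖ := norm_pos_iff.2 hg0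
    obtain ⟨L, hL, hLdet⟩ := exists_hasFDerivAt_levelNormalMap c hn hm0 hvx hg
    refine ⟨L, fun _ => ⟨hL, ?_⟩⟩
    set W := shapeOperator v x (-(‖∇ v x‖⁻¹ • ∇ v x)) ‖∇ v x‖ with hW
    -- If `det W = 0` the Jacobian vanishes and nothing about `K` is needed.
    rcases eq_or_ne W.det 0 with h0 | h0
    · rw [hLdet, h0]
      simp
    · rw [superlevelHullCurvature_eq_det_shapeOperator hb hAx hc hn hm0 hvx hg
        (fun y hy hxy hne => inner_neg_gradient_neg hx hy hxy hne) h0, ← hW]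
      have hdet0 : 0 ≤ W.det := by
        have hpos : (W : SphereTangent (-(‖∇ v x‖⁻¹ • ∇ v x)) →ₗ[ℝ]
            SphereTangent (-(‖∇ v x‖⁻¹ • ∇ v x))).IsPositive := by
          refine ⟨isSymmetric_shapeOperator _ hn hvx, fun k => ?_⟩
          exact inner_shapeOperator_nonneg hAx hn hm0 hvx hg
            (fun y hy hxy hne => inner_neg_gradient_neg hx (subset_closure hy) hxy hne) k
        have h := ((LinearMap.posSemidef_toMatrix_iff
          (stdOrthonormalBasis ℝ (SphereTangent (-(‖∇ v x‖⁻¹ • ∇ v x))))).2 hpos).det_nonneg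
        rwa [LinearMap.det_toMatrix] at h
      have hR0 : 0 ≤ R := (abs_nonneg _).trans (hR x hx)
      rw [← ENNReal.ofReal_mul (pow_nonneg hR0 _)]
      refine ENNReal.ofReal_le_ofReal ?_
      rw [hLdet, abs_mul, abs_neg, abs_norm, abs_mul, abs_pow, abs_of_nonneg hdet0]
      have h1 : |v x + c| ^ (d - 1) ≤ R ^ (d - 1) := pow_le_pow_left₀ (abs_nonneg _) (hR x hx) _
      calc ‖∇ v x‖ * (|v x + c| ^ (d - 1) * W.det) ≤ ‖∇ v x‖ * (R ^ (d - 1) * W.det) := by gcongr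
        _ = _ := by ring
  choose L hL using hex
  calc volume (levelNormalMap v c '' strictContactSet A v t₀)
      ≤ ∫⁻ x in strictContactSet A v t₀, ENNReal.ofReal |(L x).det| :=
        addHaar_image_le_lintegral_abs_det_fderiv volume hm
          fun x hx => (hL x hx).1.hasFDerivWithinAt
    _ ≤ ∫⁻ x in strictContactSet A v t₀, ENNReal.ofReal (R ^ (d - 1)) *
          ENNReal.ofReal (‖∇ v x‖ * superlevelHullCurvature A v x) :=
        setLIntegral_mono' hm fun x hx => (hL x hx).2
    _ ≤ ∫⁻ x in levelContactSet A (fun y => -v y), ENNReal.ofReal (R ^ (d - 1)) *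
          ENNReal.ofReal (‖∇ v x‖ * superlevelHullCurvature A v x) :=
        lintegral_mono_set strictContactSet_subset
    _ = _ := lintegral_const_mul' _ _ ENNReal.ofReal_ne_top

/-- A maximizer of `⟪p, ·⟫` over `{v ≥ ‖p‖ - c}` that is unique and not critical is a strict contact
point mapped to `p`. The remaining `p` lie in the null slices `hN₁` and `hN₂`, where the positive
homogeneity of the support function supplies the required conicity. -/
theorem volume_le_volume_image_levelNormalMap [NeZero d] (hb : Bornology.IsBounded A)
    (hc : ContinuousOn v (closure A)) (hv : ContDiffOn ℝ 2 v (interior A)) {t₁ c : ℝ}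
    (hfr : ∀ y ∈ frontier A, v y ≤ t₀) (ht₁ : ∃ y ∈ closure A, t₁ ≤ v y) {B : Set 𝔼}
    (hB : ∀ p ∈ B, p ≠ 0 ∧ t₀ < ‖p‖ - c ∧ ‖p‖ - c ≤ t₁) :
    volume B ≤ volume (levelNormalMap v c '' strictContactSet A v t₀) := by
  have hK : IsCompact (closure A) := hb.isCompact_closure
  set H := superlevelSupport (closure A) v t₁ with hH
  set S₁ : Set (𝔼 × ℝ) := {q | q.1 ≠ 0 ∧ ∃ y ∈ closure A, ∃ z ∈ closure A, y ≠ z ∧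
    min q.2 t₁ ≤ v y ∧ min q.2 t₁ ≤ v z ∧ inner ℝ q.1 y = H q.2 q.1 ∧
    inner ℝ q.1 z = H q.2 q.1} with hS₁
  set S₂ : Set (𝔼 × ℝ) := {q | q.1 ≠ 0 ∧ q.2 ≤ t₁ ∧ ∃ x, closure A ∈ 𝓝 x ∧ q.2 ≤ v x ∧
    ContDiffAt ℝ 2 v x ∧ ∇ v x = 0 ∧ inner ℝ q.1 x = H q.2 q.1} with hS₂
  have hS₁0 : volume S₁ = 0 :=
    measure_mono_null (fun q hq => hq.2) (volume_setOf_not_unique_maximizer hK hc ht₁)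
  have hS₂0 : volume S₂ = 0 := volume_setOf_critical_maximizer hK hc ht₁
  have hHsmul : ∀ t p (r : ℝ), 0 < r → H t (r • p) = r * H t p := by
    intro t p r hr
    obtain ⟨y, hy, hty, he⟩ := exists_eq_superlevelSupport hK hc ht₁ t p
    obtain ⟨z, hz, htz, hez⟩ := exists_eq_superlevelSupport hK hc ht₁ t (r • p)
    have h1 := le_superlevelSupport hK p hz htz
    have h2 := le_superlevelSupport hK (r • p) hy hty
    rw [inner_smul_left, conj_trivial] at h2 hez
    rw [hH]
    refine le_antisymm ?_ ?_
    · rw [← hez]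
      exact mul_le_mul_of_nonneg_left h1 hr.le
    · rw [← he]
      exact h2
  have hN₁ : volume {p : 𝔼 | (p, ‖p‖ - c) ∈ S₁} = 0 := by
    refine volume_setOf_norm_sub_mem_eq_zero hS₁0 ?_ (fun t h => h.1 rfl) c
    rintro p t ⟨hp, y, hy, z, hz, hne, h1, h2, h3, h4⟩ r hr
    refine ⟨smul_ne_zero hr.ne' hp, y, hy, z, hz, hne, h1, h2, ?_, ?_⟩
    · simp only at h3 ⊢
      rw [inner_smul_left, conj_trivial, hHsmul t p r hr, h3]
    · simp only at h4 ⊢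
      rw [inner_smul_left, conj_trivial, hHsmul t p r hr, h4]
  have hN₂ : volume {p : 𝔼 | (p, ‖p‖ - c) ∈ S₂} = 0 := by
    refine volume_setOf_norm_sub_mem_eq_zero hS₂0 ?_ (fun t h => h.1 rfl) c
    rintro p t ⟨hp, htt, x, h1, h2, h3, h4, h5⟩ r hr
    refine ⟨smul_ne_zero hr.ne' hp, htt, x, h1, h2, h3, h4, ?_⟩
    simp only at h5 ⊢
    rw [inner_smul_left, conj_trivial, hHsmul t p r hr, h5]
  have hcover : B ⊆ levelNormalMap v c '' strictContactSet A v t₀ ∪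
      ({p : 𝔼 | (p, ‖p‖ - c) ∈ S₁} ∪ {p : 𝔼 | (p, ‖p‖ - c) ∈ S₂}) := by
    intro p hp
    by_contra hbad
    simp only [mem_union, not_or] at hbad
    obtain ⟨hbad0, hbad1, hbad2⟩ := hbad
    obtain ⟨hp0, ht0, ht1⟩ := hB p hp
    set t : ℝ := ‖p‖ - c with ht
    have hpp : 0 < ‖p‖ := norm_pos_iff.2 hp0
    obtain ⟨x, hx, htx, he⟩ := exists_eq_superlevelSupport hK hc ht₁ t p
    rw [← hH] at he
    have hmin : min t t₁ = t := min_eq_left ht1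
    have htx' : t ≤ v x := hmin ▸ htx
    have hxint : x ∈ interior A := by
      by_contra h
      have := hfr x ⟨hx, h⟩
      linarith
    have hAx : A ∈ 𝓝 x := mem_interior_iff_mem_nhds.1 hxint
    have hKx : closure A ∈ 𝓝 x := mem_of_superset hAx subset_closure
    have hvx := contDiffAt_of_mem_interior hv hxint
    have hvd : DifferentiableAt ℝ v x := hvx.differentiableAt (by norm_num)
    have hg0 : ∇ v x ≠ 0 := fun h => hbad2 ⟨hp0, ht1, x, hKx, htx', hvx, h, he⟩
    have hle : ∀ y ∈ closure A, t ≤ v y → inner ℝ p y ≤ inner ℝ p x := fun y hy hty => by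
      rw [he]
      exact le_superlevelSupport hK p hy (by rwa [hmin])
    -- If `v x > t`, the interior point `x` could be pushed along `p` without leaving the superlevel
    -- set, increasing `⟪p, ·⟫`.
    have hvt : v x = t := by
      by_contra hne
      have hlt : t < v x := lt_of_le_of_ne htx' (Ne.symm hne)
      have hcs : Tendsto (fun s : ℝ => x + s • p) (𝓝[>] 0) (𝓝 x) := by
        have : Tendsto (fun s : ℝ => x + s • p) (𝓝 0) (𝓝 (x + (0 : ℝ) • p)) :=
          (continuous_const.add (continuous_id.smul continuous_const)).tendsto 0
        rw [zero_smul, add_zero] at this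
        exact this.mono_left nhdsWithin_le_nhds
      obtain ⟨s, ⟨h1, h2⟩, h3⟩ := (((hcs.eventually hKx).and (hcs.eventually
        (hvd.continuousAt.eventually (lt_mem_nhds hlt)))).and self_mem_nhdsWithin).exists
      have hs : 0 < s := h3
      have h4 := hle _ h1 h2.le
      rw [inner_add_right, inner_smul_right, real_inner_self_eq_norm_sq] at h4
      have : 0 < s * ‖p‖ ^ 2 := by positivity
      linarith
    have hn := norm_neg_inv_smul_self hg0
    have hg := eq_neg_norm_smul_neg_inv_smul hg0
    have hnormal : IsUnitOuterNormal (convexHull ℝ {y | y ∈ A ∧ v x ≤ v y}) x (‖p‖⁻¹ • p) := by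
      refine isUnitOuterNormal_convexHull ?_ fun y hy => ?_
      · rw [norm_smul, norm_inv, norm_norm, inv_mul_cancel₀ hpp.ne']
      · rw [inner_smul_left, inner_sub_right, conj_trivial]
        have h1 := hle y (subset_closure hy.1) (hvt ▸ hy.2)
        exact mul_nonpos_of_nonneg_of_nonpos (inv_nonneg.2 hpp.le) (by linarith)
    have heq := hnormal.eq_of_gradient hAx hn (norm_pos_iff.2 hg0) hvd hg
    have hpg : ∇ v x = -((‖∇ v x‖ * ‖p‖⁻¹) • p) := by
      rw [mul_smul, heq]
      exact hg
    refine hbad0 ⟨x, ⟨⟨hxint, by rw [hvt]; exact ht0, hg0⟩, fun y hy hxy hne => ?_⟩, ?_⟩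
    · have h1 := hle y hy (hvt ▸ hxy)
      have h2 : inner ℝ p y ≠ inner ℝ p x := fun h => hbad1
        ⟨hp0, y, hy, x, hx, hne, by
          show min t t₁ ≤ v y
          rwa [hmin, ← hvt], htx, h.trans he, he⟩
      have h3 : inner ℝ p y < inner ℝ p x := lt_of_le_of_ne h1 h2
      rw [hpg, inner_neg_left, inner_smul_left, inner_sub_right, conj_trivial]
      have h4 : 0 < ‖∇ v x‖ * ‖p‖⁻¹ := mul_pos (norm_pos_iff.2 hg0) (inv_pos.2 hpp)
      nlinarith
    · have h1 : v x + c = ‖p‖ := by rw [hvt, ht]; ring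
      rw [levelNormalMap, h1, ← smul_neg, ← heq, smul_smul, mul_inv_cancel₀ hpp.ne', one_smul]
  calc volume B ≤ volume (levelNormalMap v c '' strictContactSet A v t₀ ∪
      ({p : 𝔼 | (p, ‖p‖ - c) ∈ S₁} ∪ {p : 𝔼 | (p, ‖p‖ - c) ∈ S₂})) := measure_mono hcover
    _ ≤ _ + 0 := (measure_union_le _ _).trans_eq (by rw [measure_union_null hN₁ hN₂])
    _ = _ := add_zero _

theorem level_curvature_maximum_principle (d : ℕ) [NeZero d] :
    ∃ C : ℝ≥0, ∀ (A : Set (EuclideanSpace ℝ (Fin d))) (v : EuclideanSpace ℝ (Fin d) → ℝ),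
      A.Nonempty → Bornology.IsBounded A →
      ContinuousOn v (closure A) → ContDiffOn ℝ 2 v (interior A) →
      ((sSup (v '' A) : ℝ) : EReal) ≤
        ((sSup (v '' frontier A) : ℝ) : EReal) +
          (((C : ℝ≥0∞) * ∫⁻ x in levelContactSet A (fun y => -v y),
            ENNReal.ofReal (‖∇ v x‖ * superlevelHullCurvature A v x) : ℝ≥0∞) : EReal) := by
  set ω : ℝ≥0∞ := volume (Metric.ball (0 : EuclideanSpace ℝ (Fin d)) 1) with hω
  have hω0 : ω ≠ 0 := (Metric.measure_ball_pos volume _ one_pos).ne'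
  have hωt : ω ≠ ⊤ := measure_ball_lt_top.ne
  have hCt : ENNReal.ofReal (2 ^ (2 * d - 1)) * ω⁻¹ ≠ ⊤ :=
    ENNReal.mul_ne_top ENNReal.ofReal_ne_top (ENNReal.inv_ne_top.2 hω0)
  -- The constant comes from `ω (M/2)^d ≤ (2M)^(d-1) I`, that is, `M ≤ 2^(2d-1) ω⁻¹ I`.
  refine ⟨(ENNReal.ofReal (2 ^ (2 * d - 1)) * ω⁻¹).toNNReal, fun A v hne hb hc hv => ?_⟩
  rw [ENNReal.coe_toNNReal hCt]
  refine EReal.coe_le_coe_add_coe_ennreal ?_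
  set I : ℝ≥0∞ := ∫⁻ x in levelContactSet A (fun y => -v y),
            ENNReal.ofReal (‖∇ v x‖ * superlevelHullCurvature A v x) with hI
  set t₀ : ℝ := sSup (v '' frontier A) with ht₀
  have hK : IsCompact (closure A) := hb.isCompact_closure
  obtain ⟨y₁, hy₁, hmax⟩ := hK.exists_isMaxOn hne.closure hc
  set t₁ : ℝ := v y₁ with ht₁
  have hle : ∀ y ∈ closure A, v y ≤ t₁ := fun y hy => hmax hy
  have hsup : sSup (v '' A) ≤ t₁ := by
    refine csSup_le (hne.image v) ?_
    rintro _ ⟨y, hy, rfl⟩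
    exact hle y (subset_closure hy)
  have hfr : ∀ y ∈ frontier A, v y ≤ t₀ := fun y hy =>
    le_csSup ⟨t₁, by rintro _ ⟨z, hz, rfl⟩; exact hle z hz.1⟩ ⟨y, hy, rfl⟩
  refine (ENNReal.ofReal_le_ofReal (sub_le_sub_right hsup _)).trans ?_
  rcases le_or_gt t₁ t₀ with h | h
  · rw [ENNReal.ofReal_of_nonpos (by linarith)]
    exact zero_le
  set M : ℝ := t₁ - t₀ with hM
  have hM0 : 0 < M := by linarith
  -- With this shift the levels between `t₀` and `t₁` correspond to `M < ‖p‖ < 2M`, a shell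
  -- containing the ball of radius `M/2` about a point of norm `3M/2`.
  set c : ℝ := M - t₀ with hcdef
  set i : Fin d := ⟨0, NeZero.pos d⟩
  set q : EuclideanSpace ℝ (Fin d) := (3 / 2 * M) • EuclideanSpace.single i (1 : ℝ) with hq
  have hqn : ‖q‖ = 3 / 2 * M := by
    simp only [hq, norm_smul, PiLp.norm_single, norm_one, mul_one]
    rw [Real.norm_of_nonneg (by positivity)]
  have h1 : volume (Metric.ball q (M / 2)) ≤
      volume (levelNormalMap v c '' strictContactSet A v t₀) := by
    refine volume_le_volume_image_levelNormalMap hb hc hv hfr ⟨y₁, hy₁, le_rfl⟩ fun p hp => ?_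
    have h2 : ‖p - q‖ < M / 2 := mem_ball_iff_norm.1 hp
    have h3 := abs_norm_sub_norm_le p q
    rw [hqn] at h3
    have h4 := abs_lt.1 (h3.trans_lt h2)
    refine ⟨norm_pos_iff.1 (by linarith [h4.1]), by linarith [h4.1], by linarith [h4.2]⟩
  have h2 := h1.trans (volume_image_levelNormalMap_le hb hc hv (R := 2 * M) fun x hx => by
    have h5 := hx.1.2.1
    have h6 := hle x (subset_closure (interior_subset hx.1.1))
    rw [abs_le]
    constructor <;> linarith)
  rw [Measure.addHaar_ball _ _ (by positivity), finrank_euclideanSpace_fin, ← hω, ← hI] at h2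
  have hd : d = (d - 1) + 1 := (Nat.succ_pred_eq_of_pos (NeZero.pos d)).symm
  have hpow : (0 : ℝ) < M ^ (d - 1) / 2 ^ d := by positivity
  have e1 : (M / 2) ^ d = M ^ (d - 1) / 2 ^ d * M := by
    rw [div_pow]
    nth_rewrite 1 [hd]
    rw [pow_succ]
    ring
  have e2 : (2 * M) ^ (d - 1) = M ^ (d - 1) / 2 ^ d * 2 ^ (2 * d - 1) := by
    have : 2 * d - 1 = (d - 1) + d := by omega
    rw [mul_pow, this, pow_add]
    field_simp
  rw [e1, e2, ENNReal.ofReal_mul hpow.le, ENNReal.ofReal_mul hpow.le, mul_assoc, mul_assoc] at h2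
  have h3 : ENNReal.ofReal M * ω ≤ ENNReal.ofReal (2 ^ (2 * d - 1)) * I :=
    (ENNReal.mul_le_mul_iff_right (ENNReal.ofReal_pos.2 hpow).ne' ENNReal.ofReal_ne_top).1 h2
  have h4 := (ENNReal.le_div_iff_mul_le (Or.inl hω0) (Or.inl hωt)).2 h3
  refine h4.trans (le_of_eq ?_)
  rw [div_eq_mul_inv]
  ring

end

/-! ### The two maximum principles together -/

theorem mainTheorem6 (d : ℕ) [NeZero d] :
    (∃ C : ℝ≥0, ∀ (A : Set (EuclideanSpace ℝ (Fin d))) (v : EuclideanSpace ℝ (Fin d) → ℝ),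
      A.Nonempty → Convex ℝ A → Bornology.IsBounded A →
      ContinuousOn v (closure A) → ContDiffOn ℝ 2 v (interior A) →
      ((sSup (v '' A) : ℝ) : EReal) ≤
        ((sSup (v '' frontier A) : ℝ) : EReal) +
          (((C : ℝ≥0∞) * ∫⁻ x in levelContactSet A (fun y => -v y),
            ENNReal.ofReal (‖∇ v x‖ * superlevelHullCurvature A v x) : ℝ≥0∞) : EReal)) ∧
    (∀ Q : Set (EuclideanSpace ℝ (Fin d)),
      Q.Nonempty → Q ⊆ upperHemisphere d → SphericallyConvex Q →
      (∃ ε : ℝ, 0 < ε ∧ ∀ q ∈ Q, ∀ p ∈ equatorSphere d, ε ≤ dist q p) →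
      ∃ C₁ C₂ : ℝ≥0, 0 < C₁ ∧ 0 < C₂ ∧
        ∀ (R₁ R₂ : ℝ) (f : EuclideanSpace ℝ (Fin d) → ℝ),
          0 ≤ R₁ → R₁ ≤ R₂ →
          ContinuousOn f (closure (sphericalCylinder R₁ R₂ Q)) →
          ContDiffOn ℝ 2 f (interior (sphericalCylinder R₁ R₂ Q)) →
          0 ≤ sSup (f '' parabolicBoundary R₁ R₂ Q) →
          ((sSup (f '' sphericalCylinder R₁ R₂ Q) : ℝ) : EReal) ≤
            (((C₁ : ℝ) * sSup (f '' parabolicBoundary R₁ R₂ Q) : ℝ) : EReal) +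
              (((C₂ : ℝ≥0∞) *
                (∫⁻ x in parabolicContactSet (sphericalCylinder R₁ R₂ Q) f,
                  ENNReal.ofReal
                    (|radialDeriv f x * (angularOperator f x).det| / ‖x‖ ^ (d - 1))) ^
                  (1 / (d : ℝ)) : ℝ≥0∞) : EReal)) := by
  refine ⟨?_, fun Q hne hQ _ hdist => spherical_parabolic_maximum_principle Q hne hQ hdist⟩
  obtain ⟨C, hC⟩ := level_curvature_maximum_principle d
  exact ⟨C, fun A v hne _ hb hc hv => hC A v hne hb hc hv⟩
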